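/- **Setting.** Let $\mathbb{R}^{2,3}$ be $\mathbb{R}^5$ with coordinates $(x_0,\dots,x_4)$, its standard volume form $dV$, and the scalar product $\langle x,y\rangle=-x_0y_0-x_1y_1+x_2y_2+x_3y_3+x_4y_4$. A nonzero isotropic bivector $X\wedge Y$ ($\langle X,X\rangle=\langle Y,Y\rangle=\langle X,Y\rangle=0$) is *future directed* if $dV(X,Y,e_2,e_3,e_4)>0$, where $(e_0,\dots,e_4)$ is the standard basis. Let $A^\uparrow_+(2,3)$ be the group of linear isometries preserving orientation and time-orientation. A positively oriented basis $(B_0,\dots,B_4)$ is - a *Möbius basis* if its Gram matrix has non-zero entries $\langle B_0,B_4\rangle=\langle B_1,B_1\rangle=-1$, $\langle B_2,B_2\rangle=\langle B_3,B_3\rangle=1$ only (up to symmetry), and $B_0\wedge(B_1+B_2)$ is future directed; - a *Poincaré basis* if its Gram matrix is $\mathrm{diag}(-1,-1,1,1,1)$ and $(B_0-B_4)\wedge(B_1+B_2)$ is future directed; - a *Lie basis* if its Gram matrix has non-zero entries $\langle B_0,B_4\rangle=\langle B_1,B_3\rangle=-1$, $\langle B_2,B_2\rangle=1$ only (up to symmetry),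 and $B_1\wedge B_0$ is future directed; equivalently $(B_0,\dots,B_4)=\bigl(M_0,\tfrac{-M_1+M_3}{\sqrt2},M_2,\tfrac{-M_1-M_3}{\sqrt2},M_4\bigr)$ for a Möbius basis $M$. The Einstein universe is $\mathcal{E}^{1,2}=\{x_0^2+x_1^2=1=x_2^2+x_3^2+x_4^2\}$, identified with the set of null rays $[X]$ of $\mathbb{R}^{2,3}$; $A^\uparrow_+(2,3)$ acts on it. A *timelike curve* is a smooth $\gamma:I\to\mathcal{E}^{1,2}$, $I$ a nonempty open interval, with $\langle\gamma',\gamma'\rangle<0$ and $\gamma_0\gamma_1'-\gamma_1\gamma_0'>0$. With $\pi_{\mathcal N}$ the orthogonal projection onto $\mathrm{span}(\gamma,\gamma',\gamma'')^\perp$, its *strain density* is $\upsilon_\gamma=\bigl(\langle\pi_{\mathcal N}\gamma''',\pi_{\mathcal N}\gamma'''\rangle/|\langle\gamma',\gamma'\rangle|\bigr)^{1/4}$; $\gamma$ is *generic* if $\upsilon_\gamma$ has no zero. A generic curve has *conformal curvatures* $(k,h)$ if there is a smooth field $M=(M_0,\dots,M_4)$ of Möbius bases along $\gamma$ such that $M_0$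 is a positive multiple of $\gamma$ and $$M_0'=\upsilon_\gamma M_1,\quad M_1'=-\upsilon_\gamma(hM_0+M_4),\quad M_2'=\upsilon_\gamma(M_0+kM_3),\quad M_3'=-\upsilon_\gamma kM_2,\quad M_4'=\upsilon_\gamma(hM_1+M_2).$$ Changes of parameter are smooth diffeomorphisms of intervals. Two curves are *conformally equivalent* if they agree up to an element of $A^\uparrow_+(2,3)$ and a change of parameter. A generic curve is *maximal* if it is not a reparametrization of a proper arc of a larger generic timelike curve (for the conformal parameter: its interval of definition is maximal). **Classes.** Consider the following strata $C_i$ of pairs $(k,h)$, domains $\Omega_i$ of pairs $(a,b)$, and curves $\gamma_{(a,b)}$. - $C_1$: $-2<k^2-2h<2$, $k>0$. $\Omega_1$: $-1<a<1$, $b>0$, $(1+b+a(b-1))(b-1+a(1+b))<0$. In a Lie basis $(L_0,\dots,L_4)$, $$\gamma_{(a,b)}(t)=e^{b(t-\pi/4)}(\cos t+a\sin t)L_0-e^{-b(t-\pi/4)}(\sin t+a\cos t)L_1-\sqrt{2(1-a^2)}\,L_2+e^{b(t-\pi/4)}(a\cos t-\sin t)L_3+e^{-b(t-\pi/4)}(\cos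 t-a\sin t)L_4.$$ - $C_{2.i}$: $k^2-2h<-2$, $k>0$. $\Omega_{2.i}=(0,1)\times(0,1)$. In a Poincaré basis $(P_0,\dots,P_4)$, $$\gamma_{(a,b)}(t)=\cos t\,P_0+\sin t\,P_1+aP_2+\sqrt{1-a^2}\cos(bt)P_3-\sqrt{1-a^2}\sin(bt)P_4.$$ - $C_{2.ii}$: $k^2-2h>2$, $h>-\frac1{2k^2}$, $k>1$. $\Omega_{2.ii}$: $0<a<1$, $b>1$, $(1-a^2)b^2<1$. In a Poincaré basis, $$\gamma_{(a,b)}(t)=\cos t\,P_0+\sin t\,P_1-aP_2+\sqrt{1-a^2}\cos(bt)P_3+\sqrt{1-a^2}\sin(bt)P_4.$$ - $C_3$: $0<k<1$, $-\frac1{2k^2}<h<\frac{k^2-2}2$. $\Omega_3$: $a>\frac14$, $b>1$, $4a(b^2-1)-(b^2+1)>0$. In a Lie basis, $$\gamma_{(a,b)}(t)=\tfrac{1+4a}4e^tL_0+e^{-bt}L_1-L_2+\tfrac{1-4a}4e^{bt}L_3+e^{-t}L_4.$$ - $C_4$: $h<-\frac1{2k^2}$, $k>0$. $\Omega_4$: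 $0<a<1$, $b>0$, $a^2+(a^2-1)b^2>0$. In a Poincaré basis, $$\gamma_{(a,b)}(t)=P_0+a\sinh t\,P_1-a\cosh t\,P_2+\sqrt{1-a^2}\cos(bt)P_3+\sqrt{1-a^2}\sin(bt)P_4.$$ **Theorem.** For each of the five classes $i$: 1. Let $\gamma:I\to\mathcal{E}^{1,2}$ be a generic timelike curve with constant conformal curvatures $(k,h)\in C_i$. There is exactly one $(a,b)\in\Omega_i$ such that, for some basis of the kind of the class and some change of parameter $f$ from $I$ onto an open interval, $\gamma(s)=[\gamma_{(a,b)}(f(s))]$ for all $s\in I$. For every $s_0\in I$ there is exactly one such basis for which $f$ can be chosen with $f(s_0)=0$. If $\gamma$ is maximal, then always $f(I)=\mathbb{R}$. 2. For every $(a,b)\in\Omega_i$ and every basis of the kind of the class, $\mathbb{R}\ni t\mapsto[\gamma_{(a,b)}(t)]$ is a maximal generic timelike curve with constant conformal curvatures, which depend only on $(a,b)$, and $(a,b)\mapsto(k,h)$ is a diffeomorphism of $\Omega_i$ onto $C_i$. 3. A generic timelike curve is maximal with constant conformal curvatures in $C_i$ if and only if it is conformally equivalent to $\mathbb{R}\ni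 t\mapsto[\gamma_{(a,b)}(t)]$, written in the standard basis of the kind of the class, for exactly one $(a,b)\in\Omega_i$. (The standard Poincaré basis is $(e_0,\dots,e_4)$; the standard Lie basis comes from the Möbius basis $\bigl(\tfrac{e_0-e_4}{\sqrt2},e_1,e_2,e_3,\tfrac{e_0+e_4}{\sqrt2}\bigr)$ as above.) -/

import Mathlib

open Set
open scoped ContDiff

noncomputable section

namespace EinsteinUniverse

/-! ### The space `ℝ^{2,3}` -/

/-- The underlying vector space of `ℝ^{2,3}`, in the coordinates `(x₀, …, x₄)` of the standard
Poincaré basis. The volume form is the determinant in these coordinates. -/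
abbrev V : Type := Fin 5 → ℝ

/-- The scalar product of signature `(2,3)` (two minus signs). -/
def ip (x y : V) : ℝ :=
  -(x 0 * y 0) - x 1 * y 1 + x 2 * y 2 + x 3 * y 3 + x 4 * y 4

/-- The standard Poincaré basis `P^o`. -/
def stdPoincare : Fin 5 → V := fun i => Pi.single i 1

/-- The volume form `dV`. -/
def vol (B : Fin 5 → V) : ℝ := Matrix.det (Matrix.of B)

/-- The bivector `X ∧ Y` is isotropic (and nonzero). -/
def IsIsotropicBivector (X Y : V) : Prop :=
  LinearIndependent ℝ ![X, Y] ∧ ip X X = 0 ∧ ip Y Y = 0 ∧ ip X Y = 0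

/-- The isotropic bivector `X ∧ Y` is future directed: `dV(X, Y, V₁, V₂, V₃) > 0`, where
`V₁, V₂, V₃` is the oriented basis `P^o_2, P^o_3, P^o_4` of a spacelike `3`-space. -/
def IsFutureBivector (X Y : V) : Prop :=
  IsIsotropicBivector X Y ∧ 0 < vol ![X, Y, stdPoincare 2, stdPoincare 3, stdPoincare 4]

/-- The group `A^↑_+(2,3)` of linear isometries preserving orientation and time-orientation,
that is, the restricted conformal group of the Einstein universe. -/
structure IsAutomorphism (F : V ≃ₗ[ℝ] V) : Prop where
  isometry : ∀ x y, ip (F x) (F y) = ip x y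
  orientation : 0 < LinearMap.det (F : V →ₗ[ℝ] V)
  timeOrientation : ∀ X Y, IsFutureBivector (F X) (F Y) ↔ IsFutureBivector X Y

/-- Gram matrix of a Möbius basis. -/
def mobiusGram : Matrix (Fin 5) (Fin 5) ℝ :=
  !![ 0,  0, 0, 0, -1;
      0, -1, 0, 0,  0;
      0,  0, 1, 0,  0;
      0,  0, 0, 1,  0;
     -1,  0, 0, 0,  0]

/-- Gram matrix of a Poincaré basis. -/
def poincareGram : Matrix (Fin 5) (Fin 5) ℝ := Matrix.diagonal ![-1, -1, 1, 1, 1]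

/-- Gram matrix of a Lie basis. -/
def lieGram : Matrix (Fin 5) (Fin 5) ℝ :=
  !![ 0,  0, 0,  0, -1;
      0,  0, 0, -1,  0;
      0,  0, 1,  0,  0;
      0, -1, 0,  0,  0;
     -1,  0, 0,  0,  0]

/-- Möbius bases. -/
structure IsMobiusBasis (B : Fin 5 → V) : Prop where
  gram : ∀ i j, ip (B i) (B j) = mobiusGram i j
  orientation : 0 < vol B
  future : IsFutureBivector (B 0) (B 1 + B 2)

/-- Poincaré bases. -/
structure IsPoincareBasis (B : Fin 5 → V) : Prop where
  gram : ∀ i j, ip (B i) (B j) = poincareGram i j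
  orientation : 0 < vol B
  future : IsFutureBivector (B 0 - B 4) (B 1 + B 2)

/-- Lie bases. With the time-orientation below (`B 1 ∧ B 0 = -(B 0 ∧ B 1)` is future directed)
these are exactly the bases `M · T` with `M` a Möbius basis and `T` the transition matrix
`(M₀, (-M₁ + M₃)/√2, M₂, (-M₁ - M₃)/√2, M₄)`. -/
structure IsLieBasis (B : Fin 5 → V) : Prop where
  gram : ∀ i j, ip (B i) (B j) = lieGram i j
  orientation : 0 < vol B
  future : IsFutureBivector (B 1) (B 0)

/-- The standard Möbius basis `M^o`: `P^o_0 = (M^o_0 + M^o_4)/√2`, `P^o_4 = (M^o_4 - M^o_0)/√2`,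
`P^o_i = M^o_i` for `i = 1, 2, 3`. -/
def stdMobius : Fin 5 → V :=
  ![(1 / √2) • (stdPoincare 0 - stdPoincare 4), stdPoincare 1, stdPoincare 2, stdPoincare 3,
    (1 / √2) • (stdPoincare 0 + stdPoincare 4)]

/-- The standard Lie basis `L^o`. -/
def stdLie : Fin 5 → V :=
  ![stdMobius 0, (1 / √2) • (-stdMobius 1 + stdMobius 3), stdMobius 2,
    (1 / √2) • (-stdMobius 1 - stdMobius 3), stdMobius 4]

/-! ### The Einstein universe and its timelike curves -/

/-- The Einstein universe `S¹ × S² ⊂ ℝ^{2,3}`. -/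
def einstein : Set V :=
  {x | x 0 ^ 2 + x 1 ^ 2 = 1 ∧ x 2 ^ 2 + x 3 ^ 2 + x 4 ^ 2 = 1}

/-- The point of the Einstein universe on the null ray `[v]`, for a nonzero null vector `v`. -/
def proj (v : V) : V := (√(v 0 ^ 2 + v 1 ^ 2))⁻¹ • v

theorem proj_spec {v : V} (hv : v ≠ 0) (h0 : ip v v = 0) :
    proj v ∈ einstein ∧ ∃ r : ℝ, 0 < r ∧ proj v = r • v := by
  have hs : v 0 ^ 2 + v 1 ^ 2 = v 2 ^ 2 + v 3 ^ 2 + v 4 ^ 2 := by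
    unfold ip at h0; nlinarith
  have hpos : 0 < v 0 ^ 2 + v 1 ^ 2 := by
    rcases (add_nonneg (sq_nonneg (v 0)) (sq_nonneg (v 1))).lt_or_eq with h | h
    · exact h
    · exfalso
      apply hv
      funext i
      fin_cases i <;> simp <;> nlinarith [sq_nonneg (v 0), sq_nonneg (v 1), sq_nonneg (v 2),
        sq_nonneg (v 3), sq_nonneg (v 4)]
  have hq : (√(v 0 ^ 2 + v 1 ^ 2))⁻¹ ^ 2 * (v 0 ^ 2 + v 1 ^ 2) = 1 := by
    rw [inv_pow, Real.sq_sqrt hpos.le, inv_mul_cancel₀ hpos.ne']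
  refine ⟨⟨?_, ?_⟩, _, inv_pos.mpr (Real.sqrt_pos.mpr hpos), rfl⟩
  · simp only [proj, Pi.smul_apply, smul_eq_mul]
    nlinarith [hq]
  · simp only [proj, Pi.smul_apply, smul_eq_mul]
    rw [hs] at hq ⊢
    nlinarith [hq]

/-- Nonempty open intervals of the real line (possibly unbounded). -/
structure IsOpenInterval (I : Set ℝ) : Prop where
  isOpen : IsOpen I
  ordConnected : I.OrdConnected
  nonempty : I.Nonempty

/-- `γ : I → 𝓔^{1,2}` is a smooth future-directed timelike curve: `⟨γ', γ'⟩ < 0` and the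
time-component rotates counterclockwise. -/
structure IsTimelikeCurve (γ : ℝ → V) (I : Set ℝ) : Prop where
  interval : IsOpenInterval I
  smooth : ContDiffOn ℝ ∞ γ I
  mem : ∀ t ∈ I, γ t ∈ einstein
  timelike : ∀ t ∈ I, ip (deriv γ t) (deriv γ t) < 0
  future : ∀ t ∈ I, 0 < γ t 0 * deriv γ t 1 - γ t 1 * deriv γ t 0

/-- The conformal osculating space, spanned by `γ`, `γ'`, `γ''`. -/
def osculatingSpace (γ : ℝ → V) (t : ℝ) : Submodule ℝ V :=
  Submodule.span ℝ {γ t, iteratedDeriv 1 γ t, iteratedDeriv 2 γ t}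

open Classical in
/-- The orthogonal projection of `w` onto the orthogonal complement of `T`, for a subspace `T` on
which the scalar product is nondegenerate (see `normalPart_eq`). -/
def normalPart (T : Submodule ℝ V) (w : V) : V :=
  if H : ∃ n : V, (∀ x ∈ T, ip n x = 0) ∧ w - n ∈ T then H.choose else 0

theorem normalPart_eq {T : Submodule ℝ V} {w n : V}
    (hT : ∀ x ∈ T, (∀ y ∈ T, ip x y = 0) → x = 0)
    (hn : ∀ x ∈ T, ip n x = 0) (hw : w - n ∈ T) : normalPart T w = n := by
  have H : ∃ n : V, (∀ x ∈ T, ip n x = 0) ∧ w - n ∈ T := ⟨n, hn, hw⟩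
  rw [normalPart, dif_pos H]
  obtain ⟨h1, h2⟩ := H.choose_spec
  rw [← sub_eq_zero]
  apply hT
  · have := T.sub_mem hw h2
    simpa using this
  · intro y hy
    have e1 := h1 y hy
    have e2 := hn y hy
    simp only [ip, Pi.sub_apply] at e1 e2 ⊢
    linarith

/-- The strain density `(⟨π_N γ''', π_N γ'''⟩ / |⟨γ', γ'⟩|)^{1/4}`. -/
def strainDensity (γ : ℝ → V) (t : ℝ) : ℝ :=
  (ip (normalPart (osculatingSpace γ t) (iteratedDeriv 3 γ t))
      (normalPart (osculatingSpace γ t) (iteratedDeriv 3 γ t)) /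
    |ip (deriv γ t) (deriv γ t)|) ^ (1 / 4 : ℝ)

/-- Generic timelike curves: those without conformal vertices. -/
def IsGenericCurve (γ : ℝ → V) (I : Set ℝ) : Prop :=
  IsTimelikeCurve γ I ∧ ∀ t ∈ I, strainDensity γ t ≠ 0

/-! ### The canonical frame and the conformal curvatures -/

/-- The coefficient matrix of the conformal Frenet equations. -/
def frenetMatrix (k h : ℝ) : Matrix (Fin 5) (Fin 5) ℝ :=
  !![0, -h, 1,  0, 0;
     1,  0, 0,  0, h;
     0,  0, 0, -k, 1;
     0,  0, k,  0, 0;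
     0, -1, 0,  0, 0]

/-- `M` is a canonical conformal frame along `γ : I → 𝓔^{1,2}`, with conformal curvatures
`k, h`: a smooth field of Möbius bases with `M₀` on the ray of `γ`, which satisfies
`M' = υ M K(k, h)`, where `υ` is the strain density. -/
structure IsCanonicalFrame (γ : ℝ → V) (I : Set ℝ) (M : ℝ → Fin 5 → V) (k h : ℝ → ℝ) :
    Prop where
  smooth : ContDiffOn ℝ ∞ M I
  mobius : ∀ t ∈ I, IsMobiusBasis (M t)
  lift : ∀ t ∈ I, ∃ r : ℝ, 0 < r ∧ M t 0 = r • γ t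
  frenet : ∀ t ∈ I, ∀ j, deriv (fun s => M s j) t =
    strainDensity γ t • ∑ i, frenetMatrix (k t) (h t) i j • M t i

/-- `γ` is a homogeneous curve: a generic timelike curve with constant conformal curvatures
`kh = (k, h)`. -/
def HasConstantCurvatures (γ : ℝ → V) (I : Set ℝ) (kh : ℝ × ℝ) : Prop :=
  IsGenericCurve γ I ∧
    ∃ M : ℝ → Fin 5 → V, IsCanonicalFrame γ I M (fun _ => kh.1) (fun _ => kh.2)

/-- A change of parameter from the interval `I` onto the interval `J`. -/
structure IsParamChange (f : ℝ → ℝ) (I J : Set ℝ) : Prop where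
  bijOn : BijOn f I J
  smooth : ContDiffOn ℝ ∞ f I
  deriv_ne : ∀ s ∈ I, deriv f s ≠ 0

/-- The curve `γ : I → 𝓔^{1,2}` is not a reparametrization of a proper arc of a larger generic
timelike curve; for a curve parametrized by the conformal parameter this says that its interval
of definition is maximal. -/
def IsMaximalCurve (γ : ℝ → V) (I : Set ℝ) : Prop :=
  ∀ (δ : ℝ → V) (J J' : Set ℝ) (f : ℝ → ℝ), IsGenericCurve δ J → J' ⊆ J →
    IsParamChange f I J' → (∀ s ∈ I, γ s = δ (f s)) → J' = J

/-- Conformal equivalence of curves: `γ = F · δ ∘ f` with `F` in the restricted conformal group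
and `f : I → J` a change of parameter. -/
def ConformallyEquivalent (γ : ℝ → V) (I : Set ℝ) (δ : ℝ → V) (J : Set ℝ) : Prop :=
  ∃ (F : V ≃ₗ[ℝ] V) (f : ℝ → ℝ), IsAutomorphism F ∧ IsParamChange f I J ∧
    ∀ s ∈ I, γ s = proj (F (δ (f s)))

/-! ### The regular strata and the model curves -/

/-- The five regular classes. -/
inductive RegularClass : Type
  | C1 | C2i | C2ii | C3 | C4

namespace RegularClass

/-- The strata in the `(k, h)` half-plane. -/
def stratum : RegularClass → Set (ℝ × ℝ)
  | C1 => {x | -2 < x.1 ^ 2 - 2 * x.2 ∧ x.1 ^ 2 - 2 * x.2 < 2 ∧ 0 < x.1}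
  | C2i => {x | x.1 ^ 2 - 2 * x.2 < -2 ∧ 0 < x.1}
  | C2ii => {x | 2 < x.1 ^ 2 - 2 * x.2 ∧ -(1 / (2 * x.1 ^ 2)) < x.2 ∧ 1 < x.1}
  | C3 => {x | 0 < x.1 ∧ x.1 < 1 ∧ -(1 / (2 * x.1 ^ 2)) < x.2 ∧ x.2 < (x.1 ^ 2 - 2) / 2}
  | C4 => {x | x.2 < -(1 / (2 * x.1 ^ 2)) ∧ 0 < x.1}

/-- The parameter domains `Ω` of the pairs `(a, b)`. -/
def domain : RegularClass → Set (ℝ × ℝ)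
  | C1 => {p | -1 < p.1 ∧ p.1 < 1 ∧ 0 < p.2 ∧
      (1 + p.2 + p.1 * (p.2 - 1)) * (p.2 - 1 + p.1 * (1 + p.2)) < 0}
  | C2i => {p | 0 < p.1 ∧ p.1 < 1 ∧ 0 < p.2 ∧ p.2 < 1}
  | C2ii => {p | 0 < p.1 ∧ p.1 < 1 ∧ 1 < p.2 ∧ (1 - p.1 ^ 2) * p.2 ^ 2 < 1}
  | C3 => {p | 1 / 4 < p.1 ∧ 1 < p.2 ∧ 0 < 4 * p.1 * (p.2 ^ 2 - 1) - (p.2 ^ 2 + 1)}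
  | C4 => {p | 0 < p.1 ∧ p.1 < 1 ∧ 0 < p.2 ∧ 0 < p.1 ^ 2 + (p.1 ^ 2 - 1) * p.2 ^ 2}

/-- The kind of basis in which the curves of the class are written. -/
def IsBasis : RegularClass → (Fin 5 → V) → Prop
  | C1 => IsLieBasis
  | C2i => IsPoincareBasis
  | C2ii => IsPoincareBasis
  | C3 => IsLieBasis
  | C4 => IsPoincareBasis

/-- The standard basis of that kind. -/
def stdBasis : RegularClass → Fin 5 → V
  | C1 => stdLie
  | C2i => stdPoincare
  | C2ii => stdPoincare
  | C3 => stdLie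
  | C4 => stdPoincare

/-- The coordinates of `γ_{(a,b)}(t)`. -/
def coords : RegularClass → ℝ → ℝ → ℝ → Fin 5 → ℝ
  | C1, a, b, t =>
      ![Real.exp (b * (t - Real.pi / 4)) * (Real.cos t + a * Real.sin t),
        -(Real.exp (-(b * (t - Real.pi / 4))) * (Real.sin t + a * Real.cos t)),
        -√(2 * (1 - a ^ 2)),
        Real.exp (b * (t - Real.pi / 4)) * (a * Real.cos t - Real.sin t),
        Real.exp (-(b * (t - Real.pi / 4))) * (Real.cos t - a * Real.sin t)]
  | C2i, a, b, t =>
      ![Real.cos t, Real.sin t, a,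
        √(1 - a ^ 2) * Real.cos (b * t), -(√(1 - a ^ 2) * Real.sin (b * t))]
  | C2ii, a, b, t =>
      ![Real.cos t, Real.sin t, -a,
        √(1 - a ^ 2) * Real.cos (b * t), √(1 - a ^ 2) * Real.sin (b * t)]
  | C3, a, b, t =>
      ![(1 + 4 * a) / 4 * Real.exp t, Real.exp (-(b * t)), -1,
        (1 - 4 * a) / 4 * Real.exp (b * t), Real.exp (-t)]
  | C4, a, b, t =>
      ![1, a * Real.sinh t, -(a * Real.cosh t),
        √(1 - a ^ 2) * Real.cos (b * t), √(1 - a ^ 2) * Real.sin (b * t)]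

/-- The curve `t ↦ [γ_{(a,b)}(t)]` of the Einstein universe, for `p = (a, b)` and with
`γ_{(a,b)}` written in the basis `B`. -/
def model (c : RegularClass) (p : ℝ × ℝ) (B : Fin 5 → V) (t : ℝ) : V :=
  proj (∑ i, c.coords p.1 p.2 t i • B i)

/-- `B` is a basis of the kind of the class, and after the change of parameter `t = f s` from `I`
onto an interval, the curve `γ : I → 𝓔^{1,2}` is `t ↦ [γ_{(a,b)}(t)]`, written in `B`. -/
def IsModelParam (c : RegularClass) (γ : ℝ → V) (I : Set ℝ) (p : ℝ × ℝ) (B : Fin 5 → V)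
    (f : ℝ → ℝ) : Prop :=
  c.IsBasis B ∧ IsParamChange f I (f '' I) ∧ ∀ s ∈ I, γ s = c.model p B (f s)

end RegularClass

/-- `Φ` restricts to a smooth diffeomorphism of the open set `U` onto the open set `W`. -/
structure IsDiffeoOn (Φ : ℝ × ℝ → ℝ × ℝ) (U W : Set (ℝ × ℝ)) : Prop where
  isOpen_source : IsOpen U
  isOpen_target : IsOpen W
  bijOn : BijOn Φ U W
  smooth : ContDiffOn ℝ ∞ Φ U
  smooth_inv : ContDiffOn ℝ ∞ (Function.invFunOn Φ U) W

end EinsteinUniverse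

end

open EinsteinUniverse

/-!
# Homogeneous timelike curves of the Einstein universe

A generic timelike curve carries at most one canonical frame `M`: the velocity of the null vector
`M₀` on the ray of the curve fixes its scale, and each Frenet equation determines the next vector
of the frame or the next curvature (`IsFrenetFrame.unique`). The curvatures `k`, `h` are
therefore invariants of the curve under the restricted conformal group and changes of parameter.
When they are constant, the Frenet equations are, in the conformal parameter, linear with constant
coefficients, so that a frame is determined by one of its values (`IsFrenetFrame.eq_of_eq`), and the
restricted conformal group acts simply transitively on Möbius bases
(`IsMobiusBasis.exists_automorphism`). Hence two curves with the same constant curvatures differ by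
an element of the group and a change of parameter, both unique once a point of each curve is
singled out (`RegularClass.exists_modelParam`).

It remains to find the canonical frames of the model curves. Each model curve is an orbit of a
one-parameter group with a skew generator `A` (`RegularClass.gen`), whose characteristic polynomial
is `x⁵ + c₁ x³ + c₀ x`; that of the Frenet matrix is `x⁵ + (k² + 2h) x³ + (1 + 2hk²) x`. For
suitable `k`, `h` and a constant speed `l`, the canonical frame is an explicit combination of the derivatives
`γ, Aγ, …, A⁴γ` of the lift `γ` (`isFrenetFrame_krylovFrame`). The scalar products of these vectors
are constant along the curve, and, for all of them to be those of a Möbius basis, only `⟨Aγ, Aγ⟩`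
and `⟨A²γ, A²γ⟩` have to be compared with `k`, `h`, `l`, next to the two coefficients `c₁` and `c₀`.

That `(a, b) ↦ (k, h)` is a diffeomorphism is shown by factoring it into maps with explicit smooth
inverses (`RegularClass.isDiffeoOn_curvatures`),
`(a, b) ↦ (x, b) ↦ (k², x) ↦ (k², k² - 2h) ↦ (k, h)`,
where `x` is the root in `(0, 1)` of `x + 1/x = |k² - 2h|`, or the root in `(-1, 1)` of
`4x/(1 + x²) = k² - 2h` when `|k² - 2h| < 2`.

Two points are global. An isometry preserves the time orientation of all isotropic planes as soon as
it preserves that of one, because every isotropic plane is deformed through negative semidefinite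
planes to the timelike coordinate plane (`timeArea_map_pos_iff`). And a curve of infinite total
strain in both directions is maximal, because the strain density is a continuous density and an
extension would make the strain up to an end finite (`isMaximalCurve_of_strain`).
-/

namespace EinsteinUniverse

/-! ### The scalar product and the volume form -/

theorem ip_comm (x y : V) : ip x y = ip y x := by unfold ip; ring

theorem ip_add_left (x y z : V) : ip (x + y) z = ip x z + ip y z := by
  simp only [ip, Pi.add_apply]; ring

theorem ip_add_right (x y z : V) : ip x (y + z) = ip x y + ip x z := by
  simp only [ip, Pi.add_apply]; ring

theorem ip_smul_left (r : ℝ) (x y : V) : ip (r • x) y = r * ip x y := by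
  simp only [ip, Pi.smul_apply, smul_eq_mul]; ring

theorem ip_smul_right (r : ℝ) (x y : V) : ip x (r • y) = r * ip x y := by
  simp only [ip, Pi.smul_apply, smul_eq_mul]; ring

theorem ip_neg_left (x y : V) : ip (-x) y = -ip x y := by
  simp only [ip, Pi.neg_apply]; ring

theorem ip_neg_right (x y : V) : ip x (-y) = -ip x y := by
  simp only [ip, Pi.neg_apply]; ring

theorem ip_sub_left (x y z : V) : ip (x - y) z = ip x z - ip y z := by
  simp only [ip, Pi.sub_apply]; ring

theorem ip_sub_right (x y z : V) : ip x (y - z) = ip x y - ip x z := by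
  simp only [ip, Pi.sub_apply]; ring

/-- The scalar product as a bilinear form. -/
noncomputable def ipForm : LinearMap.BilinForm ℝ V :=
  LinearMap.mk₂ ℝ ip ip_add_left ip_smul_left ip_add_right ip_smul_right

@[simp] theorem ipForm_apply (x y : V) : ipForm x y = ip x y := rfl

theorem ip_sum_smul (x y : Fin 5 → ℝ) (B : Fin 5 → V) :
    ip (∑ i, x i • B i) (∑ j, y j • B j) = ∑ i, ∑ j, x i * y j * ip (B i) (B j) := by
  simp only [← ipForm_apply, map_sum, LinearMap.sum_apply, map_smul, LinearMap.smul_apply,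
    smul_eq_mul, Finset.mul_sum]
  rw [Finset.sum_comm]
  refine Finset.sum_congr rfl fun i _ => Finset.sum_congr rfl fun j _ => by ring

theorem linearIndependent_of_vol_ne {B : Fin 5 → V} (h : vol B ≠ 0) : LinearIndependent ℝ B := by
  have h2 : IsUnit (Matrix.of B) := (Matrix.isUnit_iff_isUnit_det _).2 (isUnit_iff_ne_zero.2 h)
  exact Matrix.linearIndependent_rows_iff_isUnit.2 h2

/-- The scalar product is nondegenerate: a vector orthogonal to a basis vanishes. -/
theorem eq_zero_of_ip_eq_zero {B : Fin 5 → V} (hB : vol B ≠ 0) {v : V}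
    (h : ∀ i, ip (B i) v = 0) : v = 0 := by
  have h1 : (Matrix.of B).mulVec ![-v 0, -v 1, v 2, v 3, v 4] = 0 := by
    funext i
    have := h i
    simp only [ip] at this
    simp [Matrix.mulVec, dotProduct, Fin.sum_univ_five]
    linarith
  have h2 := Matrix.eq_zero_of_mulVec_eq_zero hB h1
  funext i
  fin_cases i
  · simpa using congrFun h2 0
  · simpa using congrFun h2 1
  · simpa using congrFun h2 2
  · simpa using congrFun h2 3
  · simpa using congrFun h2 4

theorem vol_sum_smul (C : Matrix (Fin 5) (Fin 5) ℝ) (B : Fin 5 → V) :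
    vol (fun i => ∑ j, C i j • B j) = C.det * vol B := by
  unfold vol
  rw [← Matrix.det_mul]
  congr 1

theorem vol_map (F : V →ₗ[ℝ] V) (B : Fin 5 → V) :
    vol (fun i => F (B i)) = LinearMap.det F * vol B := by
  unfold vol
  rw [mul_comm, ← LinearMap.det_toMatrix', ← Matrix.det_transpose (LinearMap.toMatrix' F),
    ← Matrix.det_mul]
  congr 1
  ext i j
  have : F (B i) = (LinearMap.toMatrix' F).mulVec (B i) := by
    rw [← Matrix.toLin'_apply, Matrix.toLin'_toMatrix']
  simp [Matrix.mul_apply, this, Matrix.mulVec, dotProduct, mul_comm]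

/-! ### Time orientation -/

/-- The area, in the timelike coordinate plane, of the projection of the bivector `X ∧ Y`;
its sign decides whether an isotropic bivector is future directed. -/
def timeArea (X Y : V) : ℝ := X 0 * Y 1 - X 1 * Y 0

theorem vol_eq_timeArea (X Y : V) :
    vol ![X, Y, stdPoincare 2, stdPoincare 3, stdPoincare 4] = timeArea X Y := by
  unfold vol timeArea
  simp [Matrix.det_succ_row_zero, Fin.sum_univ_succ, stdPoincare, Fin.succAbove, Pi.single_apply]
  ring

theorem isFutureBivector_iff (X Y : V) :
    IsFutureBivector X Y ↔ IsIsotropicBivector X Y ∧ 0 < timeArea X Y := by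
  rw [IsFutureBivector, vol_eq_timeArea]

/-- A plane on which the scalar product is negative semidefinite projects isomorphically onto the
timelike coordinate plane. -/
theorem timeArea_ne_zero {U W : V} (hneg : ∀ α β : ℝ, ip (α • U + β • W) (α • U + β • W) ≤ 0)
    (hind : ∀ α β : ℝ, α • U + β • W = 0 → α = 0 ∧ β = 0) : timeArea U W ≠ 0 := by
  intro h
  have key : ∀ α β : ℝ, α * U 0 + β * W 0 = 0 → α * U 1 + β * W 1 = 0 → α = 0 ∧ β = 0 := by
    intro α β h0 h1
    apply hind
    have := hneg α β
    set v := α • U + β • W with hv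
    have e0 : v 0 = 0 := by simpa [hv] using h0
    have e1 : v 1 = 0 := by simpa [hv] using h1
    unfold ip at this
    rw [e0, e1] at this
    have e2 : v 2 = 0 := by nlinarith [sq_nonneg (v 2), sq_nonneg (v 3), sq_nonneg (v 4)]
    have e3 : v 3 = 0 := by nlinarith [sq_nonneg (v 2), sq_nonneg (v 3), sq_nonneg (v 4)]
    have e4 : v 4 = 0 := by nlinarith [sq_nonneg (v 2), sq_nonneg (v 3), sq_nonneg (v 4)]
    funext i
    fin_cases i <;> simp [e0, e1, e2, e3, e4]
  unfold timeArea at h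
  obtain ⟨a1, a2⟩ := key (W 0) (-U 0) (by ring) (by linarith)
  obtain ⟨a3, a4⟩ := key (W 1) (-U 1) (by linarith) (by ring)
  have := (key 1 0 (by linarith) (by linarith)).1
  exact one_ne_zero this

/-- A continuous function without zeros has constant sign on a connected set. -/
theorem pos_iff_of_ne_zero {S : Set ℝ} (hS : IsPreconnected S) {g : ℝ → ℝ}
    (hg : ContinuousOn g S) (hne : ∀ s ∈ S, g s ≠ 0) {s t : ℝ} (hs : s ∈ S) (ht : t ∈ S) :
    0 < g s ↔ 0 < g t := by
  have aux : ∀ s ∈ S, ∀ t ∈ S, 0 < g s → 0 < g t := by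
    intro s hs t ht h
    by_contra h'
    obtain ⟨x, hx, hx0⟩ := hS.intermediate_value ht hs hg ⟨not_lt.1 h', h.le⟩
    exact hne x hx hx0
  exact ⟨aux s hs t ht, aux t ht s hs⟩

theorem IsIsotropicBivector.ind {X Y : V} (h : IsIsotropicBivector X Y) (α β : ℝ)
    (h0 : α • X + β • Y = 0) : α = 0 ∧ β = 0 :=
  LinearIndependent.pair_iff.1 h.1 α β h0

theorem ip_comb_self (α β : ℝ) (X Y : V) : ip (α • X + β • Y) (α • X + β • Y) =
    α ^ 2 * ip X X + 2 * α * β * ip X Y + β ^ 2 * ip Y Y := by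
  simp only [ip, Pi.add_apply, Pi.smul_apply, smul_eq_mul]; ring

theorem IsIsotropicBivector.timeArea_ne_zero {X Y : V} (h : IsIsotropicBivector X Y) :
    timeArea X Y ≠ 0 :=
  EinsteinUniverse.timeArea_ne_zero
    (fun α β => by rw [ip_comb_self, h.2.1, h.2.2.1, h.2.2.2]; simp) h.ind

theorem isIsotropicBivector_map_iff {F : V ≃ₗ[ℝ] V} (hF : ∀ x y, ip (F x) (F y) = ip x y)
    (X Y : V) : IsIsotropicBivector (F X) (F Y) ↔ IsIsotropicBivector X Y := by
  unfold IsIsotropicBivector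
  simp only [hF]
  have : LinearIndependent ℝ ![F X, F Y] ↔ LinearIndependent ℝ ![X, Y] := by
    simp only [LinearIndependent.pair_iff, ← map_smul, ← map_add,
      LinearEquiv.map_eq_zero_iff]
  rw [this]

/-- An isometry either preserves or reverses the time orientation of all isotropic planes,
according to the sign of its timelike block: the isotropic plane `X ∧ Y` is deformed, through
negative semidefinite planes, to the timelike coordinate plane by shrinking the spacelike
coordinates. -/
theorem timeArea_map_pos_iff {F : V ≃ₗ[ℝ] V} (hF : ∀ x y, ip (F x) (F y) = ip x y) {X Y : V}
    (h : IsIsotropicBivector X Y) : 0 < timeArea (F X) (F Y) ↔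
      0 < timeArea (F (stdPoincare 0)) (F (stdPoincare 1)) * timeArea X Y := by
  have hXY := h.timeArea_ne_zero
  let S : ℝ → V → V := fun s v => ![v 0, v 1, s * v 2, s * v 3, s * v 4]
  have hS : ∀ s v, S s v = (v 0 • stdPoincare 0 + v 1 • stdPoincare 1) +
      s • (v 2 • stdPoincare 2 + v 3 • stdPoincare 3 + v 4 • stdPoincare 4) := by
    intro s v
    funext i
    fin_cases i <;> simp [S, stdPoincare]
  have hcont : ∀ v, Continuous fun s => F (S s v) := by
    intro v
    simp only [hS, map_add, map_smul]
    fun_prop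
  have hg : Continuous fun s => timeArea (F (S s X)) (F (S s Y)) := by
    have hX := fun i => (continuous_apply i).comp (hcont X)
    have hY := fun i => (continuous_apply i).comp (hcont Y)
    exact ((hX 0).mul (hY 1)).sub ((hX 1).mul (hY 0))
  have hcomb : ∀ s (α β : ℝ), α • S s X + β • S s Y = S s (α • X + β • Y) := by
    intro s α β
    funext i
    fin_cases i <;> simp [S] <;> ring
  have hne : ∀ s ∈ Icc (0 : ℝ) 1, timeArea (F (S s X)) (F (S s Y)) ≠ 0 := by
    intro s hs
    apply timeArea_ne_zero
    · intro α β
      rw [← map_smul, ← map_smul, ← map_add, hF, hcomb]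
      have h1 : ip (α • X + β • Y) (α • X + β • Y) = 0 := by
        rw [ip_comb_self, h.2.1, h.2.2.1, h.2.2.2]; ring
      generalize α • X + β • Y = v at h1
      simp only [ip, S] at h1 ⊢
      simp
      have h2 : s ^ 2 ≤ 1 := by nlinarith [hs.1, hs.2]
      nlinarith [mul_nonneg (sub_nonneg.2 h2) (add_nonneg (add_nonneg (sq_nonneg (v 2))
        (sq_nonneg (v 3))) (sq_nonneg (v 4)))]
    · intro α β h0
      rw [← map_smul, ← map_smul, ← map_add, LinearEquiv.map_eq_zero_iff, hcomb] at h0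
      have e0 : α * X 0 + β * Y 0 = 0 := by simpa [S] using congrFun h0 0
      have e1 : α * X 1 + β * Y 1 = 0 := by simpa [S] using congrFun h0 1
      unfold timeArea at hXY
      constructor
      · apply (mul_eq_zero.1 _).resolve_right hXY
        linear_combination Y 1 * e0 - Y 0 * e1
      · apply (mul_eq_zero.1 _).resolve_right hXY
        linear_combination X 0 * e1 - X 1 * e0
  have h01 := pos_iff_of_ne_zero isPreconnected_Icc hg.continuousOn hne
    (s := 1) (t := 0) (by simp) (by simp)
  have e1 : ∀ v, S 1 v = v := by
    intro v
    funext i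
    fin_cases i <;> simp [S]
  have e0 : timeArea (F (S 0 X)) (F (S 0 Y)) =
      timeArea (F (stdPoincare 0)) (F (stdPoincare 1)) * timeArea X Y := by
    simp only [hS, zero_smul, add_zero, map_add, map_smul, timeArea, Pi.add_apply, Pi.smul_apply,
      smul_eq_mul]
    ring
  rw [e0, e1, e1] at h01
  exact h01

/-! ### The restricted conformal group and adapted bases -/

/-- It suffices to test time orientation on a single isotropic bivector. -/
theorem isAutomorphism_of_future {F : V ≃ₗ[ℝ] V} (hF : ∀ x y, ip (F x) (F y) = ip x y)
    (hdet : 0 < LinearMap.det (F : V →ₗ[ℝ] V)) {X Y : V} (h : IsFutureBivector X Y)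
    (h' : IsFutureBivector (F X) (F Y)) : IsAutomorphism F := by
  rw [isFutureBivector_iff] at h h'
  have hpos := pos_of_mul_pos_left ((timeArea_map_pos_iff hF h.1).1 h'.2) h.2.le
  refine ⟨hF, hdet, fun Z W => ?_⟩
  rw [isFutureBivector_iff, isFutureBivector_iff, isIsotropicBivector_map_iff hF]
  refine and_congr_right fun hi => ?_
  rw [timeArea_map_pos_iff hF hi, mul_pos_iff_of_pos_left hpos]

/-- Two positively oriented bases with the same Gram matrix are related by an isometry. -/
theorem exists_isometry {B B' : Fin 5 → V} (hB : 0 < vol B) (hB' : 0 < vol B')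
    (hG : ∀ i j, ip (B' i) (B' j) = ip (B i) (B j)) :
    ∃ F : V ≃ₗ[ℝ] V, (∀ i, F (B i) = B' i) ∧ (∀ x y, ip (F x) (F y) = ip x y) ∧
      0 < LinearMap.det (F : V →ₗ[ℝ] V) := by
  let b := basisOfLinearIndependentOfCardEqFinrank (linearIndependent_of_vol_ne hB.ne') (by simp)
  let b' := basisOfLinearIndependentOfCardEqFinrank (linearIndependent_of_vol_ne hB'.ne') (by simp)
  have hb : ∀ i, b i = B i := fun i => by simp [b]
  have hb' : ∀ i, b' i = B' i := fun i => by simp [b']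
  let F : V ≃ₗ[ℝ] V := b.equiv b' (Equiv.refl _)
  have hF : ∀ i, F (B i) = B' i := fun i => by
    rw [← hb, ← hb']
    simp [F]
  refine ⟨F, hF, ?_, ?_⟩
  · have : ipForm.compl₁₂ (F : V →ₗ[ℝ] V) (F : V →ₗ[ℝ] V) = ipForm := by
      refine b.ext fun i => b.ext fun j => ?_
      simp only [LinearMap.compl₁₂_apply, ipForm_apply, LinearEquiv.coe_coe, hb, hF, hG]
    intro x y
    have := congrArg (fun q : LinearMap.BilinForm ℝ V => q x y) this
    simpa using this
  · have := vol_map (F : V →ₗ[ℝ] V) B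
    simp only [LinearEquiv.coe_coe, hF] at this
    rw [show (fun i => B' i) = B' from rfl] at this
    rw [this] at hB'
    exact pos_of_mul_pos_left hB' hB.le

theorem IsMobiusBasis.exists_automorphism {B B' : Fin 5 → V} (h : IsMobiusBasis B)
    (h' : IsMobiusBasis B') : ∃ F : V ≃ₗ[ℝ] V, IsAutomorphism F ∧ ∀ i, F (B i) = B' i := by
  obtain ⟨F, h1, h2, h3⟩ := exists_isometry h.orientation h'.orientation
    (fun i j => by rw [h.gram, h'.gram])
  refine ⟨F, isAutomorphism_of_future h2 h3 h.future ?_, h1⟩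
  simpa only [map_add, h1] using h'.future

theorem IsPoincareBasis.exists_automorphism {B B' : Fin 5 → V} (h : IsPoincareBasis B)
    (h' : IsPoincareBasis B') : ∃ F : V ≃ₗ[ℝ] V, IsAutomorphism F ∧ ∀ i, F (B i) = B' i := by
  obtain ⟨F, h1, h2, h3⟩ := exists_isometry h.orientation h'.orientation
    (fun i j => by rw [h.gram, h'.gram])
  refine ⟨F, isAutomorphism_of_future h2 h3 h.future ?_, h1⟩
  simpa only [map_add, map_sub, h1] using h'.future

theorem IsLieBasis.exists_automorphism {B B' : Fin 5 → V} (h : IsLieBasis B)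
    (h' : IsLieBasis B') : ∃ F : V ≃ₗ[ℝ] V, IsAutomorphism F ∧ ∀ i, F (B i) = B' i := by
  obtain ⟨F, h1, h2, h3⟩ := exists_isometry h.orientation h'.orientation
    (fun i j => by rw [h.gram, h'.gram])
  refine ⟨F, isAutomorphism_of_future h2 h3 h.future ?_, h1⟩
  simpa only [h1] using h'.future

theorem IsAutomorphism.vol_pos {F : V ≃ₗ[ℝ] V} (hF : IsAutomorphism F) {B : Fin 5 → V}
    (hB : 0 < vol B) : 0 < vol (fun i => F (B i)) := by
  have := vol_map (F : V →ₗ[ℝ] V) B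
  simp only [LinearEquiv.coe_coe] at this
  rw [this]
  exact mul_pos hF.orientation hB

theorem IsMobiusBasis.map {B : Fin 5 → V} (h : IsMobiusBasis B) {F : V ≃ₗ[ℝ] V}
    (hF : IsAutomorphism F) : IsMobiusBasis (fun i => F (B i)) :=
  ⟨fun i j => by rw [hF.isometry, h.gram], hF.vol_pos h.orientation, by
    simpa only [map_add] using (hF.timeOrientation _ _).2 h.future⟩

theorem IsPoincareBasis.map {B : Fin 5 → V} (h : IsPoincareBasis B) {F : V ≃ₗ[ℝ] V}
    (hF : IsAutomorphism F) : IsPoincareBasis (fun i => F (B i)) :=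
  ⟨fun i j => by rw [hF.isometry, h.gram], hF.vol_pos h.orientation, by
    simpa only [map_add, map_sub] using (hF.timeOrientation _ _).2 h.future⟩

theorem IsLieBasis.map {B : Fin 5 → V} (h : IsLieBasis B) {F : V ≃ₗ[ℝ] V}
    (hF : IsAutomorphism F) : IsLieBasis (fun i => F (B i)) :=
  ⟨fun i j => by rw [hF.isometry, h.gram], hF.vol_pos h.orientation,
    (hF.timeOrientation _ _).2 h.future⟩

theorem RegularClass.IsBasis.exists_automorphism {c : RegularClass} {B B' : Fin 5 → V}
    (h : c.IsBasis B) (h' : c.IsBasis B') :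
    ∃ F : V ≃ₗ[ℝ] V, IsAutomorphism F ∧ ∀ i, F (B i) = B' i := by
  cases c
  · exact IsLieBasis.exists_automorphism h h'
  · exact IsPoincareBasis.exists_automorphism h h'
  · exact IsPoincareBasis.exists_automorphism h h'
  · exact IsLieBasis.exists_automorphism h h'
  · exact IsPoincareBasis.exists_automorphism h h'

theorem RegularClass.IsBasis.map {c : RegularClass} {B : Fin 5 → V}
    (h : c.IsBasis B) {F : V ≃ₗ[ℝ] V} (hF : IsAutomorphism F) :
    c.IsBasis (fun i => F (B i)) := by
  cases c
  · exact IsLieBasis.map h hF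
  · exact IsPoincareBasis.map h hF
  · exact IsPoincareBasis.map h hF
  · exact IsLieBasis.map h hF
  · exact IsPoincareBasis.map h hF

theorem isPoincareBasis_stdPoincare : IsPoincareBasis stdPoincare := by
  refine ⟨?_, ?_, ?_⟩
  · intro i j
    fin_cases i <;> fin_cases j <;> simp [ip, stdPoincare, poincareGram]
  · have : Matrix.of stdPoincare = (1 : Matrix (Fin 5) (Fin 5) ℝ) := by
      ext i j
      simp [stdPoincare, Matrix.one_apply, Pi.single_apply, eq_comm]
    rw [vol, this, Matrix.det_one]
    exact one_pos
  · rw [isFutureBivector_iff]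
    refine ⟨⟨?_, ?_, ?_, ?_⟩, ?_⟩
    · rw [LinearIndependent.pair_iff]
      intro s t h
      have h0 := congrFun h 0
      have h1 := congrFun h 1
      simp [stdPoincare] at h0 h1
      exact ⟨h0, h1⟩
    all_goals simp [ip, timeArea, stdPoincare]

theorem isLieBasis_stdLie : IsLieBasis stdLie := by
  have hs : √2 * √2 = 2 := Real.mul_self_sqrt (by norm_num)
  have hi : (√2)⁻¹ * (√2)⁻¹ = 1 / 2 := by rw [← mul_inv, hs]; norm_num
  refine ⟨?_, ?_, ?_⟩
  · intro i j
    fin_cases i <;> fin_cases j <;> simp [ip, stdLie, stdMobius, stdPoincare, lieGram] <;>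
      linarith [hi]
  · have : vol stdLie = 1 := by
      simp [vol, stdLie, stdMobius, stdPoincare, Matrix.det_succ_row_zero, Fin.sum_univ_succ,
        Fin.succAbove]
      nlinarith [hi]
    rw [this]
    exact one_pos
  · rw [isFutureBivector_iff]
    refine ⟨⟨?_, ?_, ?_, ?_⟩, ?_⟩
    · rw [LinearIndependent.pair_iff]
      intro s t h
      have h0 := congrFun h 0
      have h1 := congrFun h 1
      simp [stdLie, stdMobius, stdPoincare] at h0 h1
      exact ⟨h1, h0⟩
    all_goals simp [ip, timeArea, stdLie, stdMobius, stdPoincare]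

theorem RegularClass.isBasis_stdBasis (c : RegularClass) : c.IsBasis c.stdBasis := by
  cases c
  · exact isLieBasis_stdLie
  · exact isPoincareBasis_stdPoincare
  · exact isPoincareBasis_stdPoincare
  · exact isLieBasis_stdLie
  · exact isPoincareBasis_stdPoincare

/-! ### Points of the Einstein universe -/

theorem proj_smul {r : ℝ} (hr : 0 < r) (v : V) : proj (r • v) = proj v := by
  unfold proj
  have : (r • v) 0 ^ 2 + (r • v) 1 ^ 2 = r ^ 2 * (v 0 ^ 2 + v 1 ^ 2) := by
    simp only [Pi.smul_apply, smul_eq_mul]; ring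
  rw [this, Real.sqrt_mul (sq_nonneg r), Real.sqrt_sq hr.le, smul_smul]
  congr 1
  field_simp

theorem proj_eq_self {v : V} (hv : v ∈ einstein) : proj v = v := by
  rw [proj, hv.1]; simp

theorem proj_map_proj (F : V ≃ₗ[ℝ] V) {v : V} (hv : v ≠ 0) (h0 : ip v v = 0) :
    proj (F (proj v)) = proj (F v) := by
  obtain ⟨-, r, hr, h⟩ := proj_spec hv h0
  rw [h, map_smul, proj_smul hr]

theorem sq_add_sq_pos_of_null {v : V} (hv : v ≠ 0) (h0 : ip v v = 0) :
    0 < v 0 ^ 2 + v 1 ^ 2 := by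
  by_contra h
  have e := (proj_spec hv h0).1.1
  have h1 : v 0 = 0 := by nlinarith [sq_nonneg (v 0), sq_nonneg (v 1)]
  have h2 : v 1 = 0 := by nlinarith [sq_nonneg (v 0), sq_nonneg (v 1)]
  simp [proj, h1, h2] at e

/-! ### Möbius bases -/

theorem IsMobiusBasis.ip_zero_zero {B : Fin 5 → V} (h : IsMobiusBasis B) : ip (B 0) (B 0) = 0 :=
  h.gram 0 0
theorem IsMobiusBasis.ip_zero_one {B : Fin 5 → V} (h : IsMobiusBasis B) : ip (B 0) (B 1) = 0 :=
  h.gram 0 1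
theorem IsMobiusBasis.ip_zero_two {B : Fin 5 → V} (h : IsMobiusBasis B) : ip (B 0) (B 2) = 0 :=
  h.gram 0 2
theorem IsMobiusBasis.ip_zero_three {B : Fin 5 → V} (h : IsMobiusBasis B) : ip (B 0) (B 3) = 0 :=
  h.gram 0 3
theorem IsMobiusBasis.ip_zero_four {B : Fin 5 → V} (h : IsMobiusBasis B) : ip (B 0) (B 4) = -1 :=
  h.gram 0 4
theorem IsMobiusBasis.ip_one_one {B : Fin 5 → V} (h : IsMobiusBasis B) : ip (B 1) (B 1) = -1 :=
  h.gram 1 1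
theorem IsMobiusBasis.ip_one_two {B : Fin 5 → V} (h : IsMobiusBasis B) : ip (B 1) (B 2) = 0 :=
  h.gram 1 2
theorem IsMobiusBasis.ip_one_three {B : Fin 5 → V} (h : IsMobiusBasis B) : ip (B 1) (B 3) = 0 :=
  h.gram 1 3
theorem IsMobiusBasis.ip_two_two {B : Fin 5 → V} (h : IsMobiusBasis B) : ip (B 2) (B 2) = 1 :=
  h.gram 2 2
theorem IsMobiusBasis.ip_two_three {B : Fin 5 → V} (h : IsMobiusBasis B) : ip (B 2) (B 3) = 0 :=
  h.gram 2 3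
theorem IsMobiusBasis.ip_two_four {B : Fin 5 → V} (h : IsMobiusBasis B) : ip (B 2) (B 4) = 0 :=
  h.gram 2 4
theorem IsMobiusBasis.ip_three_three {B : Fin 5 → V} (h : IsMobiusBasis B) :
    ip (B 3) (B 3) = 1 := h.gram 3 3
theorem IsMobiusBasis.ip_three_four {B : Fin 5 → V} (h : IsMobiusBasis B) : ip (B 3) (B 4) = 0 :=
  h.gram 3 4
theorem IsMobiusBasis.ip_four_four {B : Fin 5 → V} (h : IsMobiusBasis B) : ip (B 4) (B 4) = 0 :=
  h.gram 4 4

/-- For a basis with the Gram matrix of a Möbius basis, the time orientation of the null plane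
`B₀ ∧ (B₁ + B₂)` can be read off from the plane `B₀ ∧ B₁`: the planes `B₀ ∧ (B₁ + s B₂)`,
`0 ≤ s ≤ 1`, are negative semidefinite. -/
theorem timeArea_add_pos_iff {B : Fin 5 → V} (hG : ∀ i j, ip (B i) (B j) = mobiusGram i j)
    (hv : vol B ≠ 0) : 0 < timeArea (B 0) (B 1 + B 2) ↔ 0 < timeArea (B 0) (B 1) := by
  have hlin := Fintype.linearIndependent_iff.1 (linearIndependent_of_vol_ne hv)
  have hc : Continuous fun s : ℝ => timeArea (B 0) (B 1 + s • B 2) := by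
    unfold timeArea
    simp only [Pi.add_apply, Pi.smul_apply, smul_eq_mul]
    fun_prop
  have hne : ∀ s ∈ Icc (0 : ℝ) 1, timeArea (B 0) (B 1 + s • B 2) ≠ 0 := by
    intro s hs
    apply timeArea_ne_zero
    · intro α β
      have e : ip (α • B 0 + β • (B 1 + s • B 2)) (α • B 0 + β • (B 1 + s • B 2)) =
          β ^ 2 * (s ^ 2 - 1) := by
        have h00 : ip (B 0) (B 0) = 0 := hG 0 0
        have h01 : ip (B 0) (B 1) = 0 := hG 0 1
        have h02 : ip (B 0) (B 2) = 0 := hG 0 2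
        have h11 : ip (B 1) (B 1) = -1 := hG 1 1
        have h12 : ip (B 1) (B 2) = 0 := hG 1 2
        have h22 : ip (B 2) (B 2) = 1 := hG 2 2
        simp only [ip_add_left, ip_add_right, ip_smul_left, ip_smul_right, ip_comm (B 1) (B 0),
          ip_comm (B 2) (B 0), ip_comm (B 2) (B 1), h00, h01, h02, h11, h12, h22]
        ring
      rw [e]
      have : s ^ 2 ≤ 1 := by nlinarith [hs.1, hs.2]
      nlinarith [sq_nonneg β]
    · intro α β h0
      have := hlin ![α, β, s * β, 0, 0] (by
        rw [← h0]
        simp only [Fin.sum_univ_five]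
        simp
        module)
      exact ⟨this 0, this 1⟩
  have := pos_iff_of_ne_zero isPreconnected_Icc hc.continuousOn hne
    (s := 1) (t := 0) (by simp) (by simp)
  simpa using this

theorem IsMobiusBasis.timeArea_pos {B : Fin 5 → V} (h : IsMobiusBasis B) :
    0 < timeArea (B 0) (B 1) :=
  (timeArea_add_pos_iff h.gram h.orientation.ne').1 ((isFutureBivector_iff _ _).1 h.future).2

/-- The time orientation of a Möbius basis may be tested on the plane `B₀ ∧ B₁`. -/
theorem isMobiusBasis_of_timeArea_pos {B : Fin 5 → V}
    (hG : ∀ i j, ip (B i) (B j) = mobiusGram i j) (hv : 0 < vol B)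
    (ht : 0 < timeArea (B 0) (B 1)) : IsMobiusBasis B := by
  have h00 : ip (B 0) (B 0) = 0 := hG 0 0
  have h01 : ip (B 0) (B 1) = 0 := hG 0 1
  have h02 : ip (B 0) (B 2) = 0 := hG 0 2
  have h11 : ip (B 1) (B 1) = -1 := hG 1 1
  have h12 : ip (B 1) (B 2) = 0 := hG 1 2
  have h22 : ip (B 2) (B 2) = 1 := hG 2 2
  refine ⟨hG, hv, (isFutureBivector_iff _ _).2 ⟨⟨?_, h00, ?_, ?_⟩,
    (timeArea_add_pos_iff hG hv.ne').2 ht⟩⟩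
  · rw [LinearIndependent.pair_iff]
    intro s t h0
    have := Fintype.linearIndependent_iff.1 (linearIndependent_of_vol_ne hv.ne')
      ![s, t, t, 0, 0] (by
        rw [← h0]
        simp only [Fin.sum_univ_five]
        simp
        module)
    exact ⟨this 0, this 1⟩
  · simp only [ip_add_left, ip_add_right, ip_comm (B 2) (B 1), h11, h12, h22]; ring
  · rw [ip_add_right, h01, h02]; ring

/-- The expansion of a vector in a Möbius basis, by means of the dual basis
`-B₄, -B₁, B₂, B₃, -B₀`. -/
theorem IsMobiusBasis.expand {B : Fin 5 → V} (h : IsMobiusBasis B) (v : V) :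
    v = (-ip (B 4) v) • B 0 - ip (B 1) v • B 1 + ip (B 2) v • B 2 + ip (B 3) v • B 3 -
      ip (B 0) v • B 4 := by
  rw [← sub_eq_zero]
  apply eq_zero_of_ip_eq_zero h.orientation.ne'
  intro i
  simp only [ip_sub_right, ip_add_right, ip_smul_right, h.gram]
  fin_cases i <;> simp [mobiusGram]

/-! ### Calculus of curves -/

theorem hasDerivAt_ip {X Y : ℝ → V} {X' Y' : V} {t : ℝ} (hX : HasDerivAt X X' t)
    (hY : HasDerivAt Y Y' t) :
    HasDerivAt (fun s => ip (X s) (Y s)) (ip X' (Y t) + ip (X t) Y') t := by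
  rw [hasDerivAt_pi] at hX hY
  have := (((((hX 0).mul (hY 0)).neg.sub ((hX 1).mul (hY 1))).add ((hX 2).mul (hY 2))).add
    ((hX 3).mul (hY 3))).add ((hX 4).mul (hY 4))
  refine this.congr_deriv ?_
  simp only [EinsteinUniverse.ip]
  ring

theorem contDiffOn_ip {X Y : ℝ → V} {I : Set ℝ} (hX : ContDiffOn ℝ ∞ X I)
    (hY : ContDiffOn ℝ ∞ Y I) : ContDiffOn ℝ ∞ (fun s => ip (X s) (Y s)) I := by
  rw [contDiffOn_pi] at hX hY
  have := (((((hX 0).mul (hY 0)).neg.sub ((hX 1).mul (hY 1))).add ((hX 2).mul (hY 2))).add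
    ((hX 3).mul (hY 3))).add ((hX 4).mul (hY 4))
  exact this

section Smooth

variable {E : Type*} [NormedAddCommGroup E] [NormedSpace ℝ E] {g : ℝ → E} {I : Set ℝ}

theorem hasDerivAt_of_smooth (hI : IsOpen I) (hg : ContDiffOn ℝ ∞ g I) {t : ℝ} (ht : t ∈ I) :
    HasDerivAt g (deriv g t) t :=
  ((hg.differentiableOn (by simp)).differentiableAt (hI.mem_nhds ht)).hasDerivAt

theorem contDiffOn_deriv (hI : IsOpen I) (hg : ContDiffOn ℝ ∞ g I) :
    ContDiffOn ℝ ∞ (deriv g) I :=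
  ((contDiffOn_infty_iff_deriv_of_isOpen hI).1 hg).2

theorem iteratedDeriv_two_of_hasDerivAt {g1 g2 : ℝ → E} (hI : IsOpen I)
    (h1 : ∀ t ∈ I, HasDerivAt g (g1 t) t) (h2 : ∀ t ∈ I, HasDerivAt g1 (g2 t) t) {t : ℝ}
    (ht : t ∈ I) : iteratedDeriv 2 g t = g2 t := by
  rw [iteratedDeriv_succ, iteratedDeriv_one]
  have : deriv g =ᶠ[nhds t] g1 := by
    filter_upwards [hI.mem_nhds ht] with s hs using (h1 s hs).deriv
  rw [this.deriv_eq, (h2 t ht).deriv]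

theorem iteratedDeriv_three_of_hasDerivAt {g1 g2 g3 : ℝ → E} (hI : IsOpen I)
    (h1 : ∀ t ∈ I, HasDerivAt g (g1 t) t) (h2 : ∀ t ∈ I, HasDerivAt g1 (g2 t) t)
    (h3 : ∀ t ∈ I, HasDerivAt g2 (g3 t) t) {t : ℝ} (ht : t ∈ I) :
    iteratedDeriv 3 g t = g3 t := by
  rw [iteratedDeriv_succ]
  have : iteratedDeriv 2 g =ᶠ[nhds t] g2 := by
    filter_upwards [hI.mem_nhds ht] with s hs using iteratedDeriv_two_of_hasDerivAt hI h1 h2 hs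
  rw [this.deriv_eq, (h3 t ht).deriv]

end Smooth

/-! ### The strain density -/

/-- The strain density in terms of a vector `n` orthogonal to the osculating space and congruent
to the third derivative modulo the osculating space. -/
theorem strainDensity_eq {γ : ℝ → V} {t q : ℝ} {g1 g2 n : V} (h1 : deriv γ t = g1)
    (h2 : iteratedDeriv 2 γ t = g2) (hq : 0 < q) (h00 : ip (γ t) (γ t) = 0)
    (h01 : ip (γ t) g1 = 0) (h11 : ip g1 g1 = -q) (h02 : ip (γ t) g2 = q)
    (hn0 : ip n (γ t) = 0) (hn1 : ip n g1 = 0) (hn2 : ip n g2 = 0)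
    (h3 : iteratedDeriv 3 γ t - n ∈ Submodule.span ℝ {γ t, g1, g2}) :
    strainDensity γ t = (ip n n / q) ^ (1 / 4 : ℝ) := by
  have hT : osculatingSpace γ t = Submodule.span ℝ {γ t, g1, g2} := by
    rw [osculatingSpace, iteratedDeriv_one, h1, h2]
  have hN : normalPart (osculatingSpace γ t) (iteratedDeriv 3 γ t) = n := by
    rw [hT]
    refine normalPart_eq ?_ ?_ h3
    · intro x hx hy
      obtain ⟨α, β, c, rfl⟩ := Submodule.mem_span_triple.1 hx
      have y0 := hy (γ t) (Submodule.subset_span (by simp))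
      have y1 := hy g1 (Submodule.subset_span (by simp))
      have y2 := hy g2 (Submodule.subset_span (by simp))
      simp only [ip_add_left, ip_smul_left, ip_comm g1 (γ t), ip_comm g2 (γ t), h00, h01, h02,
        ip_comm g2 g1, h11] at y0 y1 y2
      have hc : c = 0 := by
        have : c * q = 0 := by linarith
        exact (mul_eq_zero.1 this).resolve_right hq.ne'
      subst hc
      have hb : β = 0 := by
        have : β * q = 0 := by linarith
        exact (mul_eq_zero.1 this).resolve_right hq.ne'
      subst hb
      have ha : α = 0 := by
        have : α * q = 0 := by linarith
        exact (mul_eq_zero.1 this).resolve_right hq.ne'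
      subst ha
      simp
    · intro x hx
      obtain ⟨α, β, c, rfl⟩ := Submodule.mem_span_triple.1 hx
      simp only [ip_add_right, ip_smul_right, hn0, hn1, hn2]
      ring
  rw [strainDensity, hN, h1, h11, abs_neg, abs_of_pos hq]

/-- The component of `d3` orthogonal to `d0`, `d1`, `d2`, for vectors with the scalar products
of the derivatives of a timelike curve. -/
noncomputable def explicitNormal (d0 d1 d2 d3 : V) : V :=
  let q := -ip d1 d1
  let c := ip d3 d0 / q
  let β := (c * ip d1 d2 - ip d3 d1) / q
  let α := (ip d3 d2 - β * ip d1 d2 - c * ip d2 d2) / q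
  d3 - (α • d0 + β • d1 + c • d2)

section explicitNormal

variable {d0 d1 d2 d3 : V}

theorem explicitNormal_orth (hq : ip d1 d1 < 0) (h00 : ip d0 d0 = 0) (h01 : ip d0 d1 = 0)
    (h02 : ip d0 d2 = -ip d1 d1) :
    ip (explicitNormal d0 d1 d2 d3) d0 = 0 ∧ ip (explicitNormal d0 d1 d2 d3) d1 = 0 ∧
      ip (explicitNormal d0 d1 d2 d3) d2 = 0 := by
  have hq' := hq.ne
  refine ⟨?_, ?_, ?_⟩ <;>
  · simp only [explicitNormal, ip_sub_left, ip_add_left, ip_smul_left, ip_comm d1 d0,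
      ip_comm d2 d0, ip_comm d2 d1, h00, h01, h02]
    field_simp
    ring

theorem sub_explicitNormal_mem :
    d3 - explicitNormal d0 d1 d2 d3 ∈ Submodule.span ℝ {d0, d1, d2} := by
  simp only [explicitNormal, sub_sub_cancel]
  exact Submodule.mem_span_triple.2 ⟨_, _, _, rfl⟩

end explicitNormal

namespace IsTimelikeCurve

variable {γ : ℝ → V} {I : Set ℝ}

theorem hasDerivAt (h : IsTimelikeCurve γ I) {t : ℝ} (ht : t ∈ I) :
    HasDerivAt γ (deriv γ t) t :=
  hasDerivAt_of_smooth h.interval.isOpen h.smooth ht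

theorem ip_self (h : IsTimelikeCurve γ I) {t : ℝ} (ht : t ∈ I) : ip (γ t) (γ t) = 0 := by
  obtain ⟨h1, h2⟩ := h.mem t ht
  unfold ip
  linarith

theorem ip_deriv (h : IsTimelikeCurve γ I) {t : ℝ} (ht : t ∈ I) :
    ip (γ t) (deriv γ t) = 0 := by
  have h1 := hasDerivAt_ip (h.hasDerivAt ht) (h.hasDerivAt ht)
  have h2 : (fun s => ip (γ s) (γ s)) =ᶠ[nhds t] fun _ => (0 : ℝ) := by
    filter_upwards [h.interval.isOpen.mem_nhds ht] with s hs using h.ip_self hs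
  have h3 := h1.unique ((hasDerivAt_const t (0 : ℝ)).congr_of_eventuallyEq h2)
  rw [ip_comm (deriv γ t)] at h3
  linarith

theorem ip_deriv_two (h : IsTimelikeCurve γ I) {t : ℝ} (ht : t ∈ I) :
    ip (γ t) (deriv (deriv γ) t) = -ip (deriv γ t) (deriv γ t) := by
  have h1 := hasDerivAt_ip (h.hasDerivAt ht) (hasDerivAt_of_smooth h.interval.isOpen
    (contDiffOn_deriv h.interval.isOpen h.smooth) ht)
  have h2 : (fun s => ip (γ s) (deriv γ s)) =ᶠ[nhds t] fun _ => (0 : ℝ) := by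
    filter_upwards [h.interval.isOpen.mem_nhds ht] with s hs using h.ip_deriv hs
  have h3 := h1.unique ((hasDerivAt_const t (0 : ℝ)).congr_of_eventuallyEq h2)
  linarith

theorem strainDensity_eq_explicit (h : IsTimelikeCurve γ I) {t : ℝ} (ht : t ∈ I) :
    strainDensity γ t =
      (ip (explicitNormal (γ t) (deriv γ t) (deriv (deriv γ) t) (deriv (deriv (deriv γ)) t))
        (explicitNormal (γ t) (deriv γ t) (deriv (deriv γ) t) (deriv (deriv (deriv γ)) t)) /
        -ip (deriv γ t) (deriv γ t)) ^ (1 / 4 : ℝ) := by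
  obtain ⟨h0, h1, h2⟩ := explicitNormal_orth (d3 := deriv (deriv (deriv γ)) t)
    (h.timelike t ht) (h.ip_self ht) (h.ip_deriv ht) (h.ip_deriv_two ht)
  refine EinsteinUniverse.strainDensity_eq (g2 := deriv (deriv γ) t) rfl ?_
    (neg_pos.2 (h.timelike t ht)) (h.ip_self ht) (h.ip_deriv ht) (by ring) (h.ip_deriv_two ht)
    h0 h1 h2 ?_
  · rw [iteratedDeriv_succ, iteratedDeriv_one]
  · rw [iteratedDeriv_succ, iteratedDeriv_succ, iteratedDeriv_one]
    exact sub_explicitNormal_mem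

theorem continuousOn_strainDensity (h : IsTimelikeCurve γ I) :
    ContinuousOn (strainDensity γ) I := by
  refine ContinuousOn.congr ?_ fun t ht => h.strainDensity_eq_explicit ht
  have hI := h.interval.isOpen
  have c0 := h.smooth
  have c1 := contDiffOn_deriv hI c0
  have c2 := contDiffOn_deriv hI c1
  have c3 := contDiffOn_deriv hI c2
  have hq : ∀ t ∈ I, -ip (deriv γ t) (deriv γ t) ≠ 0 := fun t ht =>
    (neg_pos.2 (h.timelike t ht)).ne'
  have q1 := (contDiffOn_ip c1 c1).neg
  have hc := (contDiffOn_ip c3 c0).div q1 hq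
  have hβ := ((hc.mul (contDiffOn_ip c1 c2)).sub (contDiffOn_ip c3 c1)).div q1 hq
  have hα := (((contDiffOn_ip c3 c2).sub (hβ.mul (contDiffOn_ip c1 c2))).sub
    (hc.mul (contDiffOn_ip c2 c2))).div q1 hq
  have hn := c3.sub (((hα.smul c0).add (hβ.smul c1)).add (hc.smul c2))
  exact ((contDiffOn_ip hn hn).div q1 hq).continuousOn.rpow_const fun t _ => Or.inr (by norm_num)

end IsTimelikeCurve

/-- Nonnegativity holds at negative numbers too, where `x ^ (1 / 4)` is
`|x| ^ (1 / 4) * cos (π / 4)`; hence the strain density is nonnegative for an arbitrary curve. -/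
theorem rpow_quarter_nonneg (x : ℝ) : 0 ≤ x ^ (1 / 4 : ℝ) := by
  rcases le_or_gt 0 x with h | h
  · exact Real.rpow_nonneg h _
  · rw [Real.rpow_def_of_neg h]
    refine mul_nonneg (Real.exp_pos _).le (Real.cos_nonneg_of_mem_Icc ⟨?_, ?_⟩) <;>
      linarith [Real.pi_pos]

theorem pow_four_mul_rpow_quarter {c : ℝ} (hc : 0 < c) (x : ℝ) :
    (c ^ 4 * x) ^ (1 / 4 : ℝ) = c * x ^ (1 / 4 : ℝ) := by
  have e : (c ^ 4 : ℝ) ^ (1 / 4 : ℝ) = c := by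
    rw [← Real.rpow_natCast, ← Real.rpow_mul hc.le]
    norm_num
  rcases le_or_gt 0 x with h | h
  · rw [Real.mul_rpow (by positivity) h, e]
  · have h' : c ^ 4 * x < 0 := mul_neg_of_pos_of_neg (by positivity) h
    rw [Real.rpow_def_of_neg h, Real.rpow_def_of_neg h',
      Real.log_mul (by positivity) h.ne, add_mul, Real.exp_add, ← Real.rpow_def_of_pos
      (by positivity : (0 : ℝ) < c ^ 4), e]
    ring

theorem strainDensity_nonneg (γ : ℝ → V) (t : ℝ) : 0 ≤ strainDensity γ t :=
  rpow_quarter_nonneg _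

/-- The strain density is a density: it scales by the derivative of a change of parameter. -/
theorem strainDensity_comp {γ δ : ℝ → V} {I J : Set ℝ} {g : ℝ → ℝ} (hI : IsOpen I)
    (hδ : IsTimelikeCurve δ J) (hg : ContDiffOn ℝ ∞ g I) (hm : MapsTo g I J)
    (h : ∀ s ∈ I, γ s = δ (g s)) {s : ℝ} (hs : s ∈ I) (hpos : 0 < deriv g s) :
    strainDensity γ s = deriv g s * strainDensity δ (g s) := by
  have hJ := hδ.interval.isOpen
  have c1 := contDiffOn_deriv hJ hδ.smooth
  have c2 := contDiffOn_deriv hJ c1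
  have g1 := contDiffOn_deriv hI hg
  have g2 := contDiffOn_deriv hI g1
  have D0 : ∀ s ∈ I, HasDerivAt γ (deriv g s • deriv δ (g s)) s := by
    intro s hs
    refine ((hδ.hasDerivAt (hm hs)).scomp s
      (hasDerivAt_of_smooth hI hg hs)).congr_of_eventuallyEq ?_
    filter_upwards [hI.mem_nhds hs] with u hu using h u hu
  have D1 : ∀ s ∈ I, HasDerivAt (fun s => deriv g s • deriv δ (g s))
      (deriv g s ^ 2 • deriv (deriv δ) (g s) + deriv (deriv g) s • deriv δ (g s)) s := by
    intro s hs
    refine ((hasDerivAt_of_smooth hI g1 hs).smul ((hasDerivAt_of_smooth hJ c1 (hm hs)).scomp s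
      (hasDerivAt_of_smooth hI hg hs))).congr_deriv ?_
    simp only [Function.comp]
    module
  have D2 : ∀ s ∈ I, HasDerivAt
      (fun s => deriv g s ^ 2 • deriv (deriv δ) (g s) + deriv (deriv g) s • deriv δ (g s))
      (deriv g s ^ 3 • deriv (deriv (deriv δ)) (g s) +
        (3 * deriv g s * deriv (deriv g) s) • deriv (deriv δ) (g s) +
        deriv (deriv (deriv g)) s • deriv δ (g s)) s := by
    intro s hs
    refine ((((hasDerivAt_of_smooth hI g1 hs).pow 2).smul
      ((hasDerivAt_of_smooth hJ c2 (hm hs)).scomp s (hasDerivAt_of_smooth hI hg hs))).add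
      ((hasDerivAt_of_smooth hI g2 hs).smul ((hasDerivAt_of_smooth hJ c1 (hm hs)).scomp s
      (hasDerivAt_of_smooth hI hg hs)))).congr_deriv ?_
    simp only [Function.comp, Pi.pow_apply]
    module
  have e1 := (D0 s hs).deriv
  have e2 := iteratedDeriv_two_of_hasDerivAt hI D0 D1 hs
  have e3 := iteratedDeriv_three_of_hasDerivAt hI D0 D1 D2 hs
  rw [hδ.strainDensity_eq_explicit (hm hs)]
  have f0 := hδ.ip_self (hm hs)
  have f1 := hδ.ip_deriv (hm hs)
  have f2 := hδ.ip_deriv_two (hm hs)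
  have f3 := hδ.timelike _ (hm hs)
  obtain ⟨n0, n1, n2⟩ := explicitNormal_orth (d3 := deriv (deriv (deriv δ)) (g s)) f3 f0 f1 f2
  have n3 := sub_explicitNormal_mem (d0 := δ (g s)) (d1 := deriv δ (g s))
    (d2 := deriv (deriv δ) (g s)) (d3 := deriv (deriv (deriv δ)) (g s))
  set n := explicitNormal (δ (g s)) (deriv δ (g s)) (deriv (deriv δ) (g s))
    (deriv (deriv (deriv δ)) (g s))
  set d0 := δ (g s) with hd0
  set d1 := deriv δ (g s)
  set d2 := deriv (deriv δ) (g s)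
  set d3 := deriv (deriv (deriv δ)) (g s)
  set a := deriv g s
  set b := deriv (deriv g) s
  have e0 : γ s = d0 := h s hs
  have ha : a ≠ 0 := hpos.ne'
  have key := strainDensity_eq (q := a ^ 2 * -ip d1 d1) (n := a ^ 3 • n) e1 e2
    (mul_pos (pow_pos hpos 2) (neg_pos.2 f3)) (by rw [e0, f0])
    (by rw [e0, ip_smul_right, f1, mul_zero]) (by rw [ip_smul_left, ip_smul_right]; ring)
    (by rw [e0, ip_add_right, ip_smul_right, ip_smul_right, f1, f2]; ring)
    (by rw [e0, ip_smul_left, n0, mul_zero])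
    (by rw [ip_smul_left, ip_smul_right, n1, mul_zero, mul_zero])
    (by rw [ip_smul_left, ip_add_right, ip_smul_right, ip_smul_right, n1, n2]; ring) (by
      rw [e3, e0]
      set T := Submodule.span ℝ {d0, a • d1, a ^ 2 • d2 + b • d1}
      have m0 : d0 ∈ T := Submodule.subset_span (by simp)
      have m1 : d1 ∈ T := by
        have : d1 = a⁻¹ • (a • d1) := by rw [smul_smul, inv_mul_cancel₀ ha, one_smul]
        rw [this]
        exact T.smul_mem _ (Submodule.subset_span (by simp))
      have m2 : d2 ∈ T := by
        have : d2 = (a ^ 2)⁻¹ • ((a ^ 2 • d2 + b • d1) - b • d1) := by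
          rw [add_sub_cancel_right, smul_smul, inv_mul_cancel₀ (pow_ne_zero 2 ha), one_smul]
        rw [this]
        exact T.smul_mem _ (T.sub_mem (Submodule.subset_span (by simp)) (T.smul_mem _ m1))
      have m3 : d3 - n ∈ T := by
        refine Submodule.span_le.2 ?_ n3
        rintro x (rfl | rfl | rfl)
        exacts [m0, m1, m2]
      have : a ^ 3 • d3 + (3 * a * b) • d2 + deriv (deriv (deriv g)) s • d1 - a ^ 3 • n =
          a ^ 3 • (d3 - n) + (3 * a * b) • d2 + deriv (deriv (deriv g)) s • d1 := by
        module
      rw [this]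
      exact T.add_mem (T.add_mem (T.smul_mem _ m3) (T.smul_mem _ m2)) (T.smul_mem _ m1))
  rw [key, ← pow_four_mul_rpow_quarter hpos, ip_smul_left, ip_smul_right]
  congr 1
  have := f3.ne
  field_simp

/-! ### Frames satisfying the conformal Frenet equations -/

/-- A smooth field of Möbius bases on `I` satisfying the conformal Frenet equations with constant
curvatures `k`, `h` and an arbitrary positive speed `lam`. -/
structure IsFrenetFrame (M : ℝ → Fin 5 → V) (I : Set ℝ) (lam : ℝ → ℝ) (k h : ℝ) : Prop where
  smooth : ContDiffOn ℝ ∞ M I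
  speed_smooth : ContDiffOn ℝ ∞ lam I
  speed_pos : ∀ t ∈ I, 0 < lam t
  mobius : ∀ t ∈ I, IsMobiusBasis (M t)
  frenet : ∀ t ∈ I, ∀ j, HasDerivAt (fun s => M s j)
    (lam t • ∑ i, frenetMatrix k h i j • M t i) t

namespace IsFrenetFrame

variable {M N : ℝ → Fin 5 → V} {I J : Set ℝ} {lam : ℝ → ℝ} {k h k' h' : ℝ}

theorem smooth_apply (hM : IsFrenetFrame M I lam k h) (j : Fin 5) :
    ContDiffOn ℝ ∞ (fun s => M s j) I :=
  contDiffOn_pi.1 hM.smooth j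

theorem deriv_zero (hM : IsFrenetFrame M I lam k h) {t : ℝ} (ht : t ∈ I) :
    HasDerivAt (fun s => M s 0) (lam t • M t 1) t := by
  simpa [Fin.sum_univ_five, frenetMatrix] using hM.frenet t ht 0

theorem deriv_one (hM : IsFrenetFrame M I lam k h) {t : ℝ} (ht : t ∈ I) :
    HasDerivAt (fun s => M s 1) (lam t • (-h • M t 0 - M t 4)) t := by
  simpa [Fin.sum_univ_five, frenetMatrix, sub_eq_add_neg] using hM.frenet t ht 1

theorem deriv_two (hM : IsFrenetFrame M I lam k h) {t : ℝ} (ht : t ∈ I) :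
    HasDerivAt (fun s => M s 2) (lam t • (M t 0 + k • M t 3)) t := by
  simpa [Fin.sum_univ_five, frenetMatrix] using hM.frenet t ht 2

theorem deriv_three (hM : IsFrenetFrame M I lam k h) {t : ℝ} (ht : t ∈ I) :
    HasDerivAt (fun s => M s 3) (lam t • -(k • M t 2)) t := by
  simpa [Fin.sum_univ_five, frenetMatrix] using hM.frenet t ht 3

theorem deriv_four (hM : IsFrenetFrame M I lam k h) {t : ℝ} (ht : t ∈ I) :
    HasDerivAt (fun s => M s 4) (lam t • (h • M t 1 + M t 2)) t := by
  simpa [Fin.sum_univ_five, frenetMatrix] using hM.frenet t ht 4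

/-- Frenet frames can be reparametrized. -/
theorem comp (hM : IsFrenetFrame M J lam k h) (hI : IsOpen I) {g : ℝ → ℝ}
    (hg : ContDiffOn ℝ ∞ g I) (hm : MapsTo g I J) (hpos : ∀ s ∈ I, 0 < deriv g s) :
    IsFrenetFrame (fun s => M (g s)) I (fun s => lam (g s) * deriv g s) k h where
  smooth := hM.smooth.comp hg hm
  speed_smooth := (hM.speed_smooth.comp hg hm).mul (contDiffOn_deriv hI hg)
  speed_pos s hs := mul_pos (hM.speed_pos _ (hm hs)) (hpos s hs)
  mobius s hs := hM.mobius _ (hm hs)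
  frenet s hs j := by
    refine ((hM.frenet _ (hm hs) j).scomp s (hasDerivAt_of_smooth hI hg hs)).congr_deriv ?_
    rw [smul_smul, mul_comm]

theorem map (hM : IsFrenetFrame M I lam k h) {F : V ≃ₗ[ℝ] V} (hF : IsAutomorphism F) :
    IsFrenetFrame (fun s i => F (M s i)) I lam k h where
  smooth := contDiffOn_pi.2 fun i =>
    (LinearMap.toContinuousLinearMap (F : V →ₗ[ℝ] V)).contDiff.comp_contDiffOn (hM.smooth_apply i)
  speed_smooth := hM.speed_smooth
  speed_pos := hM.speed_pos
  mobius s hs := (hM.mobius s hs).map hF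
  frenet s hs j := by
    have := (LinearMap.toContinuousLinearMap (F : V →ₗ[ℝ] V)).hasFDerivAt.comp_hasDerivAt s
      (hM.frenet s hs j)
    refine this.congr_deriv ?_
    simp [map_sum]

/-- The Frenet equations are linear, so a frame is determined by its value at one point: the
tensor `-M₀ ⊗ N₄ - M₁ ⊗ N₁ + M₂ ⊗ N₂ + M₃ ⊗ N₃ - M₄ ⊗ N₀`, which represents the isometry taking
the basis `N` to `M`, is constant along two solutions. -/
theorem eq_of_eq (hI : IsOpenInterval I) (hM : IsFrenetFrame M I lam k h)
    (hN : IsFrenetFrame N I lam k h) {s₀ : ℝ} (hs₀ : s₀ ∈ I) (h0 : M s₀ = N s₀) {t : ℝ}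
    (ht : t ∈ I) : M t = N t := by
  let T : V → ℝ → V := fun v s => (-ip (N s 4) v) • M s 0 - ip (N s 1) v • M s 1 +
    ip (N s 2) v • M s 2 + ip (N s 3) v • M s 3 - ip (N s 0) v • M s 4
  have hT : ∀ v, ∀ s ∈ I, HasDerivAt (T v) 0 s := by
    intro v s hs
    have c := hasDerivAt_const s v
    refine ((((((hasDerivAt_ip (hN.deriv_four hs) c).neg.smul (hM.deriv_zero hs)).sub
      ((hasDerivAt_ip (hN.deriv_one hs) c).smul (hM.deriv_one hs))).add
      ((hasDerivAt_ip (hN.deriv_two hs) c).smul (hM.deriv_two hs))).add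
      ((hasDerivAt_ip (hN.deriv_three hs) c).smul (hM.deriv_three hs))).sub
      ((hasDerivAt_ip (hN.deriv_zero hs) c).smul (hM.deriv_four hs))).congr_deriv ?_
    have z : ip (N s 0) 0 = 0 ∧ ip (N s 1) 0 = 0 ∧ ip (N s 2) 0 = 0 ∧ ip (N s 3) 0 = 0 ∧
        ip (N s 4) 0 = 0 := by simp [ip]
    obtain ⟨z0, z1, z2, z3, z4⟩ := z
    simp only [ip_smul_left, ip_sub_left, ip_add_left, ip_neg_left, Pi.neg_apply, z0, z1, z2,
      z3, z4]
    module
  have hconst : ∀ v, T v t = T v s₀ := by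
    intro v
    refine hI.isOpen.is_const_of_deriv_eq_zero hI.ordConnected.isPreconnected
      (fun s hs => (hT v s hs).differentiableAt.differentiableWithinAt)
      (fun s hs => (hT v s hs).deriv) ht hs₀
  funext j
  have e1 := hconst (N t j)
  have e2 := (hN.mobius s₀ hs₀).expand (N t j)
  have e3 : T (N t j) t = M t j := by
    simp only [T, (hN.mobius t ht).gram]
    fin_cases j <;> simp [mobiusGram]
  rw [← e3, e1]
  simp only [T, h0]
  exact e2.symm

/-- The frame and the curvatures of a curve are determined by the null line field `M₀`. -/
theorem unique (hI : IsOpen I) (hM : IsFrenetFrame M I lam k h)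
    (hN : IsFrenetFrame N I lam k' h') (hr : ∀ t ∈ I, ∃ r : ℝ, 0 < r ∧ N t 0 = r • M t 0) {t : ℝ}
    (ht : t ∈ I) : N t = M t ∧ k' = k ∧ h' = h := by
  have unq : ∀ {X Y : ℝ → V} {X' Y' : V} {t : ℝ}, t ∈ I → (∀ s ∈ I, X s = Y s) →
      HasDerivAt X X' t → HasDerivAt Y Y' t → X' = Y' := by
    intro X Y X' Y' t ht h hX hY
    refine hX.unique (hY.congr_of_eventuallyEq ?_)
    filter_upwards [hI.mem_nhds ht] with s hs using h s hs
  -- `M₀' / lam` is a unit timelike vector, which fixes the scale of `M₀` on its ray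
  have E0 : ∀ t ∈ I, N t 0 = M t 0 := by
    intro t ht
    have hρ : ∀ s ∈ I, N s 0 = (-ip (N s 0) (M s 4)) • M s 0 := by
      intro s hs
      obtain ⟨r, -, hr⟩ := hr s hs
      rw [hr, ip_smul_left, (hM.mobius s hs).ip_zero_four]
      simp
    have hd := (hasDerivAt_ip (hN.deriv_zero ht) (hM.deriv_four ht)).neg
    have e := unq ht hρ (hN.deriv_zero ht) (hd.smul (hM.deriv_zero ht))
    obtain ⟨r, hrp, hr⟩ := hr t ht
    have er : -ip (N t 0) (M t 4) = r := by
      rw [hr, ip_smul_left, (hM.mobius t ht).ip_zero_four]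
      ring
    generalize hb :
      -(ip (lam t • N t 1) (M t 4) + ip (N t 0) (lam t • (h • M t 1 + M t 2))) = b at e
    have e' : lam t • N t 1 = r • lam t • M t 1 + b • M t 0 := by
      rw [e, ← er]
      rfl
    have en := congrArg (fun v => ip v v) e'
    simp only [ip_add_left, ip_add_right, ip_smul_left, ip_smul_right,
      (hN.mobius t ht).ip_one_one, (hM.mobius t ht).ip_one_one, (hM.mobius t ht).ip_zero_zero,
      (hM.mobius t ht).ip_zero_one, ip_comm (M t 1) (M t 0)] at en
    have hl := hM.speed_pos t ht
    have : r ^ 2 = 1 := by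
      have : lam t ^ 2 * (r ^ 2 - 1) = 0 := by linear_combination en
      rcases mul_eq_zero.1 this with h | h
      · exact absurd h (by positivity)
      · linarith
    have hr1 : r = 1 := by nlinarith
    rw [hr, hr1, one_smul]
  have cancel : ∀ {t : ℝ} {v w : V}, t ∈ I → lam t • v = lam t • w → v = w := by
    intro t v w ht e
    exact smul_right_injective V (hM.speed_pos t ht).ne' e
  have E1 : ∀ t ∈ I, N t 1 = M t 1 := fun t ht =>
    cancel ht (unq ht E0 (hN.deriv_zero ht) (hM.deriv_zero ht))
  -- `-M₁' / lam = h M₀ + M₄` has square norm `-2 h`, which separates `h` and `M₄`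
  have E4 : ∀ t ∈ I, h' = h ∧ N t 4 = M t 4 := by
    intro t ht
    have e := cancel ht (unq ht E1 (hN.deriv_one ht) (hM.deriv_one ht))
    have en := congrArg (fun v => ip v v) e
    simp only [ip_sub_left, ip_sub_right, ip_smul_left, ip_smul_right,
      (hN.mobius t ht).ip_zero_zero, (hM.mobius t ht).ip_zero_zero, (hN.mobius t ht).ip_four_four,
      (hN.mobius t ht).ip_zero_four, (hM.mobius t ht).ip_zero_four, ip_comm (M t 4) (M t 0),
      ip_comm (N t 4) (N t 0), (hM.mobius t ht).ip_four_four] at en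
    have hh : h' = h := by linarith
    refine ⟨hh, ?_⟩
    rw [hh, E0 t ht] at e
    exact sub_right_injective e
  have E2 : ∀ t ∈ I, N t 2 = M t 2 := by
    intro t ht
    have e := cancel ht (unq ht (fun s hs => (E4 s hs).2) (hN.deriv_four ht) (hM.deriv_four ht))
    rw [(E4 t ht).1, E1 t ht] at e
    exact add_left_cancel e
  -- the four other vectors determine `M₃` up to sign, and the orientation fixes the sign
  have E3 : ∀ t ∈ I, N t 3 = M t 3 := by
    intro t ht
    have hNt := hN.mobius t ht
    have hMt := hM.mobius t ht
    have e := hMt.expand (N t 3)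
    set x := ip (M t 3) (N t 3) with hx
    rw [← E0 t ht, ← E1 t ht, ← E2 t ht, ← (E4 t ht).2, hNt.ip_zero_three, hNt.ip_one_three,
      hNt.ip_two_three, ip_comm (N t 4), hNt.ip_three_four] at e
    simp only [neg_zero, zero_smul, sub_zero, zero_add] at e
    have e2 : x ^ 2 = 1 := by
      have := hNt.ip_three_three
      rw [e, ip_smul_left, ip_smul_right, hMt.ip_three_three] at this
      linear_combination this
    have hupd : vol (N t) = x * vol (M t) := by
      have : Matrix.of (N t) = (Matrix.of (M t)).updateRow 3 (x • (Matrix.of (M t)) 3) := by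
        ext i j
        fin_cases i
        · simp [Matrix.updateRow_apply, E0 t ht]
        · simp [Matrix.updateRow_apply, E1 t ht]
        · simp [Matrix.updateRow_apply, E2 t ht]
        · simpa [Matrix.updateRow_apply] using congrFun e j
        · simp [Matrix.updateRow_apply, (E4 t ht).2]
      unfold vol
      rw [this, Matrix.det_updateRow_smul, Matrix.updateRow_eq_self]
    have hxp : 0 < x := pos_of_mul_pos_left (hupd ▸ hNt.orientation) hMt.orientation.le
    have : x = 1 := by nlinarith
    rw [e, this, one_smul]
  have hk : k' = k := by
    have e := cancel ht (unq ht E2 (hN.deriv_two ht) (hM.deriv_two ht))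
    rw [E0 t ht, E3 t ht] at e
    have e2 := add_left_cancel e
    have e3 := congrArg (fun v => ip v (M t 3)) e2
    simpa only [ip_smul_left, (hM.mobius t ht).ip_three_three, mul_one] using e3
  refine ⟨?_, hk, (E4 t ht).1⟩
  funext j
  fin_cases j
  exacts [E0 t ht, E1 t ht, E2 t ht, E3 t ht, (E4 t ht).2]

end IsFrenetFrame

/-! ### The curve of a Frenet frame -/

/-- `M` is a Frenet frame with speed `lam` and curvatures `k`, `h`, and the curve `γ` is a smooth
positive multiple of its first vector. -/
structure IsFrenetFrameAlong (γ : ℝ → V) (M : ℝ → Fin 5 → V) (I : Set ℝ) (lam : ℝ → ℝ)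
    (k h : ℝ) : Prop extends IsFrenetFrame M I lam k h where
  exists_scale : ∃ ρ : ℝ → ℝ, ContDiffOn ℝ ∞ ρ I ∧ (∀ t ∈ I, 0 < ρ t) ∧
    ∀ t ∈ I, γ t = ρ t • M t 0

namespace IsFrenetFrameAlong

variable {γ : ℝ → V} {M : ℝ → Fin 5 → V} {I J : Set ℝ} {lam : ℝ → ℝ} {k h : ℝ}

theorem smooth_curve (hM : IsFrenetFrameAlong γ M I lam k h) : ContDiffOn ℝ ∞ γ I := by
  obtain ⟨ρ, hρ, -, hγ⟩ := hM.exists_scale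
  exact (hρ.smul (hM.smooth_apply 0)).congr hγ

/-- The derivatives of `γ = ρ M₀`, expanded in the frame: the osculating space is spanned by
`M₀, M₁, M₄`, and `γ'''` is congruent to `-ρ lam³ M₂` modulo it, so the speed of the frame is the
strain density. The expansion of `γ'` shows that `γ` is timelike and future directed. -/
theorem strainDensity_and_deriv (hI : IsOpen I) (hM : IsFrenetFrameAlong γ M I lam k h) {t : ℝ}
    (ht : t ∈ I) : strainDensity γ t = lam t ∧
      ∃ ρ ρ' : ℝ, 0 < ρ ∧ γ t = ρ • M t 0 ∧ deriv γ t = ρ' • M t 0 + (ρ * lam t) • M t 1 := by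
  obtain ⟨ρ, hρ, hpos, hγ⟩ := hM.exists_scale
  have hl := hM.speed_smooth
  have D : ∀ {α β δ : ℝ → ℝ}, ContDiffOn ℝ ∞ α I → ContDiffOn ℝ ∞ β I → ContDiffOn ℝ ∞ δ I →
      ∀ t ∈ I, HasDerivAt (fun s => α s • M s 0 + β s • M s 1 + δ s • M s 4)
        ((deriv α t - β t * lam t * h) • M t 0 +
          (deriv β t + α t * lam t + δ t * lam t * h) • M t 1 +
          (deriv δ t - lam t * β t) • M t 4 + (δ t * lam t) • M t 2) t := by
    intro α β δ hα hβ hδ t ht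
    refine ((((hasDerivAt_of_smooth hI hα ht).smul (hM.deriv_zero ht)).add
      ((hasDerivAt_of_smooth hI hβ ht).smul (hM.deriv_one ht))).add
      ((hasDerivAt_of_smooth hI hδ ht).smul (hM.deriv_four ht))).congr_deriv ?_
    module
  have hz : ContDiffOn ℝ ∞ (fun _ : ℝ => (0 : ℝ)) I := contDiffOn_const
  have D0 : ∀ t ∈ I, HasDerivAt γ
      (deriv ρ t • M t 0 + (ρ t * lam t) • M t 1 + (0 : ℝ) • M t 4) t := by
    intro t ht
    refine ((D hρ hz hz t ht).congr_of_eventuallyEq ?_).congr_deriv ?_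
    · filter_upwards [hI.mem_nhds ht] with s hs
      rw [hγ s hs]
      module
    · simp
  have hρ1 := contDiffOn_deriv hI hρ
  have hα2 : ContDiffOn ℝ ∞ (fun t => deriv (deriv ρ) t - ρ t * lam t * lam t * h) I :=
    (contDiffOn_deriv hI hρ1).sub (((hρ.mul hl).mul hl).mul contDiffOn_const)
  have hβ2 : ContDiffOn ℝ ∞ (fun t => deriv (fun t => ρ t * lam t) t + deriv ρ t * lam t) I :=
    (contDiffOn_deriv hI (hρ.mul hl)).add (hρ1.mul hl)
  have hδ2 : ContDiffOn ℝ ∞ (fun t => -(ρ t * lam t ^ 2)) I := (hρ.mul (hl.pow 2)).neg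
  have D1 : ∀ t ∈ I, HasDerivAt (fun t => deriv ρ t • M t 0 + (ρ t * lam t) • M t 1 +
      (0 : ℝ) • M t 4) ((deriv (deriv ρ) t - ρ t * lam t * lam t * h) • M t 0 +
        (deriv (fun t => ρ t * lam t) t + deriv ρ t * lam t) • M t 1 +
        (-(ρ t * lam t ^ 2)) • M t 4) t := by
    intro t ht
    refine (D hρ1 (hρ.mul hl) hz t ht).congr_deriv ?_
    simp only [deriv_const]
    module
  have D2 := D hα2 hβ2 hδ2
  have e1 := (D0 t ht).deriv
  have e2 := iteratedDeriv_two_of_hasDerivAt hI D0 D1 ht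
  have e3 := iteratedDeriv_three_of_hasDerivAt hI D0 D1 D2 ht
  have hr := hpos t ht
  have hlp := hM.speed_pos t ht
  have hm := hM.mobius t ht
  refine ⟨?_, ρ t, deriv ρ t, hr, hγ t ht, by rw [e1, zero_smul, add_zero]⟩
  have key := strainDensity_eq (q := ρ t ^ 2 * lam t ^ 2)
    (n := (-(ρ t * lam t ^ 2) * lam t) • M t 2) e1 e2 (by positivity)
    (by rw [hγ t ht]; simp only [ip_smul_left, ip_smul_right, hm.ip_zero_zero]; ring)
    (by
      rw [hγ t ht]
      simp only [ip_smul_left, ip_smul_right, ip_add_right, hm.ip_zero_zero, hm.ip_zero_one]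
      ring)
    (by
      simp only [ip_smul_left, ip_smul_right, ip_add_right, ip_add_left, hm.ip_zero_zero,
        hm.ip_zero_one, hm.ip_one_one, ip_comm (M t 1) (M t 0)]
      ring)
    (by
      rw [hγ t ht]
      simp only [ip_smul_left, ip_smul_right, ip_add_right, hm.ip_zero_zero, hm.ip_zero_one,
        hm.ip_zero_four]
      ring)
    (by
      rw [hγ t ht]
      simp only [ip_smul_left, ip_smul_right, ip_comm (M t 2) (M t 0), hm.ip_zero_two]
      ring)
    (by
      simp only [ip_smul_left, ip_smul_right, ip_add_right, ip_comm (M t 2) (M t 0),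
        hm.ip_zero_two, ip_comm (M t 2) (M t 1), hm.ip_one_two, hm.ip_two_four]
      ring)
    (by
      simp only [ip_smul_left, ip_smul_right, ip_add_right, ip_comm (M t 2) (M t 0),
        hm.ip_zero_two, ip_comm (M t 2) (M t 1), hm.ip_one_two, hm.ip_two_four]
      ring)
    (by
      rw [e3, add_sub_cancel_right]
      set g1 := deriv ρ t • M t 0 + (ρ t * lam t) • M t 1 + (0 : ℝ) • M t 4 with hg1
      set g2 := (deriv (deriv ρ) t - ρ t * lam t * lam t * h) • M t 0 +
        (deriv (fun t => ρ t * lam t) t + deriv ρ t * lam t) • M t 1 +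
        (-(ρ t * lam t ^ 2)) • M t 4 with hg2
      set T := Submodule.span ℝ {γ t, g1, g2}
      have m0 : M t 0 ∈ T := by
        have : M t 0 = (ρ t)⁻¹ • γ t := by
          rw [hγ t ht, smul_smul, inv_mul_cancel₀ hr.ne', one_smul]
        rw [this]
        exact T.smul_mem _ (Submodule.subset_span (by simp))
      have m1 : M t 1 ∈ T := by
        have : M t 1 = (ρ t * lam t)⁻¹ • (g1 - deriv ρ t • M t 0) := by
          rw [hg1, zero_smul, add_zero, add_sub_cancel_left, smul_smul,
            inv_mul_cancel₀ (by positivity), one_smul]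
        rw [this]
        exact T.smul_mem _ (T.sub_mem (Submodule.subset_span (by simp)) (T.smul_mem _ m0))
      have m4 : M t 4 ∈ T := by
        have : M t 4 = (-(ρ t * lam t ^ 2))⁻¹ • (g2 -
            ((deriv (deriv ρ) t - ρ t * lam t * lam t * h) • M t 0 +
            (deriv (fun t => ρ t * lam t) t + deriv ρ t * lam t) • M t 1)) := by
          rw [hg2, add_sub_cancel_left, smul_smul,
            inv_mul_cancel₀ (neg_ne_zero.2 (by positivity)), one_smul]
        rw [this]
        exact T.smul_mem _ (T.sub_mem (Submodule.subset_span (by simp))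
          (T.add_mem (T.smul_mem _ m0) (T.smul_mem _ m1)))
      exact T.add_mem (T.add_mem (T.smul_mem _ m0) (T.smul_mem _ m1)) (T.smul_mem _ m4))
  have hq : ip ((-(ρ t * lam t ^ 2) * lam t) • M t 2) ((-(ρ t * lam t ^ 2) * lam t) • M t 2) /
      (ρ t ^ 2 * lam t ^ 2) = lam t ^ 4 * 1 := by
    rw [ip_smul_left, ip_smul_right, hm.ip_two_two]
    field_simp
  rw [key, hq, pow_four_mul_rpow_quarter hlp, Real.one_rpow, mul_one]

theorem strainDensity_eq (hI : IsOpen I) (hM : IsFrenetFrameAlong γ M I lam k h) {t : ℝ}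
    (ht : t ∈ I) : strainDensity γ t = lam t :=
  (hM.strainDensity_and_deriv hI ht).1

theorem isTimelikeCurve (hI : IsOpenInterval I) (hM : IsFrenetFrameAlong γ M I lam k h)
    (hmem : ∀ t ∈ I, γ t ∈ einstein) : IsTimelikeCurve γ I := by
  refine ⟨hI, hM.smooth_curve, hmem, fun t ht => ?_, fun t ht => ?_⟩
  all_goals
    obtain ⟨-, ρ, ρ', hρ, e0, e1⟩ := hM.strainDensity_and_deriv hI.isOpen ht
    have hl := hM.speed_pos t ht
    have hm := hM.mobius t ht
  · rw [e1]
    simp only [ip_smul_left, ip_smul_right, ip_add_right, ip_add_left, hm.ip_zero_zero,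
        hm.ip_zero_one, hm.ip_one_one, ip_comm (M t 1) (M t 0)]
    nlinarith [pow_pos (mul_pos hρ hl) 2]
  · have := mul_pos (mul_pos (mul_pos hρ hρ) hl) hm.timeArea_pos
    rw [e1, e0]
    simp only [timeArea, Pi.add_apply, Pi.smul_apply, smul_eq_mul] at this ⊢
    linarith

theorem isCanonicalFrame (hI : IsOpen I) (hM : IsFrenetFrameAlong γ M I lam k h) :
    IsCanonicalFrame γ I M (fun _ => k) (fun _ => h) := by
  refine ⟨hM.smooth, hM.mobius, fun t ht => ?_, fun t ht j => ?_⟩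
  · obtain ⟨ρ, -, hpos, hγ⟩ := hM.exists_scale
    refine ⟨(ρ t)⁻¹, inv_pos.2 (hpos t ht), ?_⟩
    rw [hγ t ht, smul_smul, inv_mul_cancel₀ (hpos t ht).ne', one_smul]
  · rw [hM.strainDensity_eq hI ht]
    exact (hM.frenet t ht j).deriv

theorem hasConstantCurvatures (hI : IsOpenInterval I) (hM : IsFrenetFrameAlong γ M I lam k h)
    (hmem : ∀ t ∈ I, γ t ∈ einstein) : HasConstantCurvatures γ I (k, h) :=
  ⟨⟨hM.isTimelikeCurve hI hmem, fun t ht => by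
    rw [hM.strainDensity_eq hI.isOpen ht]
    exact (hM.speed_pos t ht).ne'⟩, M, hM.isCanonicalFrame hI.isOpen⟩

theorem comp {γ' : ℝ → V} (hM : IsFrenetFrameAlong γ M J lam k h) (hI : IsOpen I) {g : ℝ → ℝ}
    (hg : ContDiffOn ℝ ∞ g I) (hm : MapsTo g I J) (hpos : ∀ s ∈ I, 0 < deriv g s)
    (hγ : ∀ s ∈ I, γ' s = γ (g s)) :
    IsFrenetFrameAlong γ' (fun s => M (g s)) I (fun s => lam (g s) * deriv g s) k h where
  toIsFrenetFrame := hM.toIsFrenetFrame.comp hI hg hm hpos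
  exists_scale := by
    obtain ⟨ρ, hρ, hp, h⟩ := hM.exists_scale
    exact ⟨fun s => ρ (g s), hρ.comp hg hm, fun s hs => hp _ (hm hs), fun s hs => by
      rw [hγ s hs, h _ (hm hs)]⟩

end IsFrenetFrameAlong

/-- A canonical frame with constant curvatures is a Frenet frame. The strain density is smooth
because it equals `-⟨M₀', M₁⟩`, and the scale of `γ` is smooth because it equals `-⟨γ, M₄⟩`. -/
theorem HasConstantCurvatures.exists_frame {γ : ℝ → V} {I : Set ℝ} {kh : ℝ × ℝ}
    (h : HasConstantCurvatures γ I kh) :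
    ∃ M, IsFrenetFrameAlong γ M I (strainDensity γ) kh.1 kh.2 := by
  obtain ⟨⟨hγ, hgen⟩, M, hM⟩ := h
  have hI := hγ.interval.isOpen
  have hsm := contDiffOn_pi.1 hM.smooth
  have hD : ∀ t ∈ I, ∀ j, HasDerivAt (fun s => M s j)
      (strainDensity γ t • ∑ i, frenetMatrix kh.1 kh.2 i j • M t i) t := fun t ht j => by
    rw [← hM.frenet t ht j]
    exact hasDerivAt_of_smooth hI (hsm j) ht
  have hυ : ∀ t ∈ I, strainDensity γ t = -ip (deriv (fun s => M s 0) t) (M t 1) := by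
    intro t ht
    rw [hM.frenet t ht 0]
    simp [Fin.sum_univ_five, frenetMatrix, ip_smul_left, (hM.mobius t ht).ip_one_one]
  refine ⟨M, ⟨hM.smooth, ?_, fun t ht => (strainDensity_nonneg γ t).lt_of_ne (hgen t ht).symm,
    hM.mobius, hD⟩, fun s => -ip (γ s) (M s 4), ?_, ?_, ?_⟩
  · exact (contDiffOn_ip (contDiffOn_deriv hI (hsm 0)) (hsm 1)).neg.congr hυ
  · exact (contDiffOn_ip hγ.smooth (hsm 4)).neg
  all_goals
    intro t ht
    obtain ⟨r, hr, e⟩ := hM.lift t ht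
    have e' : γ t = r⁻¹ • M t 0 := by rw [e, smul_smul, inv_mul_cancel₀ hr.ne', one_smul]
    have e2 : -ip (γ t) (M t 4) = r⁻¹ := by
      rw [e', ip_smul_left, (hM.mobius t ht).ip_zero_four]; ring
    simp only [e2]
  · exact inv_pos.2 hr
  · exact e'

/-- Two Frenet frames along the same curve coincide, and so do the curvatures. -/
theorem IsFrenetFrameAlong.unique {γ : ℝ → V} {M N : ℝ → Fin 5 → V} {I : Set ℝ}
    {lam lam' : ℝ → ℝ} {k h k' h' : ℝ} (hI : IsOpen I) (hM : IsFrenetFrameAlong γ M I lam k h)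
    (hN : IsFrenetFrameAlong γ N I lam' k' h') {t : ℝ} (ht : t ∈ I) :
    N t = M t ∧ k' = k ∧ h' = h := by
  have hl : ∀ t ∈ I, lam' t = lam t := fun t ht => by
    rw [← hM.strainDensity_eq hI ht, hN.strainDensity_eq hI ht]
  have hN' : IsFrenetFrame N I lam k' h' := ⟨hN.smooth, hM.speed_smooth, hM.speed_pos, hN.mobius,
    fun t ht j => by rw [← hl t ht]; exact hN.frenet t ht j⟩
  refine hM.toIsFrenetFrame.unique hI hN' (fun t ht => ?_) ht
  obtain ⟨ρ, -, hp, e⟩ := hM.exists_scale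
  obtain ⟨ρ', -, hp', e'⟩ := hN.exists_scale
  refine ⟨(ρ' t)⁻¹ * ρ t, mul_pos (inv_pos.2 (hp' t ht)) (hp t ht), ?_⟩
  rw [mul_smul, ← e t ht, e' t ht, smul_smul, inv_mul_cancel₀ (hp' t ht).ne', one_smul]

/-! ### Changes of parameter and maximality -/

/-- A curve whose image under a change of parameter is again a future directed timelike curve
is traversed in the same direction. -/
theorem deriv_pos_of_comp {γ δ : ℝ → V} {I J : Set ℝ} {g : ℝ → ℝ} (hγ : IsTimelikeCurve γ I)
    (hδ : IsTimelikeCurve δ J) (hg : ContDiffOn ℝ ∞ g I) (hm : MapsTo g I J)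
    (h : ∀ s ∈ I, γ s = δ (g s)) {s : ℝ} (hs : s ∈ I) : 0 < deriv g s := by
  have hI := hγ.interval.isOpen
  have D : HasDerivAt γ (deriv g s • deriv δ (g s)) s := by
    refine ((hδ.hasDerivAt (hm hs)).scomp s
      (hasDerivAt_of_smooth hI hg hs)).congr_of_eventuallyEq ?_
    filter_upwards [hI.mem_nhds hs] with u hu using h u hu
  have h1 := hγ.future s hs
  rw [D.deriv, h s hs] at h1
  simp only [Pi.smul_apply, smul_eq_mul] at h1
  refine pos_of_mul_pos_left ?_ (hδ.future _ (hm hs)).le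
  linarith

theorem strictMonoOn_of_interval {g : ℝ → ℝ} {I : Set ℝ} (hI : IsOpenInterval I)
    (hg : ContDiffOn ℝ ∞ g I) (hpos : ∀ s ∈ I, 0 < deriv g s) : StrictMonoOn g I := by
  refine strictMonoOn_of_deriv_pos hI.ordConnected.convex hg.continuousOn ?_
  rwa [hI.isOpen.interior_eq]

/-- A curve whose total strain is infinite in both directions is maximal: along an extension
`δ`, the strain density is bounded near a point of `J` that is an end point of `J'`, so that the
total strain up to that point would be finite. -/
theorem isMaximalCurve_of_strain {γ : ℝ → V} {I : Set ℝ} (hγ : IsTimelikeCurve γ I)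
    {f : ℝ → ℝ} {c : ℝ} (hc : 0 < c) (hf : ContDiffOn ℝ ∞ f I) (hfpos : ∀ s ∈ I, 0 < deriv f s)
    (hsurj : SurjOn f I univ) (hstrain : ∀ s ∈ I, strainDensity γ s = c * deriv f s) :
    IsMaximalCurve γ I := by
  intro δ J J' g hδ hJ' hg heq
  have hI := hγ.interval
  have hm : MapsTo g I J := fun s hs => hJ' (hg.bijOn.mapsTo hs)
  have hgpos : ∀ s ∈ I, 0 < deriv g s := fun s hs =>
    deriv_pos_of_comp hγ hδ.1 hg.smooth hm heq hs
  have hfmono := strictMonoOn_of_interval hI hf hfpos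
  have hgmono := strictMonoOn_of_interval hI hg.smooth hgpos
  -- on an arc mapped to a compact interval of `J`, the growth of `f` is bounded by that of `g`
  have bound : ∀ p ∈ J, ∀ p' ∈ J, ∃ C : ℝ, 0 < C ∧ ∀ x ∈ I, ∀ y ∈ I, x ≤ y → p ≤ g x → g y ≤ p' →
      c * (f y - f x) ≤ C * (g y - g x) := by
    intro p hp p' hp'
    have hsub : Icc p p' ⊆ J := hδ.1.interval.ordConnected.out hp hp'
    obtain ⟨C, hC⟩ := isCompact_Icc.exists_bound_of_continuousOn
      (hδ.1.continuousOn_strainDensity.mono hsub)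
    refine ⟨max C 1, by positivity, fun x hx y hy hxy hpx hpy => ?_⟩
    have hsubI : Icc x y ⊆ I := hI.ordConnected.out hx hy
    have hanti : AntitoneOn (fun s => c * f s - max C 1 * g s) (Icc x y) := by
      have hd : ∀ s ∈ I, HasDerivAt (fun s => c * f s - max C 1 * g s)
          (c * deriv f s - max C 1 * deriv g s) s := fun s hs =>
        ((hasDerivAt_of_smooth hI.isOpen hf hs).const_mul c).sub
          ((hasDerivAt_of_smooth hI.isOpen hg.smooth hs).const_mul _)
      refine antitoneOn_of_deriv_nonpos (convex_Icc x y)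
        (fun s hs => (hd s (hsubI hs)).continuousAt.continuousWithinAt)
        (fun s hs => (hd s (hsubI (interior_subset hs))).differentiableAt.differentiableWithinAt)
        fun s hs => ?_
      have hsI := hsubI (interior_subset hs)
      have hs' := interior_subset hs
      rw [(hd s hsI).deriv, ← hstrain s hsI,
        strainDensity_comp hI.isOpen hδ.1 hg.smooth hm heq hsI (hgpos s hsI)]
      have h1 : strainDensity δ (g s) ≤ max C 1 := by
        have := hC (g s) ⟨hpx.trans (hgmono.monotoneOn hx hsI hs'.1),
          (hgmono.monotoneOn hsI hy hs'.2).trans hpy⟩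
        exact ((le_abs_self _).trans this).trans (le_max_left _ _)
      nlinarith [hgpos s hsI]
    have := hanti (left_mem_Icc.2 hxy) (right_mem_Icc.2 hxy) hxy
    simp only at this
    linarith
  refine hJ'.antisymm fun e he => ?_
  by_contra hne
  obtain ⟨s₀, hs₀⟩ := hI.nonempty
  have hord : J'.OrdConnected := by
    rw [← hg.bijOn.image_eq]
    exact (hI.ordConnected.isPreconnected.image g hg.smooth.continuousOn).ordConnected
  have hgs₀ := hg.bijOn.mapsTo hs₀
  rcases lt_trichotomy e (g s₀) with h | h | h
  · obtain ⟨C, hC, hb⟩ := bound e he (g s₀) (hm hs₀)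
    obtain ⟨s₁, hs₁, hfs₁⟩ := hsurj (mem_univ (f s₀ - C * (g s₀ - e) / c - 1))
    have hlt : f s₁ < f s₀ := by
      rw [hfs₁]
      have : 0 < C * (g s₀ - e) / c := div_pos (mul_pos hC (sub_pos.2 h)) hc
      linarith
    have hs := (hfmono.lt_iff_lt hs₁ hs₀).1 hlt
    have he1 : e ≤ g s₁ := by
      by_contra h'
      exact hne (hord.out (hg.bijOn.mapsTo hs₁) hgs₀ ⟨(not_le.1 h').le, h.le⟩)
    have h2 := hb s₁ hs₁ s₀ hs₀ hs.le he1 le_rfl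
    rw [hfs₁] at h2
    have h3 : c * (f s₀ - (f s₀ - C * (g s₀ - e) / c - 1)) = C * (g s₀ - e) + c := by
      field_simp; ring
    rw [h3] at h2
    nlinarith
  · exact hne (h ▸ hgs₀)
  · obtain ⟨C, hC, hb⟩ := bound (g s₀) (hm hs₀) e he
    obtain ⟨s₁, hs₁, hfs₁⟩ := hsurj (mem_univ (f s₀ + C * (e - g s₀) / c + 1))
    have hlt : f s₀ < f s₁ := by
      rw [hfs₁]
      have : 0 < C * (e - g s₀) / c := div_pos (mul_pos hC (sub_pos.2 h)) hc
      linarith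
    have hs := (hfmono.lt_iff_lt hs₀ hs₁).1 hlt
    have he1 : g s₁ ≤ e := by
      by_contra h'
      exact hne (hord.out hgs₀ (hg.bijOn.mapsTo hs₁) ⟨h.le, (not_le.1 h').le⟩)
    have h2 := hb s₀ hs₀ s₁ hs₁ hs.le le_rfl he1
    rw [hfs₁] at h2
    have h3 : c * ((f s₀ + C * (e - g s₀) / c + 1) - f s₀) = C * (e - g s₀) + c := by
      field_simp; ring
    rw [h3] at h2
    nlinarith

theorem exists_smooth_primitive {I : Set ℝ} (hI : IsOpenInterval I) {u : ℝ → ℝ}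
    (hu : ContDiffOn ℝ ∞ u I) {s₀ : ℝ} (hs₀ : s₀ ∈ I) :
    ∃ f : ℝ → ℝ, ContDiffOn ℝ ∞ f I ∧ (∀ s ∈ I, deriv f s = u s) ∧ f s₀ = 0 := by
  have hd : ∀ s ∈ I, HasDerivAt (fun x => ∫ y in s₀..x, u y) (u s) s := by
    intro s hs
    have hsub : uIcc s₀ s ⊆ I := hI.ordConnected.uIcc_subset hs₀ hs
    exact intervalIntegral.integral_hasDerivAt_right
      ((hu.continuousOn.mono hsub).intervalIntegrable)
      (hu.continuousOn.stronglyMeasurableAtFilter hI.isOpen s hs)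
      (hu.continuousOn.continuousAt (hI.isOpen.mem_nhds hs))
  refine ⟨fun x => ∫ y in s₀..x, u y, ?_, fun s hs => (hd s hs).deriv, by simp⟩
  rw [contDiffOn_infty_iff_deriv_of_isOpen hI.isOpen]
  exact ⟨fun s hs => (hd s hs).differentiableAt.differentiableWithinAt,
    hu.congr fun s hs => (hd s hs).deriv⟩

theorem isParamChange_of_deriv_pos {f : ℝ → ℝ} {I : Set ℝ} (hI : IsOpenInterval I)
    (hf : ContDiffOn ℝ ∞ f I) (hpos : ∀ s ∈ I, 0 < deriv f s) : IsParamChange f I (f '' I) :=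
  ⟨(strictMonoOn_of_interval hI hf hpos).injOn.bijOn_image, hf, fun s hs => (hpos s hs).ne'⟩

/-! ### Frames built from the derivatives of a homogeneous null curve -/

theorem vol_ne_zero_of_gram {B : Fin 5 → V} {G : Matrix (Fin 5) (Fin 5) ℝ}
    (hG : ∀ i j, ip (B i) (B j) = G i j) (hdet : G.det ≠ 0) : vol B ≠ 0 := by
  have : G = Matrix.of B * (Matrix.diagonal ![-1, -1, 1, 1, 1] * (Matrix.of B).transpose) := by
    ext i j
    rw [← hG]
    simp [Matrix.mul_apply, Fin.sum_univ_five, Matrix.diagonal_apply, ip]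
    ring
  rw [this, Matrix.det_mul] at hdet
  exact left_ne_zero_of_mul hdet

theorem det_mobiusGram_ne_zero : mobiusGram.det ≠ 0 := by
  simp [mobiusGram, Matrix.det_succ_row_zero, Fin.sum_univ_succ, Fin.succAbove]

/-- The Frenet frame of the null curve `y 0`, for a sequence `y n` of vectors that behave like the
successive derivatives of a homogeneous curve. -/
noncomputable def krylovFrame (r l k h : ℝ) (y : ℕ → V) : Fin 5 → V :=
  ![r • y 0, (r / l) • y 1, (-(r / l ^ 3)) • y 3 - (2 * h * (r / l)) • y 1,
    k⁻¹ • (-(r / l ^ 4) • y 4 - (2 * h * (r / l ^ 2)) • y 2 - r • y 0),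
    (-(r / l ^ 2)) • y 2 - (h * r) • y 0]

/-- A curve `Y 0` generated by a skew endomorphism that is annihilated by `x⁵ + c₁ x³ + c₀ x`
is a multiple of a Frenet frame with constant curvatures, read off by comparing
`x⁵ + c₁ x³ + c₀ x` with the characteristic polynomial `x⁵ + (k² + 2h) x³ + (1 + 2hk²) x` of the
Frenet matrix. All scalar products are constant, so they are only needed at `0`. -/
theorem isFrenetFrame_krylovFrame {Y : ℕ → ℝ → V} {r l k h c₁ c₀ μ₁ μ₂ : ℝ} (hr : 0 < r)
    (hl : 0 < l) (hk : 0 < k) (hd : ∀ n t, HasDerivAt (Y n) (Y (n + 1) t) t)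
    (hskew : ∀ m n t, ip (Y m t) (Y (n + 1) t) = -ip (Y (m + 1) t) (Y n t))
    (hrel : ∀ t, Y 5 t = -(c₁ • Y 3 t + c₀ • Y 1 t))
    (h00 : ip (Y 0 0) (Y 0 0) = 0) (h11 : ip (Y 1 0) (Y 1 0) = -μ₁)
    (h22 : ip (Y 2 0) (Y 2 0) = μ₂)
    (hμ₁ : r ^ 2 * μ₁ = l ^ 2) (hμ₂ : 2 * h * l ^ 2 * μ₁ = -μ₂) (hc₁ : (k ^ 2 + 2 * h) * l ^ 2 = c₁)
    (hc₀ : (1 + 2 * h * k ^ 2) * l ^ 4 = c₀)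
    (hvol : vol (fun i : Fin 5 => Y i 0) < 0) (htime : 0 < timeArea (Y 0 0) (Y 1 0)) :
    IsFrenetFrame (fun t => krylovFrame r l k h fun n => Y n t) univ (fun _ => l) k h := by
  have hconst : ∀ m n t, ip (Y m t) (Y n t) = ip (Y m 0) (Y n 0) := by
    intro m n t
    have hD : ∀ s, HasDerivAt (fun s => ip (Y m s) (Y n s)) 0 s := fun s =>
      (hasDerivAt_ip (hd m s) (hd n s)).congr_deriv (by rw [hskew]; ring)
    exact is_const_of_deriv_eq_zero (fun s => (hD s).differentiableAt) (fun s => (hD s).deriv) t 0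
  have e00 : ∀ t, ip (Y 0 t) (Y 0 t) = 0 := fun t => by rw [hconst, h00]
  have e11 : ∀ t, ip (Y 1 t) (Y 1 t) = -μ₁ := fun t => by rw [hconst, h11]
  have e22 : ∀ t, ip (Y 2 t) (Y 2 t) = μ₂ := fun t => by rw [hconst, h22]
  have eodd : ∀ n t, ip (Y n t) (Y (n + 1) t) = 0 := fun n t => by
    have := hskew n n t
    rw [ip_comm (Y (n + 1) t)] at this
    linarith
  have e01 : ∀ t, ip (Y 0 t) (Y 1 t) = 0 := fun t => eodd 0 t
  have e12 : ∀ t, ip (Y 1 t) (Y 2 t) = 0 := fun t => eodd 1 t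
  have e23 : ∀ t, ip (Y 2 t) (Y 3 t) = 0 := fun t => eodd 2 t
  have e34 : ∀ t, ip (Y 3 t) (Y 4 t) = 0 := fun t => eodd 3 t
  have e02 : ∀ t, ip (Y 0 t) (Y 2 t) = μ₁ := fun t => by rw [hskew 0 1, e11, neg_neg]
  have e03 : ∀ t, ip (Y 0 t) (Y 3 t) = 0 := fun t => by rw [hskew 0 2, e12, neg_zero]
  have e13 : ∀ t, ip (Y 1 t) (Y 3 t) = -μ₂ := fun t => by rw [hskew 1 2, e22]
  have e04 : ∀ t, ip (Y 0 t) (Y 4 t) = μ₂ := fun t => by rw [hskew 0 3, e13, neg_neg]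
  have e14 : ∀ t, ip (Y 1 t) (Y 4 t) = 0 := fun t => by rw [hskew 1 3, e23, neg_zero]
  have e33 : ∀ t, ip (Y 3 t) (Y 3 t) = c₁ * μ₂ + c₀ * μ₁ := fun t => by
    have h1 := hskew 1 4 t
    have h2 := hskew 2 3 t
    rw [hrel] at h1
    simp only [ip_neg_right, ip_add_right, ip_smul_right, e11, e13] at h1
    linarith
  have e24 : ∀ t, ip (Y 2 t) (Y 4 t) = -(c₁ * μ₂ + c₀ * μ₁) := fun t => by rw [hskew 2 3, e33]
  have e44 : ∀ t, ip (Y 4 t) (Y 4 t) = c₁ * (c₁ * μ₂ + c₀ * μ₁) - c₀ * μ₂ := fun t => by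
    have h1 := hskew 3 4 t
    rw [hrel] at h1
    simp only [ip_neg_right, ip_add_right, ip_smul_right, e33, ip_comm (Y 3 t) (Y 1 t), e13] at h1
    linarith
  have hm1 : μ₁ = l ^ 2 / r ^ 2 := by field_simp; linarith
  have hm2 : μ₂ = -(2 * h * l ^ 4 / r ^ 2) := by
    rw [hm1] at hμ₂
    field_simp at hμ₂ ⊢
    linarith
  have hgram : ∀ t i j, ip (krylovFrame r l k h (fun n => Y n t) i)
      (krylovFrame r l k h (fun n => Y n t) j) = mobiusGram i j := by
    intro t
    have aux : ∀ i j : Fin 5, i ≤ j → ip (krylovFrame r l k h (fun n => Y n t) i)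
        (krylovFrame r l k h (fun n => Y n t) j) = mobiusGram i j := by
      intro i j hij
      fin_cases i <;> fin_cases j <;> first
        | exact absurd hij (by decide)
        | (simp only [krylovFrame, mobiusGram, Matrix.of_apply, Matrix.cons_val, Fin.zero_eta,
            Fin.mk_one, Fin.reduceFinMk, ip_sub_left, ip_sub_right, ip_smul_left, ip_smul_right,
            e00, e01, e02, e03, e04, ip_comm (Y 1 t) (Y 0 t), e11, e12, e13, e14,
            ip_comm (Y 2 t) (Y 0 t), e22, e23, e24,
            ip_comm (Y 3 t) (Y 0 t), ip_comm (Y 3 t) (Y 1 t), ip_comm (Y 3 t) (Y 2 t), e33, e34,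
            ip_comm (Y 4 t) (Y 0 t), ip_comm (Y 4 t) (Y 2 t), e44, ← hc₁, ← hc₀, hm1, hm2]
           try field_simp
           try ring)
    intro i j
    rcases le_total i j with hij | hij
    · exact aux i j hij
    · rw [ip_comm, aux j i hij]
      fin_cases i <;> fin_cases j <;> rfl
  have hYc : ∀ n, Continuous (Y n) := fun n =>
    continuous_iff_continuousAt.2 fun t => (hd n t).continuousAt
  have hYs : ∀ n, ContDiff ℝ ∞ (Y n) := by
    have : ∀ m : ℕ, ∀ n, ContDiff ℝ m (Y n) := by
      intro m
      induction m with
      | zero => exact fun n => contDiff_zero.2 (hYc n)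
      | succ m ih =>
        intro n
        rw [Nat.cast_succ, contDiff_succ_iff_deriv]
        refine ⟨fun t => (hd n t).differentiableAt, by simp, ?_⟩
        rw [show deriv (Y n) = Y (n + 1) from funext fun t => (hd n t).deriv]
        exact ih _
    exact fun n => contDiff_infty.2 fun m => this m n
  have hMs : ContDiff ℝ ∞ (fun t => krylovFrame r l k h fun n => Y n t) := by
    rw [contDiff_pi]
    have h0 := hYs 0
    have h1 := hYs 1
    have h2 := hYs 2
    have h3 := hYs 3
    have h4 := hYs 4
    intro i
    fin_cases i <;> simp [krylovFrame] <;> fun_prop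
  -- the orientation and the time orientation do not change along the curve, by continuity
  have hvne : ∀ t, vol (krylovFrame r l k h fun n => Y n t) ≠ 0 := fun t =>
    vol_ne_zero_of_gram (hgram t) det_mobiusGram_ne_zero
  have hvol0 : 0 < vol (krylovFrame r l k h fun n => Y n 0) := by
    let C : Matrix (Fin 5) (Fin 5) ℝ := !![r, 0, 0, 0, 0; 0, r / l, 0, 0, 0;
      0, -(2 * h * (r / l)), 0, -(r / l ^ 3), 0;
      -(k⁻¹ * r), 0, -(k⁻¹ * (2 * h * (r / l ^ 2))), 0, -(k⁻¹ * (r / l ^ 4));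
      -(h * r), 0, -(r / l ^ 2), 0, 0]
    have e : (krylovFrame r l k h fun n => Y n 0) = fun i => ∑ j, C i j • Y j 0 := by
      funext i
      fin_cases i <;> simp [krylovFrame, C, Fin.sum_univ_five] <;> module
    have hC : C.det = -(r * (r / l) * (r / l ^ 3) * (k⁻¹ * (r / l ^ 4)) * (r / l ^ 2)) := by
      simp [C, Matrix.det_succ_row_zero, Fin.sum_univ_succ, Fin.succAbove]
      ring
    rw [e, vol_sum_smul, hC]
    exact mul_pos_of_neg_of_neg (neg_neg_of_pos (by positivity)) hvol
  have hvpos : ∀ t, 0 < vol (krylovFrame r l k h fun n => Y n t) := by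
    intro t
    refine (pos_iff_of_ne_zero isPreconnected_univ ?_ (fun s _ => hvne s) (mem_univ (0 : ℝ))
      (mem_univ t)).1 hvol0
    exact (Continuous.matrix_det hMs.continuous).continuousOn
  have hM0 : ∀ t, krylovFrame r l k h (fun n => Y n t) 0 = r • Y 0 t := fun t => rfl
  have hM1 : ∀ t, krylovFrame r l k h (fun n => Y n t) 1 = (r / l) • Y 1 t := fun t => rfl
  have htpos : ∀ t, 0 < timeArea (krylovFrame r l k h (fun n => Y n t) 0)
      (krylovFrame r l k h (fun n => Y n t) 1) := by
    intro t
    refine (pos_iff_of_ne_zero isPreconnected_univ (g := fun t =>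
      timeArea (krylovFrame r l k h (fun n => Y n t) 0)
      (krylovFrame r l k h (fun n => Y n t) 1)) ?_ (fun s _ => ?_) (mem_univ (0 : ℝ))
      (mem_univ t)).1 ?_
    · have h0 := fun i => (continuous_apply i).comp (hYc 0)
      have h1 := fun i => (continuous_apply i).comp (hYc 1)
      have := ((continuous_const (y := r * (r / l))).mul
        (((h0 0).mul (h1 1)).sub ((h0 1).mul (h1 0)))).continuousOn (s := univ)
      refine this.congr fun s _ => ?_
      simp only [hM0, hM1, timeArea, Pi.smul_apply, smul_eq_mul, Pi.mul_apply, Pi.sub_apply,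
        Function.comp]
      ring
    · apply timeArea_ne_zero
      · intro α β
        have g00 : ip _ _ = 0 := hgram s 0 0
        have g01 : ip _ _ = 0 := hgram s 0 1
        have g11 : ip _ _ = -1 := hgram s 1 1
        rw [ip_comb_self, g00, g01, g11]
        nlinarith [sq_nonneg β]
      · intro α β h0
        have := Fintype.linearIndependent_iff.1 (linearIndependent_of_vol_ne (hvne s))
          ![α, β, 0, 0, 0] (by
            rw [← h0]
            simp only [Fin.sum_univ_five]
            simp)
        exact ⟨this 0, this 1⟩
    · have : timeArea (r • Y 0 0) ((r / l) • Y 1 0) = r * (r / l) * timeArea (Y 0 0) (Y 1 0) := by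
        simp only [timeArea, Pi.smul_apply, smul_eq_mul]; ring
      simp only [hM0, hM1, this]
      positivity
  refine ⟨hMs.contDiffOn, contDiffOn_const, fun _ _ => hl, fun t _ =>
    isMobiusBasis_of_timeArea_pos (hgram t) (hvpos t) (htpos t), fun t _ j => ?_⟩
  have hl' := hl.ne'
  have hk' := hk.ne'
  have h5 := hd 4 t
  rw [hrel, ← hc₁, ← hc₀] at h5
  fin_cases j
  · refine ((hd 0 t).const_smul r).congr_deriv ?_
    simp [Fin.sum_univ_five, frenetMatrix, krylovFrame]
    match_scalars
    field_simp
  · refine ((hd 1 t).const_smul (r / l)).congr_deriv ?_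
    simp [Fin.sum_univ_five, frenetMatrix, krylovFrame]
    match_scalars <;> field_simp
    ring
  · refine (((hd 3 t).const_smul (-(r / l ^ 3))).sub
      ((hd 1 t).const_smul (2 * h * (r / l)))).congr_deriv ?_
    simp [Fin.sum_univ_five, frenetMatrix, krylovFrame]
    match_scalars <;> field_simp
    ring
  · refine ((((h5.const_smul (-(r / l ^ 4))).sub ((hd 2 t).const_smul
      (2 * h * (r / l ^ 2)))).sub ((hd 0 t).const_smul r)).const_smul k⁻¹).congr_deriv ?_
    simp [Fin.sum_univ_five, frenetMatrix, krylovFrame]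
    match_scalars <;> (field_simp; ring)
  · refine (((hd 2 t).const_smul (-(r / l ^ 2))).sub
      ((hd 0 t).const_smul (h * r))).congr_deriv ?_
    simp [Fin.sum_univ_five, frenetMatrix, krylovFrame]
    match_scalars <;> field_simp
    ring

/-! ### The generators of the model curves -/

namespace RegularClass

/-- The matrix, in a basis of the kind of the class, of the infinitesimal conformal motion
generating the model curves with second parameter `b`. -/
noncomputable def genMatrix : RegularClass → ℝ → Matrix (Fin 5) (Fin 5) ℝ
  | C1, b => !![b, 0, 0, 1, 0; 0, -b, 0, 0, -1; 0, 0, 0, 0, 0; -1, 0, 0, b, 0; 0, 1, 0, 0, -b]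
  | C2i, b => !![0, -1, 0, 0, 0; 1, 0, 0, 0, 0; 0, 0, 0, 0, 0; 0, 0, 0, 0, b; 0, 0, 0, -b, 0]
  | C2ii, b => !![0, -1, 0, 0, 0; 1, 0, 0, 0, 0; 0, 0, 0, 0, 0; 0, 0, 0, 0, -b; 0, 0, 0, b, 0]
  | C3, b => Matrix.diagonal ![1, -b, 0, b, -1]
  | C4, b => !![0, 0, 0, 0, 0; 0, 0, -1, 0, 0; 0, -1, 0, 0, 0; 0, 0, 0, 0, -b; 0, 0, 0, b, 0]

/-- The infinitesimal conformal motion generating the model curves, in coordinates. -/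
noncomputable def gen (c : RegularClass) (b : ℝ) : V →ₗ[ℝ] V := Matrix.toLin' (c.genMatrix b)

section gen_apply

variable (b x₀ x₁ x₂ x₃ x₄ : ℝ)

theorem gen_C1 : C1.gen b ![x₀, x₁, x₂, x₃, x₄] =
    ![b * x₀ + x₃, -(b * x₁) - x₄, 0, b * x₃ - x₀, x₁ - b * x₄] := by
  funext i
  fin_cases i <;> simp [gen, genMatrix, Matrix.mulVec, dotProduct, Fin.sum_univ_five] <;> ring

theorem gen_C2i : C2i.gen b ![x₀, x₁, x₂, x₃, x₄] = ![-x₁, x₀, 0, b * x₄, -(b * x₃)] := by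
  funext i
  fin_cases i <;> simp [gen, genMatrix, Matrix.mulVec, dotProduct, Fin.sum_univ_five]

theorem gen_C2ii : C2ii.gen b ![x₀, x₁, x₂, x₃, x₄] = ![-x₁, x₀, 0, -(b * x₄), b * x₃] := by
  funext i
  fin_cases i <;> simp [gen, genMatrix, Matrix.mulVec, dotProduct, Fin.sum_univ_five]

theorem gen_C3 : C3.gen b ![x₀, x₁, x₂, x₃, x₄] = ![x₀, -(b * x₁), 0, b * x₃, -x₄] := by
  funext i
  fin_cases i <;> simp [gen, genMatrix, Matrix.mulVec_diagonal]

theorem gen_C4 : C4.gen b ![x₀, x₁, x₂, x₃, x₄] = ![0, -x₂, -x₁, -(b * x₄), b * x₃] := by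
  funext i
  fin_cases i <;> simp [gen, genMatrix, Matrix.mulVec, dotProduct, Fin.sum_univ_five]

end gen_apply

/-- A vector as a literal, the form on which the formulas for the generators apply. -/
theorem eq_vec (x : V) : x = ![x 0, x 1, x 2, x 3, x 4] := by
  funext i
  fin_cases i <;> rfl

theorem hasDerivAt_coords (c : RegularClass) (a b t : ℝ) :
    HasDerivAt (c.coords a b) (c.gen b (c.coords a b t)) t := by
  have hE : HasDerivAt (fun t => Real.exp (b * (t - Real.pi / 4)))
      (b * Real.exp (b * (t - Real.pi / 4))) t :=
    (((hasDerivAt_id' t).sub_const (Real.pi / 4)).const_mul b).exp.congr_deriv (by ring)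
  have hE' : HasDerivAt (fun t => Real.exp (-(b * (t - Real.pi / 4))))
      (-b * Real.exp (-(b * (t - Real.pi / 4)))) t :=
    (((hasDerivAt_id' t).sub_const (Real.pi / 4)).const_mul b).fun_neg.exp.congr_deriv (by ring)
  have hc := Real.hasDerivAt_cos t
  have hs := Real.hasDerivAt_sin t
  have hcb : HasDerivAt (fun t => Real.cos (b * t)) (-(b * Real.sin (b * t))) t :=
    ((hasDerivAt_id' t).const_mul b).cos.congr_deriv (by ring)
  have hsb : HasDerivAt (fun t => Real.sin (b * t)) (b * Real.cos (b * t)) t :=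
    ((hasDerivAt_id' t).const_mul b).sin.congr_deriv (by ring)
  have he := Real.hasDerivAt_exp t
  have he' : HasDerivAt (fun t => Real.exp (-t)) (-Real.exp (-t)) t :=
    (hasDerivAt_id' t).fun_neg.exp.congr_deriv (by ring)
  have heb : HasDerivAt (fun t => Real.exp (b * t)) (b * Real.exp (b * t)) t :=
    ((hasDerivAt_id' t).const_mul b).exp.congr_deriv (by ring)
  have heb' : HasDerivAt (fun t => Real.exp (-(b * t))) (-(b * Real.exp (-(b * t)))) t :=
    ((hasDerivAt_id' t).const_mul b).fun_neg.exp.congr_deriv (by ring)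
  rw [hasDerivAt_pi]
  cases c
  · simp only [coords, gen_C1]
    intro i
    fin_cases i
    · exact (hE.mul (hc.add (hs.const_mul a))).congr_deriv (by simp; ring)
    · exact (hE'.mul (hs.add (hc.const_mul a))).neg.congr_deriv (by simp; ring)
    · exact hasDerivAt_const _ _
    · exact (hE.mul ((hc.const_mul a).sub hs)).congr_deriv (by simp; ring)
    · exact (hE'.mul (hc.sub (hs.const_mul a))).congr_deriv (by simp; ring)
  · simp only [coords, gen_C2i]
    intro i
    fin_cases i
    · exact hc
    · exact hs
    · exact hasDerivAt_const _ _
    · exact (hcb.const_mul (√(1 - a ^ 2))).congr_deriv (by simp; ring)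
    · exact (hsb.const_mul (√(1 - a ^ 2))).neg.congr_deriv (by simp; ring)
  · simp only [coords, gen_C2ii]
    intro i
    fin_cases i
    · exact hc
    · exact hs
    · exact hasDerivAt_const _ _
    · exact (hcb.const_mul (√(1 - a ^ 2))).congr_deriv (by simp; ring)
    · exact (hsb.const_mul (√(1 - a ^ 2))).congr_deriv (by simp; ring)
  · simp only [coords, gen_C3]
    intro i
    fin_cases i
    · exact he.const_mul ((1 + 4 * a) / 4)
    · exact heb'
    · exact hasDerivAt_const _ _
    · exact (heb.const_mul ((1 - 4 * a) / 4)).congr_deriv (by simp; ring)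
    · exact he'
  · simp only [coords, gen_C4]
    intro i
    fin_cases i
    · exact hasDerivAt_const _ _
    · exact ((Real.hasDerivAt_sinh t).const_mul a).congr_deriv (by simp)
    · exact ((Real.hasDerivAt_cosh t).const_mul a).neg.congr_deriv (by simp)
    · exact (hcb.const_mul (√(1 - a ^ 2))).congr_deriv (by simp; ring)
    · exact (hsb.const_mul (√(1 - a ^ 2))).congr_deriv (by simp; ring)

/-- The coefficient of `x³` in the characteristic polynomial `x⁵ + c₁ x³ + c₀ x` of the
generator. -/
noncomputable def coeffThree : RegularClass → ℝ → ℝ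
  | C1, b => 2 * (1 - b ^ 2)
  | C2i, b => 1 + b ^ 2
  | C2ii, b => 1 + b ^ 2
  | C3, b => -(1 + b ^ 2)
  | C4, b => b ^ 2 - 1

/-- The coefficient of `x` in the characteristic polynomial `x⁵ + c₁ x³ + c₀ x` of the
generator. -/
noncomputable def coeffOne : RegularClass → ℝ → ℝ
  | C1, b => (1 + b ^ 2) ^ 2
  | C2i, b => b ^ 2
  | C2ii, b => b ^ 2
  | C3, b => b ^ 2
  | C4, b => -b ^ 2

/-- The Cayley–Hamilton relation of the generator. -/
theorem gen_cayley (c : RegularClass) (b : ℝ) (x : V) :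
    (c.gen b)^[5] x = -(c.coeffThree b • (c.gen b)^[3] x + c.coeffOne b • c.gen b x) := by
  rw [eq_vec x]
  cases c <;> funext i <;> fin_cases i <;>
    simp [gen_C1, gen_C2i, gen_C2ii, gen_C3, gen_C4, coeffOne, coeffThree] <;> ring

/-- The linear combinations of the standard basis of the class. -/
noncomputable def combine (c : RegularClass) : V →ₗ[ℝ] V :=
  Fintype.linearCombination ℝ c.stdBasis

theorem combine_apply (c : RegularClass) (x : V) : c.combine x = ∑ i, x i • c.stdBasis i :=
  Fintype.linearCombination_apply _ _ _

theorem ip_sum_poincare {B : Fin 5 → V} (hB : IsPoincareBasis B) (x y : V) :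
    ip (∑ i, x i • B i) (∑ i, y i • B i) =
      -(x 0 * y 0) - x 1 * y 1 + x 2 * y 2 + x 3 * y 3 + x 4 * y 4 := by
  rw [ip_sum_smul]
  simp only [hB.gram, Fin.sum_univ_five, poincareGram]
  simp
  ring

theorem ip_sum_lie {B : Fin 5 → V} (hB : IsLieBasis B) (x y : V) :
    ip (∑ i, x i • B i) (∑ i, y i • B i) =
      -(x 0 * y 4 + x 4 * y 0) - (x 1 * y 3 + x 3 * y 1) + x 2 * y 2 := by
  rw [ip_sum_smul]
  simp only [hB.gram, Fin.sum_univ_five, lieGram]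
  simp
  ring

/-- The generator is skew for the scalar product. -/
theorem gen_skew (c : RegularClass) (b : ℝ) (x y : V) :
    ip (c.combine x) (c.combine (c.gen b y)) = -ip (c.combine (c.gen b x)) (c.combine y) := by
  rw [eq_vec x, eq_vec y]
  simp only [combine_apply]
  cases c
  · simp only [stdBasis, ip_sum_lie isLieBasis_stdLie, gen_C1]
    simp
    ring
  · simp only [stdBasis, ip_sum_poincare isPoincareBasis_stdPoincare, gen_C2i]
    simp
    ring
  · simp only [stdBasis, ip_sum_poincare isPoincareBasis_stdPoincare, gen_C2ii]
    simp
    ring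
  · simp only [stdBasis, ip_sum_lie isLieBasis_stdLie, gen_C3]
    simp
    ring
  · simp only [stdBasis, ip_sum_poincare isPoincareBasis_stdPoincare, gen_C4]
    simp
    ring

/-- The value of `-⟨γ', γ'⟩` for the model curves. -/
noncomputable def momentOne : RegularClass → ℝ → ℝ → ℝ
  | C1, a, b => 2 * ((1 - a * b) ^ 2 - (a + b) ^ 2)
  | C2i, a, b => 1 - (1 - a ^ 2) * b ^ 2
  | C2ii, a, b => 1 - (1 - a ^ 2) * b ^ 2
  | C3, a, b => ((4 * a - 1) * b ^ 2 - (4 * a + 1)) / 2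
  | C4, a, b => a ^ 2 - (1 - a ^ 2) * b ^ 2

/-- The value of `⟨γ'', γ''⟩` for the model curves. -/
noncomputable def momentTwo : RegularClass → ℝ → ℝ → ℝ
  | C1, a, b => 2 * (4 * b * (a + b) * (1 - a * b) - (b ^ 2 - 1) * ((a + b) ^ 2 - (1 - a * b) ^ 2))
  | C2i, a, b => -1 + (1 - a ^ 2) * b ^ 4
  | C2ii, a, b => -1 + (1 - a ^ 2) * b ^ 4
  | C3, a, b => ((4 * a - 1) * b ^ 4 - (4 * a + 1)) / 2
  | C4, a, b => a ^ 2 + (1 - a ^ 2) * b ^ 4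

/-- The initial point of a model curve, with abbreviations for the constants that occur in it. -/
theorem coords_zero_C1 (a b : ℝ) : ∃ E E' : ℝ, E * E' = 1 ∧
    C1.coords a b 0 = ![E, -(E' * a), -√(2 * (1 - a ^ 2)), E * a, E'] := by
  refine ⟨Real.exp (b * (0 - Real.pi / 4)), Real.exp (-(b * (0 - Real.pi / 4))), ?_, ?_⟩
  · rw [← Real.exp_add, add_neg_cancel, Real.exp_zero]
  · simp [coords]

theorem one_sub_sq_pos {c : RegularClass} {a b : ℝ} (hp : (a, b) ∈ c.domain) (hc : c ≠ C3) :
    0 < 1 - a ^ 2 := by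
  cases c
  · obtain ⟨h1, h2, -⟩ := hp
    simp only at h1 h2
    nlinarith
  · obtain ⟨h1, h2, -⟩ := hp
    simp only at h1 h2
    nlinarith
  · obtain ⟨h1, h2, -⟩ := hp
    simp only at h1 h2
    nlinarith
  · exact absurd rfl hc
  · obtain ⟨h1, h2, -⟩ := hp
    simp only at h1 h2
    nlinarith

/-- The scalar products of the derivatives of a model curve. -/
theorem moments_zero {c : RegularClass} {a b : ℝ} (hp : (a, b) ∈ c.domain) :
    ip (c.combine (c.coords a b 0)) (c.combine (c.coords a b 0)) = 0 ∧
    ip (c.combine (c.gen b (c.coords a b 0))) (c.combine (c.gen b (c.coords a b 0))) =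
      -c.momentOne a b ∧
    ip (c.combine (c.gen b (c.gen b (c.coords a b 0))))
      (c.combine (c.gen b (c.gen b (c.coords a b 0)))) = c.momentTwo a b := by
  cases c
  · obtain ⟨E, E', hE, e⟩ := coords_zero_C1 a b
    have hw := Real.mul_self_sqrt (mul_pos two_pos (one_sub_sq_pos hp (by simp))).le
    rw [e]
    simp only [combine_apply, stdBasis, ip_sum_lie isLieBasis_stdLie, gen_C1, momentOne, momentTwo]
    generalize √(2 * (1 - a ^ 2)) = w at hw ⊢
    simp
    refine ⟨?_, ?_, ?_⟩
    · linear_combination hw + (2 * a ^ 2 - 2) * hE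
    · linear_combination 2 * ((a + b) ^ 2 - (1 - a * b) ^ 2) * hE
    · linear_combination 2 * (4 * b * (a + b) * (1 - a * b) -
        (b ^ 2 - 1) * ((a + b) ^ 2 - (1 - a * b) ^ 2)) * hE
  · have hw := Real.mul_self_sqrt (one_sub_sq_pos hp (by simp)).le
    simp only [coords, combine_apply, stdBasis, ip_sum_poincare isPoincareBasis_stdPoincare,
      gen_C2i, momentOne, momentTwo]
    simp
    generalize √(1 - a ^ 2) = w at hw ⊢
    refine ⟨?_, ?_, ?_⟩
    · linear_combination hw
    · linear_combination b ^ 2 * hw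
    · linear_combination b ^ 4 * hw
  · have hw := Real.mul_self_sqrt (one_sub_sq_pos hp (by simp)).le
    simp only [coords, combine_apply, stdBasis, ip_sum_poincare isPoincareBasis_stdPoincare,
      gen_C2ii, momentOne, momentTwo]
    simp
    generalize √(1 - a ^ 2) = w at hw ⊢
    refine ⟨?_, ?_, ?_⟩
    · linear_combination hw
    · linear_combination b ^ 2 * hw
    · linear_combination b ^ 4 * hw
  · simp only [coords, combine_apply, stdBasis, ip_sum_lie isLieBasis_stdLie, gen_C3, momentOne,
      momentTwo]
    simp
    refine ⟨?_, ?_, ?_⟩ <;> ring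
  · have hw := Real.mul_self_sqrt (one_sub_sq_pos hp (by simp)).le
    simp only [coords, combine_apply, stdBasis, ip_sum_poincare isPoincareBasis_stdPoincare,
      gen_C4, momentOne, momentTwo]
    simp
    generalize √(1 - a ^ 2) = w at hw ⊢
    refine ⟨?_, ?_, ?_⟩
    · linear_combination hw
    · linear_combination b ^ 2 * hw
    · linear_combination b ^ 4 * hw

/-- The vectors `γ, γ', γ'', γ''', γ''''` form a negatively oriented basis, so that the frame built
from them, by a change of basis with negative determinant, is positively oriented. -/
theorem vol_zero_neg {c : RegularClass} {a b : ℝ} (hp : (a, b) ∈ c.domain) :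
    vol (fun i : Fin 5 => c.combine ((c.gen b)^[i] (c.coords a b 0))) < 0 := by
  have hstd : 0 < vol c.stdBasis := by
    have := c.isBasis_stdBasis
    cases c
    exacts [this.orientation, this.orientation, this.orientation, this.orientation,
      this.orientation]
  let C : Matrix (Fin 5) (Fin 5) ℝ := Matrix.of fun i : Fin 5 => (c.gen b)^[i] (c.coords a b 0)
  have e : (fun i : Fin 5 => c.combine ((c.gen b)^[i] (c.coords a b 0))) =
      fun i => ∑ j, C i j • c.stdBasis j := by
    funext i
    rw [combine_apply]
    rfl
  rw [e, vol_sum_smul]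
  refine mul_neg_of_neg_of_pos ?_ hstd
  cases c
  · obtain ⟨h1, h2, h3, h4⟩ := hp
    simp only at h1 h2 h3 h4
    obtain ⟨E, E', hE, e⟩ := coords_zero_C1 a b
    have hw := Real.sqrt_pos.2 (mul_pos two_pos (by nlinarith : 0 < 1 - a ^ 2))
    have hC : C.det = -(16 * b ^ 2 * (1 + b ^ 2) ^ 3 * (1 + a ^ 2) ^ 2 * √(2 * (1 - a ^ 2)) *
        (E * E') ^ 2) := by
      simp only [C, e]
      generalize √(2 * (1 - a ^ 2)) = w
      simp [Matrix.det_succ_row_zero, Fin.sum_univ_succ, Fin.succAbove, gen_C1]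
      ring
    rw [hC, hE]
    have := h3.ne'
    exact neg_neg_of_pos (by positivity)
  · obtain ⟨h1, h2, h3, h4⟩ := hp
    simp only at h1 h2 h3 h4
    have hw := Real.sqrt_pos.2 (by nlinarith : 0 < 1 - a ^ 2)
    have hC : C.det = -(a * √(1 - a ^ 2) ^ 2 * b ^ 3 * (1 - b ^ 2) ^ 2) := by
      simp only [C, coords]
      generalize √(1 - a ^ 2) = w
      simp [Matrix.det_succ_row_zero, Fin.sum_univ_succ, Fin.succAbove, gen_C2i]
      ring
    rw [hC]
    have : 0 < 1 - b ^ 2 := by nlinarith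
    exact neg_neg_of_pos (by positivity)
  · obtain ⟨h1, h2, h3, h4⟩ := hp
    simp only at h1 h2 h3 h4
    have hw := Real.sqrt_pos.2 (by nlinarith : 0 < 1 - a ^ 2)
    have hC : C.det = -(a * √(1 - a ^ 2) ^ 2 * b ^ 3 * (b ^ 2 - 1) ^ 2) := by
      simp only [C, coords]
      generalize √(1 - a ^ 2) = w
      simp [Matrix.det_succ_row_zero, Fin.sum_univ_succ, Fin.succAbove, gen_C2ii]
      ring
    rw [hC]
    have : 0 < b ^ 2 - 1 := by nlinarith
    exact neg_neg_of_pos (by positivity)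
  · obtain ⟨h1, h2, h3⟩ := hp
    simp only at h1 h2 h3
    have hC : C.det = -((4 * a + 1) * (4 * a - 1) / 4 * b ^ 3 * (b ^ 2 - 1) ^ 2) := by
      simp only [C, coords]
      simp [Matrix.det_succ_row_zero, Fin.sum_univ_succ, Fin.succAbove, gen_C3]
      ring
    rw [hC]
    have h4 : 0 < b ^ 2 - 1 := by nlinarith
    have h5 : 0 < 4 * a - 1 := by linarith
    exact neg_neg_of_pos (by positivity)
  · obtain ⟨h1, h2, h3, h4⟩ := hp
    simp only at h1 h2 h3 h4
    have hw := Real.sqrt_pos.2 (by nlinarith : 0 < 1 - a ^ 2)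
    have hC : C.det = -(a ^ 2 * √(1 - a ^ 2) ^ 2 * b ^ 3 * (1 + b ^ 2) ^ 2) := by
      simp only [C, coords]
      generalize √(1 - a ^ 2) = w
      simp [Matrix.det_succ_row_zero, Fin.sum_univ_succ, Fin.succAbove, gen_C4]
      ring
    rw [hC]
    exact neg_neg_of_pos (by positivity)

theorem timeArea_sum_stdLie (x y : V) : timeArea (C1.combine x) (C1.combine y) =
    ((x 1 + x 3) * (y 0 + y 4) - (x 0 + x 4) * (y 1 + y 3)) / 2 := by
  have hs : √2 * √2 = 2 := Real.mul_self_sqrt (by norm_num)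
  have hi : (√2)⁻¹ * (√2)⁻¹ = 1 / 2 := by rw [← mul_inv, hs]; norm_num
  simp [timeArea, combine_apply, Fin.sum_univ_five, stdBasis, stdLie, stdMobius, stdPoincare]
  linear_combination ((x 1 + x 3) * (y 0 + y 4) - (x 0 + x 4) * (y 1 + y 3)) * hi

theorem timeArea_sum_stdPoincare (x y : V) : timeArea (C4.combine x) (C4.combine y) =
    x 0 * y 1 - x 1 * y 0 := by
  simp [timeArea, combine_apply, Fin.sum_univ_five, stdBasis, stdPoincare]

theorem timeArea_zero_pos {c : RegularClass} {a b : ℝ} (hp : (a, b) ∈ c.domain) :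
    0 < timeArea (c.combine (c.coords a b 0)) (c.combine (c.gen b (c.coords a b 0))) := by
  cases c
  · obtain ⟨h1, h2, h3, h4⟩ := hp
    simp only at h1 h2 h3 h4
    obtain ⟨E, E', hE, e⟩ := coords_zero_C1 a b
    rw [timeArea_sum_stdLie, e, gen_C1]
    simp
    have h5 : 0 < 1 - a ^ 2 := by nlinarith
    have h6 : a + b < 1 - a * b := by nlinarith
    nlinarith [mul_pos h3 h5, sq_nonneg (E - E'), sq_nonneg (E + E')]
  · -- the standard basis is that of `C4`
    change 0 < timeArea (C4.combine _) (C4.combine _)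
    rw [timeArea_sum_stdPoincare, coords, gen_C2i]
    simp
  · change 0 < timeArea (C4.combine _) (C4.combine _)
    rw [timeArea_sum_stdPoincare, coords, gen_C2ii]
    simp
  · obtain ⟨h1, h2, h3⟩ := hp
    simp only at h1 h2 h3
    change 0 < timeArea (C1.combine _) (C1.combine _)
    rw [timeArea_sum_stdLie, coords, gen_C3]
    simp
    nlinarith [mul_pos (sub_pos.2 h1) (sub_pos.2 h2)]
  · obtain ⟨h1, -⟩ := hp
    rw [timeArea_sum_stdPoincare, coords, gen_C4]
    simpa using h1

end RegularClass

/-! ### Diffeomorphisms with explicit inverses -/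

/-- `Φ` and `Ψ` are mutually inverse smooth maps between `U` and `W`. -/
structure IsSmoothPair (Φ Ψ : ℝ × ℝ → ℝ × ℝ) (U W : Set (ℝ × ℝ)) : Prop where
  mapsTo : MapsTo Φ U W
  mapsTo_inv : MapsTo Ψ W U
  left_inv : ∀ p ∈ U, Ψ (Φ p) = p
  right_inv : ∀ q ∈ W, Φ (Ψ q) = q
  smooth : ContDiffOn ℝ ∞ Φ U
  smooth_inv : ContDiffOn ℝ ∞ Ψ W

theorem IsSmoothPair.trans {Φ Ψ Φ' Ψ' : ℝ × ℝ → ℝ × ℝ} {U W X : Set (ℝ × ℝ)}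
    (h : IsSmoothPair Φ Ψ U W) (h' : IsSmoothPair Φ' Ψ' W X) :
    IsSmoothPair (Φ' ∘ Φ) (Ψ ∘ Ψ') U X where
  mapsTo := h'.mapsTo.comp h.mapsTo
  mapsTo_inv := h.mapsTo_inv.comp h'.mapsTo_inv
  left_inv p hp := by
    rw [Function.comp_apply, Function.comp_apply, h'.left_inv _ (h.mapsTo hp), h.left_inv p hp]
  right_inv q hq := by
    rw [Function.comp_apply, Function.comp_apply, h.right_inv _ (h'.mapsTo_inv hq),
      h'.right_inv q hq]
  smooth := h'.smooth.comp h.smooth h.mapsTo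
  smooth_inv := h.smooth_inv.comp h'.smooth_inv h'.mapsTo_inv

theorem IsSmoothPair.isDiffeoOn {Φ Ψ : ℝ × ℝ → ℝ × ℝ} {U W : Set (ℝ × ℝ)}
    (h : IsSmoothPair Φ Ψ U W) (hU : IsOpen U) (hW : IsOpen W) : IsDiffeoOn Φ U W := by
  have hinj : InjOn Φ U := fun p hp q hq e => by rw [← h.left_inv p hp, e, h.left_inv q hq]
  have hsurj : SurjOn Φ U W := fun q hq => ⟨Ψ q, h.mapsTo_inv hq, h.right_inv q hq⟩
  refine ⟨hU, hW, ⟨h.mapsTo, hinj, hsurj⟩, h.smooth, h.smooth_inv.congr fun q hq => ?_⟩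
  refine hinj (hsurj.mapsTo_invFunOn hq) (h.mapsTo_inv hq) ?_
  rw [hsurj.rightInvOn_invFunOn hq, h.right_inv q hq]

namespace RegularClass

/-! ### The curvatures as functions of the parameters -/

/-- The change from the parameters `(a, b)` to `(x, b)`, where `x` is a root of
`w = ±(x + 1/x)` for `w = k² - 2h` (of `w = 4x/(1 + x²)` for the first class). -/
noncomputable def toModulus : RegularClass → ℝ × ℝ → ℝ × ℝ
  | C1, p => ((p.1 + p.2) / (1 - p.1 * p.2), p.2)
  | C2i, p => (√(1 - p.1 ^ 2) * p.2, p.2)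
  | C2ii, p => (√(1 - p.1 ^ 2) * p.2, p.2)
  | C3, p => (√((4 * p.1 + 1) / (4 * p.1 - 1)) / p.2, p.2)
  | C4, p => (√(1 - p.1 ^ 2) * p.2 / p.1, p.2)

/-- The inverse of `toModulus`. -/
noncomputable def ofModulus : RegularClass → ℝ × ℝ → ℝ × ℝ
  | C1, p => ((p.1 - p.2) / (1 + p.1 * p.2), p.2)
  | C2i, p => (√(1 - (p.1 / p.2) ^ 2), p.2)
  | C2ii, p => (√(1 - (p.1 / p.2) ^ 2), p.2)
  | C3, p => ((p.2 ^ 2 * p.1 ^ 2 + 1) / (4 * (p.2 ^ 2 * p.1 ^ 2 - 1)), p.2)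
  | C4, p => (p.2 / √(p.2 ^ 2 + p.1 ^ 2), p.2)

/-- The range of the pairs `(x, b)`. -/
def modulusDomain : RegularClass → Set (ℝ × ℝ)
  | C1 => {p | -1 < p.1 ∧ p.1 < 1 ∧ 0 < p.2 ∧ p.2 * (1 - p.1) < 1 + p.1}
  | C2i => {p | 0 < p.1 ∧ p.1 < p.2 ∧ p.2 < 1}
  | C2ii => {p | 0 < p.1 ∧ p.1 < 1 ∧ 1 < p.2}
  | C3 => {p | 0 < p.1 ∧ p.1 < 1 ∧ 1 < p.2 ∧ 1 < p.2 * p.1}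
  | C4 => {p | 0 < p.1 ∧ p.1 < 1 ∧ 0 < p.2}

/-- The change from `(x, b)` to `(K, x)`, where `K = k²`. -/
noncomputable def toSquare : RegularClass → ℝ × ℝ → ℝ × ℝ
  | C1, p => (((1 - p.1 ^ 2) * (1 - p.2 ^ 2) + 4 * p.1 * p.2) / (2 * p.2 * (1 + p.1 ^ 2)), p.1)
  | C2i, p => ((p.2 ^ 2 - p.1 ^ 2) / (p.1 * (1 - p.2 ^ 2)), p.1)
  | C2ii, p => ((p.2 ^ 2 - p.1 ^ 2) / (p.1 * (p.2 ^ 2 - 1)), p.1)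
  | C3, p => ((p.2 ^ 2 * p.1 ^ 2 - 1) / (p.1 * (p.2 ^ 2 - 1)), p.1)
  | C4, p => ((p.2 ^ 2 + p.1 ^ 2) / (p.1 * (p.2 ^ 2 + 1)), p.1)

/-- The inverse of `toSquare`. -/
noncomputable def ofSquare : RegularClass → ℝ × ℝ → ℝ × ℝ
  | C1, q => (q.2, √(((q.1 * (1 + q.2 ^ 2) - 2 * q.2) / (1 - q.2 ^ 2)) ^ 2 + 1) -
      (q.1 * (1 + q.2 ^ 2) - 2 * q.2) / (1 - q.2 ^ 2))
  | C2i, q => (q.2, √(q.2 * (q.1 + q.2) / (1 + q.1 * q.2)))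
  | C2ii, q => (q.2, √(q.2 * (q.1 - q.2) / (q.1 * q.2 - 1)))
  | C3, q => (q.2, √((1 - q.1 * q.2) / (q.2 * (q.2 - q.1))))
  | C4, q => (q.2, √(q.2 * (q.1 - q.2) / (1 - q.1 * q.2)))

/-- The range of the pairs `(K, x)`. -/
def squareDomain : RegularClass → Set (ℝ × ℝ)
  | C1 => {q | 0 < q.1 ∧ -1 < q.2 ∧ q.2 < 1}
  | C2i => {q | 0 < q.1 ∧ 0 < q.2 ∧ q.2 < 1}
  | C2ii => {q | 1 < q.1 ∧ 0 < q.2 ∧ q.2 < 1 ∧ 0 < (q.1 - q.2) * (q.1 * q.2 - 1)}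
  | C3 => {q | 0 < q.1 ∧ q.1 < 1 ∧ 0 < q.2 ∧ q.2 < 1 ∧ 0 < (q.1 - q.2) * (q.1 * q.2 - 1)}
  | C4 => {q | 0 < q.1 ∧ 0 < q.2 ∧ q.2 < 1 ∧ (q.1 - q.2) * (q.1 * q.2 - 1) < 0}

/-- The change from `(K, x)` to `(K, w)`, where `w = k² - 2h`. -/
noncomputable def toInvariant : RegularClass → ℝ × ℝ → ℝ × ℝ
  | C1, q => (q.1, 4 * q.2 / (1 + q.2 ^ 2))
  | C2i, q => (q.1, -(q.2 + 1 / q.2))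
  | C2ii, q => (q.1, q.2 + 1 / q.2)
  | C3, q => (q.1, q.2 + 1 / q.2)
  | C4, q => (q.1, q.2 + 1 / q.2)

/-- The inverse of `toInvariant`. -/
noncomputable def ofInvariant : RegularClass → ℝ × ℝ → ℝ × ℝ
  | C1, q => (q.1, q.2 / (2 + √(4 - q.2 ^ 2)))
  | C2i, q => (q.1, 2 / (-q.2 + √((-q.2) ^ 2 - 4)))
  | C2ii, q => (q.1, 2 / (q.2 + √(q.2 ^ 2 - 4)))
  | C3, q => (q.1, 2 / (q.2 + √(q.2 ^ 2 - 4)))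
  | C4, q => (q.1, 2 / (q.2 + √(q.2 ^ 2 - 4)))

/-- The range of the pairs `(K, w)`. -/
def invariantDomain : RegularClass → Set (ℝ × ℝ)
  | C1 => {q | 0 < q.1 ∧ -2 < q.2 ∧ q.2 < 2}
  | C2i => {q | 0 < q.1 ∧ q.2 < -2}
  | C2ii => {q | 1 < q.1 ∧ 2 < q.2 ∧ q.1 * (q.2 - q.1) < 1}
  | C3 => {q | 0 < q.1 ∧ q.1 < 1 ∧ 2 < q.2 ∧ q.1 * (q.2 - q.1) < 1}
  | C4 => {q | 0 < q.1 ∧ 1 < q.1 * (q.2 - q.1)}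

/-- The conformal curvatures in terms of `K = k²` and `w = k² - 2h`. -/
noncomputable def toCurvature (q : ℝ × ℝ) : ℝ × ℝ := (√q.1, (q.1 - q.2) / 2)

/-- The inverse of `toCurvature`. -/
noncomputable def ofCurvature (q : ℝ × ℝ) : ℝ × ℝ := (q.1 ^ 2, q.1 ^ 2 - 2 * q.2)

/-- The conformal curvatures `(k, h)` of the model curve with parameters `(a, b)`. -/
noncomputable def curvatures (c : RegularClass) : ℝ × ℝ → ℝ × ℝ :=
  toCurvature ∘ c.toInvariant ∘ c.toSquare ∘ c.toModulus

theorem invariantDomain_fst_pos {c : RegularClass} {q : ℝ × ℝ} (hq : q ∈ c.invariantDomain) :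
    0 < q.1 := by
  cases c
  exacts [hq.1, hq.1, one_pos.trans hq.1, hq.1, hq.1]

theorem stratum_fst_pos {c : RegularClass} {q : ℝ × ℝ} (hq : q ∈ c.stratum) : 0 < q.1 := by
  cases c
  exacts [hq.2.2, hq.2, one_pos.trans hq.2.2, hq.1, hq.2]

theorem ofCurvature_mem_iff {c : RegularClass} {q : ℝ × ℝ} (hq : 0 < q.1) :
    ofCurvature q ∈ c.invariantDomain ↔ q ∈ c.stratum := by
  obtain ⟨k, h⟩ := q
  simp only at hq
  have hk : 0 < k ^ 2 := by positivity
  have e : -(1 / (2 * k ^ 2)) < h ↔ k ^ 2 * (k ^ 2 - 2 * h - k ^ 2) < 1 := by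
    rw [← neg_lt, lt_div_iff₀ (by positivity)]
    constructor <;> intro h <;> linarith
  have e' : h < -(1 / (2 * k ^ 2)) ↔ 1 < k ^ 2 * (k ^ 2 - 2 * h - k ^ 2) := by
    rw [lt_neg, div_lt_iff₀ (by positivity)]
    constructor <;> intro h <;> linarith
  have e1 : 1 < k ^ 2 ↔ 1 < k := by
    constructor <;> intro h <;> nlinarith
  have e2 : k ^ 2 < 1 ↔ k < 1 := by
    constructor <;> intro h <;> nlinarith
  cases c <;> simp only [ofCurvature, invariantDomain, stratum, mem_ofPred_eq]
  · tauto
  · tauto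
  · rw [e, e1]; tauto
  · rw [e, e2]
    have e3 : h < (k ^ 2 - 2) / 2 ↔ 2 < k ^ 2 - 2 * h := by
      constructor <;> intro h <;> linarith
    rw [e3]
    tauto
  · rw [e']; tauto

theorem isSmoothPair_curvature (c : RegularClass) :
    IsSmoothPair toCurvature ofCurvature c.invariantDomain c.stratum := by
  have hr : ∀ q : ℝ × ℝ, 0 < q.1 → ofCurvature (toCurvature q) = q := fun q hq => by
    simp only [ofCurvature, toCurvature, Real.sq_sqrt hq.le]
    ext
    · rfl
    · simp only
      ring
  refine ⟨fun q hq => ?_, fun q hq => (ofCurvature_mem_iff (stratum_fst_pos hq)).2 hq,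
    fun q hq => hr q (invariantDomain_fst_pos hq), fun q hq => ?_, ?_, ?_⟩
  · have hq' := invariantDomain_fst_pos hq
    rw [← ofCurvature_mem_iff (Real.sqrt_pos.2 hq'), hr q hq']
    exact hq
  · simp only [ofCurvature, toCurvature, Real.sqrt_sq (stratum_fst_pos hq).le]
    ext <;> simp
  · refine ContDiffOn.prodMk (ContDiffOn.sqrt (by fun_prop)
      fun q hq => (invariantDomain_fst_pos hq).ne') (by fun_prop)
  · unfold ofCurvature
    fun_prop

/-- The root in `(0, 1)` of the equation `x + 1/x = w`. -/
theorem root_spec {w : ℝ} (hw : 2 < w) : 0 < 2 / (w + √(w ^ 2 - 4)) ∧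
    2 / (w + √(w ^ 2 - 4)) < 1 ∧
    2 / (w + √(w ^ 2 - 4)) + 1 / (2 / (w + √(w ^ 2 - 4))) = w := by
  have h1 : 0 < w ^ 2 - 4 := by nlinarith
  have h2 := Real.sqrt_pos.2 h1
  have h3 := Real.sq_sqrt h1.le
  set s := √(w ^ 2 - 4)
  refine ⟨by positivity, ?_, ?_⟩
  · rw [div_lt_one (by positivity)]
    linarith
  · field_simp
    linear_combination h3

theorem root_add_inv {x : ℝ} (h0 : 0 < x) (h1 : x < 1) :
    2 / ((x + 1 / x) + √((x + 1 / x) ^ 2 - 4)) = x := by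
  have e : (x + 1 / x) ^ 2 - 4 = (1 / x - x) ^ 2 := by field_simp; ring
  have h2 : 1 < 1 / x := by rwa [lt_div_iff₀ h0, one_mul]
  rw [e, Real.sqrt_sq (by linarith)]
  field_simp
  rw [show x ^ 2 + 1 + (1 - x ^ 2) = 2 by ring]
  norm_num

theorem two_lt_add_inv {x : ℝ} (h0 : 0 < x) (h1 : x < 1) : 2 < x + 1 / x := by
  have : x + 1 / x - 2 = (1 - x) ^ 2 / x := by field_simp; ring
  have h2 : 0 < (1 - x) ^ 2 / x := div_pos (pow_pos (sub_pos.2 h1) 2) h0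
  linarith

theorem contDiffOn_root {S : Set (ℝ × ℝ)} {g : ℝ × ℝ → ℝ} (hg : ContDiffOn ℝ ∞ g S)
    (hS : ∀ q ∈ S, 2 < g q) : ContDiffOn ℝ ∞ (fun q => 2 / (g q + √(g q ^ 2 - 4))) S := by
  refine contDiffOn_const.div (hg.add (ContDiffOn.sqrt ((hg.pow 2).sub contDiffOn_const)
    fun q hq => ?_)) fun q hq => ?_
  · have := hS q hq
    nlinarith
  · have := hS q hq
    positivity

theorem one_sub_mul_eq {K x : ℝ} (hx : 0 < x) :
    1 - K * (x + 1 / x - K) = (K - x) * (K * x - 1) / x := by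
  field_simp
  ring

theorem mul_lt_one_iff_root {K x : ℝ} (hx : 0 < x) :
    K * (x + 1 / x - K) < 1 ↔ 0 < (K - x) * (K * x - 1) := by
  rw [← sub_pos, one_sub_mul_eq hx, div_pos_iff_of_pos_right hx]

theorem one_lt_mul_iff_root {K x : ℝ} (hx : 0 < x) :
    1 < K * (x + 1 / x - K) ↔ (K - x) * (K * x - 1) < 0 := by
  rw [← sub_neg, one_sub_mul_eq hx, div_lt_iff₀ hx, zero_mul]

theorem isSmoothPair_invariant (c : RegularClass) :
    IsSmoothPair c.toInvariant c.ofInvariant c.squareDomain c.invariantDomain := by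
  cases c
  · refine ⟨fun q hq => ?_, fun q hq => ?_, fun q hq => ?_, fun q hq => ?_, ?_, ?_⟩
    · obtain ⟨h1, h2, h3⟩ := hq
      refine ⟨h1, ?_, ?_⟩ <;> simp only [toInvariant]
      · rw [lt_div_iff₀ (by positivity)]
        nlinarith
      · rw [div_lt_iff₀ (by positivity)]
        nlinarith
    · obtain ⟨h1, h2, h3⟩ := hq
      have h4 : 0 < 4 - q.2 ^ 2 := by nlinarith
      have h5 := Real.sqrt_pos.2 h4
      refine ⟨h1, ?_, ?_⟩ <;> simp only [ofInvariant]
      · rw [lt_div_iff₀ (by positivity)]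
        linarith
      · rw [div_lt_iff₀ (by positivity)]
        linarith
    · obtain ⟨h1, h2, h3⟩ := hq
      have h4 : 0 < 1 - q.2 ^ 2 := by nlinarith
      have e : 4 - (4 * q.2 / (1 + q.2 ^ 2)) ^ 2 = (2 * (1 - q.2 ^ 2) / (1 + q.2 ^ 2)) ^ 2 := by
        field_simp
        ring
      simp only [toInvariant, ofInvariant]
      rw [e, Real.sqrt_sq (by positivity)]
      ext
      · rfl
      · have : 2 + 2 * (1 - q.2 ^ 2) / (1 + q.2 ^ 2) = 4 / (1 + q.2 ^ 2) := by
          field_simp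
          ring
        simp only [this]
        field_simp
    · obtain ⟨h1, h2, h3⟩ := hq
      have h4 : 0 < 4 - q.2 ^ 2 := by nlinarith
      have h5 := Real.sqrt_pos.2 h4
      have h6 := Real.sq_sqrt h4.le
      simp only [toInvariant, ofInvariant]
      ext
      · rfl
      · simp only
        set s := √(4 - q.2 ^ 2)
        have : 1 + (q.2 / (2 + s)) ^ 2 = 4 / (2 + s) := by
          field_simp
          linear_combination h6
        rw [this]
        field_simp
    · exact contDiffOn_fst.prodMk (ContDiffOn.div (by fun_prop) (by fun_prop)
        fun q _ => by positivity)
    · refine contDiffOn_fst.prodMk (ContDiffOn.div (by fun_prop)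
        (contDiffOn_const.add (ContDiffOn.sqrt (by fun_prop) fun q hq => ?_))
        fun q _ => by positivity)
      obtain ⟨h1, h2, h3⟩ := hq
      nlinarith
  · refine ⟨fun q hq => ?_, fun q hq => ?_, fun q hq => ?_, fun q hq => ?_, ?_, ?_⟩
    · exact ⟨hq.1, by simpa [toInvariant] using neg_lt_neg (two_lt_add_inv hq.2.1 hq.2.2)⟩
    · obtain ⟨r1, r2, -⟩ := root_spec (lt_neg_of_lt_neg hq.2)
      exact ⟨hq.1, r1, r2⟩
    · ext
      · rfl
      · simp only [toInvariant, ofInvariant, neg_neg]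
        exact root_add_inv hq.2.1 hq.2.2
    · ext
      · rfl
      · simp only [toInvariant, ofInvariant]
        rw [(root_spec (lt_neg_of_lt_neg hq.2)).2.2, neg_neg]
    · exact contDiffOn_fst.prodMk (contDiffOn_snd.add (contDiffOn_const.div contDiffOn_snd
        fun q hq => hq.2.1.ne')).neg
    · exact contDiffOn_fst.prodMk (contDiffOn_root contDiffOn_snd.neg
        fun q hq => lt_neg_of_lt_neg hq.2)
  · refine ⟨fun q hq => ?_, fun q hq => ?_, fun q hq => ?_, fun q hq => ?_, ?_, ?_⟩
    · obtain ⟨h1, h2, h3, h4⟩ := hq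
      exact ⟨h1, two_lt_add_inv h2 h3, (mul_lt_one_iff_root h2).2 h4⟩
    · obtain ⟨h1, h2, h3⟩ := hq
      obtain ⟨r1, r2, r3⟩ := root_spec h2
      refine ⟨h1, r1, r2, (mul_lt_one_iff_root r1).1 ?_⟩
      simp only [ofInvariant]
      rwa [r3]
    · ext
      · rfl
      · exact root_add_inv hq.2.1 hq.2.2.1
    · ext
      · rfl
      · exact (root_spec hq.2.1).2.2
    · exact contDiffOn_fst.prodMk (contDiffOn_snd.add (contDiffOn_const.div contDiffOn_snd
        fun q hq => hq.2.1.ne'))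
    · exact contDiffOn_fst.prodMk (contDiffOn_root contDiffOn_snd fun q hq => hq.2.1)
  · refine ⟨fun q hq => ?_, fun q hq => ?_, fun q hq => ?_, fun q hq => ?_, ?_, ?_⟩
    · obtain ⟨h1, h1', h2, h3, h4⟩ := hq
      exact ⟨h1, h1', two_lt_add_inv h2 h3, (mul_lt_one_iff_root h2).2 h4⟩
    · obtain ⟨h1, h1', h2, h3⟩ := hq
      obtain ⟨r1, r2, r3⟩ := root_spec h2
      refine ⟨h1, h1', r1, r2, (mul_lt_one_iff_root r1).1 ?_⟩
      simp only [ofInvariant]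
      rwa [r3]
    · ext
      · rfl
      · exact root_add_inv hq.2.2.1 hq.2.2.2.1
    · ext
      · rfl
      · exact (root_spec hq.2.2.1).2.2
    · exact contDiffOn_fst.prodMk (contDiffOn_snd.add (contDiffOn_const.div contDiffOn_snd
        fun q hq => hq.2.2.1.ne'))
    · exact contDiffOn_fst.prodMk (contDiffOn_root contDiffOn_snd fun q hq => hq.2.2.1)
  · -- here `w > 2` follows from `K w > 1 + K² ≥ 2 K`
    have hw : ∀ q ∈ C4.invariantDomain, 2 < q.2 := fun q hq => by
      obtain ⟨h1, h2⟩ := hq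
      by_contra h
      nlinarith [sq_nonneg (q.1 - 1), mul_le_mul_of_nonneg_left (not_lt.1 h) h1.le]
    refine ⟨fun q hq => ?_, fun q hq => ?_, fun q hq => ?_, fun q hq => ?_, ?_, ?_⟩
    · obtain ⟨h1, h2, h3, h4⟩ := hq
      exact ⟨h1, (one_lt_mul_iff_root h2).2 h4⟩
    · obtain ⟨r1, r2, r3⟩ := root_spec (hw q hq)
      obtain ⟨h1, h3⟩ := hq
      refine ⟨h1, r1, r2, (one_lt_mul_iff_root r1).1 ?_⟩
      simp only [ofInvariant]
      rwa [r3]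
    · ext
      · rfl
      · exact root_add_inv hq.2.1 hq.2.2.1
    · ext
      · rfl
      · exact (root_spec (hw q hq)).2.2
    · exact contDiffOn_fst.prodMk (contDiffOn_snd.add (contDiffOn_const.div contDiffOn_snd
        fun q hq => hq.2.1.ne'))
    · exact contDiffOn_fst.prodMk (contDiffOn_root contDiffOn_snd hw)

/-! ### The passage from `(x, b)` to `(k², x)` -/

theorem isSmoothPair_square_C1 :
    IsSmoothPair C1.toSquare C1.ofSquare C1.modulusDomain C1.squareDomain := by
  have hpos : ∀ q ∈ C1.squareDomain, 0 < 1 - q.2 ^ 2 := fun q hq => by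
    obtain ⟨h1, h2, h3⟩ := hq
    nlinarith
  refine ⟨fun p hp => ?_, fun q hq => ?_, fun p hp => ?_, fun q hq => ?_, ?_, ?_⟩
  · obtain ⟨h1, h2, h3, h4⟩ := hp
    refine ⟨div_pos ?_ (by positivity), h1, h2⟩
    -- the numerator is the product of two positive linear functions of `b`
    have h5 : 0 < 1 + p.1 - p.2 * (1 - p.1) := sub_pos.2 h4
    have h6 : 0 < 1 - p.1 + p.2 * (1 + p.1) :=
      add_pos (sub_pos.2 h2) (mul_pos h3 (by linarith))
    nlinarith [mul_pos h5 h6]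
  · have h4 := hpos q hq
    obtain ⟨h1, h2, h3⟩ := hq
    simp only [ofSquare]
    set Z := (q.1 * (1 + q.2 ^ 2) - 2 * q.2) / (1 - q.2 ^ 2) with hZ
    have hs : 0 < Z ^ 2 + 1 := by positivity
    have h5 := Real.sq_sqrt hs.le
    have h6 := Real.sqrt_pos.2 hs
    have h7 : 0 < √(Z ^ 2 + 1) - Z := by
      rw [sub_pos]
      exact Real.lt_sqrt_of_sq_lt (by linarith)
    refine ⟨h2, h3, h7, ?_⟩
    -- `b` solves `(1 - m²) (1 - b²) + 4 m b = 2 b K (1 + m²)`, whose left side factors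
    have hb : (1 - q.2 ^ 2) * (1 - (√(Z ^ 2 + 1) - Z) ^ 2) + 4 * q.2 * (√(Z ^ 2 + 1) - Z) =
        2 * (√(Z ^ 2 + 1) - Z) * (q.1 * (1 + q.2 ^ 2)) := by
      have e : (1 - q.2 ^ 2) * Z = q.1 * (1 + q.2 ^ 2) - 2 * q.2 := by
        rw [hZ]; field_simp
      linear_combination 2 * (√(Z ^ 2 + 1) - Z) * e - (1 - q.2 ^ 2) * h5
    set b := √(Z ^ 2 + 1) - Z
    simp only
    by_contra h
    have h8 : 0 < b * (q.1 * (1 + q.2 ^ 2)) := by positivity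
    have h9 : 0 < 1 - q.2 + b * (1 + q.2) := by nlinarith
    nlinarith [mul_nonneg (sub_nonneg.2 (not_lt.1 h)) h9.le]
  · obtain ⟨h1, h2, h3, h4⟩ := hp
    have h5 : 0 < 1 - p.1 ^ 2 := by nlinarith
    have e : (((1 - p.1 ^ 2) * (1 - p.2 ^ 2) + 4 * p.1 * p.2) / (2 * p.2 * (1 + p.1 ^ 2)) *
        (1 + p.1 ^ 2) - 2 * p.1) / (1 - p.1 ^ 2) = (1 - p.2 ^ 2) / (2 * p.2) := by
      field_simp
      ring
    have e2 : ((1 - p.2 ^ 2) / (2 * p.2)) ^ 2 + 1 = ((1 + p.2 ^ 2) / (2 * p.2)) ^ 2 := by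
      field_simp
      ring
    simp only [toSquare, ofSquare]
    rw [e, e2, Real.sqrt_sq (by positivity)]
    ext
    · rfl
    · simp only
      field_simp
      ring
  · have h4 := hpos q hq
    obtain ⟨h1, h2, h3⟩ := hq
    simp only [toSquare, ofSquare]
    set Z := (q.1 * (1 + q.2 ^ 2) - 2 * q.2) / (1 - q.2 ^ 2) with hZ
    have hs : 0 < Z ^ 2 + 1 := by positivity
    have h5 := Real.sq_sqrt hs.le
    have h7 : 0 < √(Z ^ 2 + 1) - Z := by
      rw [sub_pos]
      exact Real.lt_sqrt_of_sq_lt (by linarith)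
    have hb : (1 - q.2 ^ 2) * (1 - (√(Z ^ 2 + 1) - Z) ^ 2) + 4 * q.2 * (√(Z ^ 2 + 1) - Z) =
        2 * (√(Z ^ 2 + 1) - Z) * (q.1 * (1 + q.2 ^ 2)) := by
      have e : (1 - q.2 ^ 2) * Z = q.1 * (1 + q.2 ^ 2) - 2 * q.2 := by
        rw [hZ]; field_simp
      linear_combination 2 * (√(Z ^ 2 + 1) - Z) * e - (1 - q.2 ^ 2) * h5
    ext
    · simp only
      rw [hb, div_eq_iff (by positivity)]
      ring
    · rfl
  · refine ContDiffOn.prodMk (ContDiffOn.div (by fun_prop) (by fun_prop) fun p hp => ?_)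
      contDiffOn_fst
    have := hp.2.2.1
    positivity
  · have hZ : ContDiffOn ℝ ∞ (fun q : ℝ × ℝ => (q.1 * (1 + q.2 ^ 2) - 2 * q.2) / (1 - q.2 ^ 2))
        C1.squareDomain :=
      ContDiffOn.div (by fun_prop) (by fun_prop) fun q hq => (hpos q hq).ne'
    exact contDiffOn_snd.prodMk ((((hZ.pow 2).add contDiffOn_const).sqrt
      fun q _ => by positivity).sub hZ)

theorem isSmoothPair_square_C2i :
    IsSmoothPair C2i.toSquare C2i.ofSquare C2i.modulusDomain C2i.squareDomain := by
  refine ⟨fun p hp => ?_, fun q hq => ?_, fun p hp => ?_, fun q hq => ?_, ?_, ?_⟩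
  · obtain ⟨h1, h2, h3⟩ := hp
    exact ⟨div_pos (by nlinarith) (mul_pos h1 (by nlinarith)), h1, h2.trans h3⟩
  · obtain ⟨h1, h2, h3⟩ := hq
    refine ⟨h2, ?_, ?_⟩
    · refine Real.lt_sqrt_of_sq_lt ?_
      rw [lt_div_iff₀ (by positivity)]
      simp only [ofSquare]
      nlinarith [mul_pos (mul_pos h1 h2) (sub_pos.2 h3),
        mul_pos (mul_pos (mul_pos h1 h2) h2) (sub_pos.2 h3)]
    · rw [ofSquare, Real.sqrt_lt' one_pos, div_lt_iff₀ (by positivity)]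
      nlinarith
  · obtain ⟨h1, h2, h3⟩ := hp
    have h4 : 0 < 1 - p.2 ^ 2 := by nlinarith
    have h5 : 0 < 1 - p.1 ^ 2 := by nlinarith
    simp only [toSquare, ofSquare]
    have e1 : p.1 * ((p.2 ^ 2 - p.1 ^ 2) / (p.1 * (1 - p.2 ^ 2)) + p.1) =
        p.2 ^ 2 * (1 - p.1 ^ 2) / (1 - p.2 ^ 2) := by
      field_simp
      ring
    have e2 : 1 + (p.2 ^ 2 - p.1 ^ 2) / (p.1 * (1 - p.2 ^ 2)) * p.1 =
        (1 - p.1 ^ 2) / (1 - p.2 ^ 2) := by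
      field_simp
      ring
    rw [e1, e2, div_div_div_cancel_right₀ h4.ne', mul_div_cancel_right₀ _ h5.ne',
      Real.sqrt_sq (h1.trans h2).le]
  · obtain ⟨h1, h2, h3⟩ := hq
    have h4 : 0 < 1 - q.2 ^ 2 := by nlinarith
    simp only [toSquare, ofSquare]
    rw [Real.sq_sqrt (by positivity)]
    have e1 : q.2 * (q.1 + q.2) / (1 + q.1 * q.2) - q.2 ^ 2 =
        q.1 * q.2 * (1 - q.2 ^ 2) / (1 + q.1 * q.2) := by
      field_simp
      ring
    have e2 : 1 - q.2 * (q.1 + q.2) / (1 + q.1 * q.2) = (1 - q.2 ^ 2) / (1 + q.1 * q.2) := by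
      field_simp
      ring
    rw [e1, e2]
    ext
    · simp only
      field_simp
    · rfl
  · refine ContDiffOn.prodMk (ContDiffOn.div (by fun_prop) (by fun_prop) fun p hp => ?_)
      contDiffOn_fst
    obtain ⟨h1, h2, h3⟩ := hp
    exact (mul_pos h1 (by nlinarith)).ne'
  · refine contDiffOn_snd.prodMk (ContDiffOn.sqrt (ContDiffOn.div (by fun_prop) (by fun_prop)
      fun q hq => ?_) fun q hq => ?_) <;>
    · obtain ⟨h1, h2, h3⟩ := hq
      positivity

theorem isSmoothPair_square_C2ii :
    IsSmoothPair C2ii.toSquare C2ii.ofSquare C2ii.modulusDomain C2ii.squareDomain := by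
  have hpos : ∀ q ∈ C2ii.squareDomain, 0 < q.1 - q.2 ∧ 0 < q.1 * q.2 - 1 := fun q hq => by
    obtain ⟨h1, h2, h3, h4⟩ := hq
    have h5 : 0 < q.1 - q.2 := by linarith
    exact ⟨h5, (mul_pos_iff_of_pos_left h5).1 h4⟩
  refine ⟨fun p hp => ?_, fun q hq => ?_, fun p hp => ?_, fun q hq => ?_, ?_, ?_⟩
  · obtain ⟨h1, h2, h3⟩ := hp
    have h4 : 0 < p.2 ^ 2 - 1 := by nlinarith
    have h5 : 0 < 1 - p.1 ^ 2 := by nlinarith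
    simp only [toSquare]
    have h6 : 1 < (p.2 ^ 2 - p.1 ^ 2) / (p.1 * (p.2 ^ 2 - 1)) := by
      rw [lt_div_iff₀ (by positivity)]
      nlinarith [mul_pos (sub_pos.2 h2) h4]
    refine ⟨h6, h1, h2, mul_pos (by linarith) ?_⟩
    have : (p.2 ^ 2 - p.1 ^ 2) / (p.1 * (p.2 ^ 2 - 1)) * p.1 - 1 =
        (1 - p.1 ^ 2) / (p.2 ^ 2 - 1) := by
      field_simp
      ring
    rw [this]
    positivity
  · obtain ⟨h5, h6⟩ := hpos q hq
    obtain ⟨h1, h2, h3, h4⟩ := hq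
    refine ⟨h2, h3, Real.lt_sqrt_of_sq_lt ?_⟩
    rw [lt_div_iff₀ h6]
    nlinarith
  · obtain ⟨h1, h2, h3⟩ := hp
    have h4 : 0 < p.2 ^ 2 - 1 := by nlinarith
    have h5 : 0 < 1 - p.1 ^ 2 := by nlinarith
    simp only [toSquare, ofSquare]
    have e1 : p.1 * ((p.2 ^ 2 - p.1 ^ 2) / (p.1 * (p.2 ^ 2 - 1)) - p.1) =
        p.2 ^ 2 * (1 - p.1 ^ 2) / (p.2 ^ 2 - 1) := by
      field_simp
      ring
    have e2 : (p.2 ^ 2 - p.1 ^ 2) / (p.1 * (p.2 ^ 2 - 1)) * p.1 - 1 =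
        (1 - p.1 ^ 2) / (p.2 ^ 2 - 1) := by
      field_simp
      ring
    rw [e1, e2, div_div_div_cancel_right₀ h4.ne', mul_div_cancel_right₀ _ h5.ne',
      Real.sqrt_sq (one_pos.trans h3).le]
  · obtain ⟨h5, h6⟩ := hpos q hq
    obtain ⟨h1, h2, h3, h4⟩ := hq
    have h7 : 0 < 1 - q.2 ^ 2 := by nlinarith
    simp only [toSquare, ofSquare]
    rw [Real.sq_sqrt (by positivity)]
    have h8 := h6.ne'
    have e1 : q.2 * (q.1 - q.2) / (q.1 * q.2 - 1) - q.2 ^ 2 =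
        q.1 * q.2 * (1 - q.2 ^ 2) / (q.1 * q.2 - 1) := by
      rw [div_sub' h8]
      congr 1
      ring
    have e2 : q.2 * (q.1 - q.2) / (q.1 * q.2 - 1) - 1 = (1 - q.2 ^ 2) / (q.1 * q.2 - 1) := by
      rw [div_sub' h8]
      congr 1
      ring
    rw [e1, e2]
    ext
    · simp only
      field_simp
    · rfl
  · refine ContDiffOn.prodMk (ContDiffOn.div (by fun_prop) (by fun_prop) fun p hp => ?_)
      contDiffOn_fst
    obtain ⟨h1, h2, h3⟩ := hp
    exact (mul_pos h1 (by nlinarith)).ne'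
  · refine contDiffOn_snd.prodMk (ContDiffOn.sqrt (ContDiffOn.div (by fun_prop) (by fun_prop)
      fun q hq => (hpos q hq).2.ne') fun q hq => ?_)
    exact (div_pos (mul_pos hq.2.1 (hpos q hq).1) (hpos q hq).2).ne'

theorem isSmoothPair_square_C3 :
    IsSmoothPair C3.toSquare C3.ofSquare C3.modulusDomain C3.squareDomain := by
  have hpos : ∀ q ∈ C3.squareDomain, 0 < q.2 - q.1 ∧ 0 < 1 - q.1 * q.2 := fun q hq => by
    obtain ⟨h1, h1', h2, h3, h4⟩ := hq
    have h5 : 0 < 1 - q.1 * q.2 := by nlinarith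
    refine ⟨?_, h5⟩
    by_contra h
    nlinarith
  refine ⟨fun p hp => ?_, fun q hq => ?_, fun p hp => ?_, fun q hq => ?_, ?_, ?_⟩
  · obtain ⟨h1, h2, h3, h3'⟩ := hp
    have h4 : 0 < p.2 ^ 2 - 1 := by nlinarith
    have h5 : 0 < 1 - p.1 ^ 2 := by nlinarith
    have h6 : 0 < p.2 ^ 2 * p.1 ^ 2 - 1 := by nlinarith
    simp only [toSquare]
    have h7 : p.1 - (p.2 ^ 2 * p.1 ^ 2 - 1) / (p.1 * (p.2 ^ 2 - 1)) =
        (1 - p.1 ^ 2) / (p.1 * (p.2 ^ 2 - 1)) := by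
      field_simp
      ring
    have h8 : 0 < (1 - p.1 ^ 2) / (p.1 * (p.2 ^ 2 - 1)) := by positivity
    have h9 : 0 < (p.2 ^ 2 * p.1 ^ 2 - 1) / (p.1 * (p.2 ^ 2 - 1)) := by positivity
    simp only [squareDomain, mem_ofPred_eq]
    generalize (p.2 ^ 2 * p.1 ^ 2 - 1) / (p.1 * (p.2 ^ 2 - 1)) = K at h7 h9
    rw [← h7] at h8
    have h10 : K < 1 := by linarith
    exact ⟨h9, h10, h1, h2, mul_pos_of_neg_of_neg (by linarith) (by nlinarith)⟩
  · obtain ⟨h5, h6⟩ := hpos q hq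
    obtain ⟨h1, h1', h2, h3, h4⟩ := hq
    refine ⟨h2, h3, ?_, ?_⟩
    · refine Real.lt_sqrt_of_sq_lt ?_
      rw [lt_div_iff₀ (by positivity)]
      nlinarith
    · simp only [ofSquare]
      rw [← div_lt_iff₀ h2]
      refine Real.lt_sqrt_of_sq_lt ?_
      rw [lt_div_iff₀ (by positivity)]
      have : (1 / q.2) ^ 2 * (q.2 * (q.2 - q.1)) = (q.2 - q.1) / q.2 := by field_simp
      rw [this, div_lt_iff₀ h2]
      nlinarith [mul_pos h1 (by nlinarith : 0 < 1 - q.2 ^ 2)]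
  · obtain ⟨h1, h2, h3, h3'⟩ := hp
    have h4 : 0 < p.2 ^ 2 - 1 := by nlinarith
    have h5 : 0 < 1 - p.1 ^ 2 := by nlinarith
    simp only [toSquare, ofSquare]
    have e1 : p.1 * (p.1 - (p.2 ^ 2 * p.1 ^ 2 - 1) / (p.1 * (p.2 ^ 2 - 1))) =
        (1 - p.1 ^ 2) / (p.2 ^ 2 - 1) := by
      field_simp
      ring
    have e2 : 1 - (p.2 ^ 2 * p.1 ^ 2 - 1) / (p.1 * (p.2 ^ 2 - 1)) * p.1 =
        p.2 ^ 2 * (1 - p.1 ^ 2) / (p.2 ^ 2 - 1) := by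
      field_simp
      ring
    rw [e1, e2, div_div_div_cancel_right₀ h4.ne', mul_div_cancel_right₀ _ h5.ne',
      Real.sqrt_sq (one_pos.trans h3).le]
  · obtain ⟨h5, h6⟩ := hpos q hq
    obtain ⟨h1, h1', h2, h3, h4⟩ := hq
    have h7 : 0 < 1 - q.2 ^ 2 := by nlinarith
    simp only [toSquare, ofSquare]
    rw [Real.sq_sqrt (by positivity)]
    have e1 : (1 - q.1 * q.2) / (q.2 * (q.2 - q.1)) * q.2 ^ 2 - 1 =
        q.1 * (1 - q.2 ^ 2) / (q.2 - q.1) := by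
      field_simp
      ring
    have e2 : (1 - q.1 * q.2) / (q.2 * (q.2 - q.1)) - 1 = (1 - q.2 ^ 2) / (q.2 * (q.2 - q.1)) := by
      field_simp
      ring
    rw [e1, e2]
    ext
    · simp only
      field_simp
    · rfl
  · refine ContDiffOn.prodMk (ContDiffOn.div (by fun_prop) (by fun_prop) fun p hp => ?_)
      contDiffOn_fst
    obtain ⟨h1, h2, h3, -⟩ := hp
    exact (mul_pos h1 (by nlinarith)).ne'
  · refine contDiffOn_snd.prodMk (ContDiffOn.sqrt (ContDiffOn.div (by fun_prop) (by fun_prop)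
      fun q hq => ?_) fun q hq => ?_)
    · exact (mul_pos hq.2.2.1 (hpos q hq).1).ne'
    · exact (div_pos (hpos q hq).2 (mul_pos hq.2.2.1 (hpos q hq).1)).ne'

theorem isSmoothPair_square_C4 :
    IsSmoothPair C4.toSquare C4.ofSquare C4.modulusDomain C4.squareDomain := by
  have hpos : ∀ q ∈ C4.squareDomain, 0 < q.1 - q.2 ∧ 0 < 1 - q.1 * q.2 := fun q hq => by
    obtain ⟨h1, h2, h3, h4⟩ := hq
    -- the other sign would give `K < x` and `K > 1/x`, but `x < 1`
    rcases mul_neg_iff.1 h4 with ⟨h5, h6⟩ | ⟨h5, h6⟩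
    · exact ⟨h5, by linarith⟩
    · exfalso
      nlinarith
  refine ⟨fun p hp => ?_, fun q hq => ?_, fun p hp => ?_, fun q hq => ?_, ?_, ?_⟩
  · obtain ⟨h1, h2, h3⟩ := hp
    have h5 : 0 < 1 - p.1 ^ 2 := by nlinarith
    simp only [toSquare]
    refine ⟨by positivity, h1, h2, ?_⟩
    have e1 : (p.2 ^ 2 + p.1 ^ 2) / (p.1 * (p.2 ^ 2 + 1)) - p.1 =
        p.2 ^ 2 * (1 - p.1 ^ 2) / (p.1 * (p.2 ^ 2 + 1)) := by
      field_simp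
      ring
    have e2 : (p.2 ^ 2 + p.1 ^ 2) / (p.1 * (p.2 ^ 2 + 1)) * p.1 - 1 =
        -((1 - p.1 ^ 2) / (p.2 ^ 2 + 1)) := by
      field_simp
      ring
    simp only [e1, e2]
    exact mul_neg_of_pos_of_neg (by positivity) (neg_neg_of_pos (by positivity))
  · obtain ⟨h5, h6⟩ := hpos q hq
    obtain ⟨h1, h2, h3, h4⟩ := hq
    exact ⟨h2, h3, Real.sqrt_pos.2 (by positivity)⟩
  · obtain ⟨h1, h2, h3⟩ := hp
    have h5 : 0 < 1 - p.1 ^ 2 := by nlinarith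
    have h4 : 0 < p.2 ^ 2 + 1 := by positivity
    simp only [toSquare, ofSquare]
    have e1 : p.1 * ((p.2 ^ 2 + p.1 ^ 2) / (p.1 * (p.2 ^ 2 + 1)) - p.1) =
        p.2 ^ 2 * (1 - p.1 ^ 2) / (p.2 ^ 2 + 1) := by
      field_simp
      ring
    have e2 : 1 - (p.2 ^ 2 + p.1 ^ 2) / (p.1 * (p.2 ^ 2 + 1)) * p.1 =
        (1 - p.1 ^ 2) / (p.2 ^ 2 + 1) := by
      field_simp
      ring
    rw [e1, e2, div_div_div_cancel_right₀ h4.ne', mul_div_cancel_right₀ _ h5.ne',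
      Real.sqrt_sq h3.le]
  · obtain ⟨h5, h6⟩ := hpos q hq
    obtain ⟨h1, h2, h3, h4⟩ := hq
    have h7 : 0 < 1 - q.2 ^ 2 := by nlinarith
    simp only [toSquare, ofSquare]
    rw [Real.sq_sqrt (by positivity)]
    have h8 := h6.ne'
    have e1 : q.2 * (q.1 - q.2) / (1 - q.1 * q.2) + q.2 ^ 2 =
        q.1 * q.2 * (1 - q.2 ^ 2) / (1 - q.1 * q.2) := by
      rw [div_add' _ _ _ h8]
      congr 1
      ring
    have e2 : q.2 * (q.1 - q.2) / (1 - q.1 * q.2) + 1 = (1 - q.2 ^ 2) / (1 - q.1 * q.2) := by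
      rw [div_add' _ _ _ h8]
      congr 1
      ring
    rw [e1, e2]
    ext
    · simp only
      field_simp
    · rfl
  · refine ContDiffOn.prodMk (ContDiffOn.div (by fun_prop) (by fun_prop) fun p hp => ?_)
      contDiffOn_fst
    have := hp.1
    positivity
  · refine contDiffOn_snd.prodMk (ContDiffOn.sqrt (ContDiffOn.div (by fun_prop) (by fun_prop)
      fun q hq => (hpos q hq).2.ne') fun q hq => ?_)
    exact (div_pos (mul_pos hq.2.1 (hpos q hq).1) (hpos q hq).2).ne'

theorem isSmoothPair_square (c : RegularClass) :
    IsSmoothPair c.toSquare c.ofSquare c.modulusDomain c.squareDomain := by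
  cases c
  exacts [isSmoothPair_square_C1, isSmoothPair_square_C2i, isSmoothPair_square_C2ii,
    isSmoothPair_square_C3, isSmoothPair_square_C4]

/-! ### The passage from `(a, b)` to `(x, b)` -/

/-- For the first class the sign condition defining the domain says that `a + b < 1 - a b`, since
the other factor is positive. -/
theorem C1_domain_iff {p : ℝ × ℝ} : p ∈ C1.domain ↔
    -1 < p.1 ∧ p.1 < 1 ∧ 0 < p.2 ∧ p.1 + p.2 < 1 - p.1 * p.2 := by
  simp only [domain, mem_ofPred_eq]
  refine and_congr_right fun h1 => and_congr_right fun h2 => and_congr_right fun h3 => ?_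
  have h4 : 0 < 1 + p.2 + p.1 * (p.2 - 1) := by nlinarith [mul_pos h3 (by linarith : 0 < 1 + p.1)]
  rw [← neg_pos, ← mul_neg, mul_pos_iff_of_pos_left h4]
  constructor <;> intro h <;> linarith

theorem isSmoothPair_modulus_C1 :
    IsSmoothPair C1.toModulus C1.ofModulus C1.domain C1.modulusDomain := by
  have hD : ∀ p ∈ C1.domain, 0 < 1 - p.1 * p.2 ∧ 0 < 1 - p.1 * p.2 + (p.1 + p.2) ∧
      0 < 1 - p.1 * p.2 - (p.1 + p.2) := fun p hp => by
    obtain ⟨h1, h2, h3, h4⟩ := C1_domain_iff.1 hp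
    have h5 : 0 < 1 - p.1 * p.2 + (p.1 + p.2) := by nlinarith [mul_pos h3 (sub_pos.2 h2)]
    exact ⟨by linarith, h5, by linarith⟩
  have hN : ∀ p ∈ C1.modulusDomain, 0 < 1 + p.1 * p.2 ∧ 0 < 1 - p.1 + p.2 * (1 + p.1) ∧
      0 < 1 + p.1 - p.2 * (1 - p.1) := fun p hp => by
    obtain ⟨h1, h2, h3, h4⟩ := hp
    have h5 : 0 < 1 - p.1 + p.2 * (1 + p.1) :=
      add_pos (sub_pos.2 h2) (mul_pos h3 (by linarith))
    exact ⟨by linarith, h5, by linarith⟩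
  refine ⟨fun p hp => ?_, fun p hp => ?_, fun p hp => ?_, fun p hp => ?_, ?_, ?_⟩
  · obtain ⟨h5, h6, h7⟩ := hD p hp
    obtain ⟨h1, h2, h3, h4⟩ := C1_domain_iff.1 hp
    refine ⟨?_, ?_, h3, ?_⟩ <;> simp only [toModulus]
    · rw [lt_div_iff₀ h5]
      linarith
    · rw [div_lt_iff₀ h5]
      linarith
    · have e : 1 + (p.1 + p.2) / (1 - p.1 * p.2) - p.2 * (1 - (p.1 + p.2) / (1 - p.1 * p.2)) =
          (1 + p.1) * (1 + p.2 ^ 2) / (1 - p.1 * p.2) := by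
        have h8 := h5.ne'
        field_simp
        ring
      rw [← sub_pos, e]
      have h9 : 0 < 1 + p.1 := by linarith
      positivity
  · obtain ⟨h5, h6, h7⟩ := hN p hp
    obtain ⟨h1, h2, h3, h4⟩ := hp
    rw [C1_domain_iff]
    refine ⟨?_, ?_, h3, ?_⟩ <;> simp only [ofModulus]
    · rw [lt_div_iff₀ h5]
      linarith
    · rw [div_lt_iff₀ h5]
      linarith
    · have e : 1 - (p.1 - p.2) / (1 + p.1 * p.2) * p.2 - ((p.1 - p.2) / (1 + p.1 * p.2) + p.2) =
          (1 - p.1) * (1 + p.2 ^ 2) / (1 + p.1 * p.2) := by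
        field_simp
        ring
      rw [← sub_pos, e]
      have h9 : 0 < 1 - p.1 := by linarith
      positivity
  · have h5 := (hD p hp).1
    have h5' := h5.ne'
    have e1 : (p.1 + p.2) / (1 - p.1 * p.2) - p.2 = p.1 * (1 + p.2 ^ 2) / (1 - p.1 * p.2) := by
      field_simp
      ring
    have e2 : 1 + (p.1 + p.2) / (1 - p.1 * p.2) * p.2 = (1 + p.2 ^ 2) / (1 - p.1 * p.2) := by
      field_simp
      ring
    simp only [toModulus, ofModulus]
    rw [e1, e2, div_div_div_cancel_right₀ h5', mul_div_cancel_right₀ _ (by positivity)]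
  · have h5 := (hN p hp).1
    have e1 : (p.1 - p.2) / (1 + p.1 * p.2) + p.2 = p.1 * (1 + p.2 ^ 2) / (1 + p.1 * p.2) := by
      field_simp
      ring
    have e2 : 1 - (p.1 - p.2) / (1 + p.1 * p.2) * p.2 = (1 + p.2 ^ 2) / (1 + p.1 * p.2) := by
      field_simp
      ring
    simp only [toModulus, ofModulus]
    rw [e1, e2, div_div_div_cancel_right₀ h5.ne', mul_div_cancel_right₀ _ (by positivity)]
  · exact ContDiffOn.prodMk (ContDiffOn.div (by fun_prop) (by fun_prop)
      fun p hp => (hD p hp).1.ne') contDiffOn_snd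
  · exact ContDiffOn.prodMk (ContDiffOn.div (by fun_prop) (by fun_prop)
      fun p hp => (hN p hp).1.ne') contDiffOn_snd

/-- The maps of the classes `C2i` and `C2ii` have the same formulas on different domains. -/
theorem isSmoothPair_modulus_aux {U W : Set (ℝ × ℝ)}
    (hU : ∀ p ∈ U, 0 < p.1 ∧ p.1 < 1 ∧ 0 < p.2) (hW : ∀ p ∈ W, 0 < p.1 ∧ p.1 < p.2)
    (hUW : MapsTo C2i.toModulus U W) (hWU : MapsTo C2i.ofModulus W U) :
    IsSmoothPair C2i.toModulus C2i.ofModulus U W := by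
  refine ⟨hUW, hWU, fun p hp => ?_, fun p hp => ?_, ?_, ?_⟩
  · obtain ⟨h1, h2, h3⟩ := hU p hp
    simp only [toModulus, ofModulus]
    rw [mul_div_cancel_right₀ _ h3.ne', Real.sq_sqrt (by nlinarith), sub_sub_cancel,
      Real.sqrt_sq h1.le]
  · obtain ⟨h1, h2⟩ := hW p hp
    have h3 := h1.trans h2
    have h4 : p.1 / p.2 < 1 := (div_lt_one h3).2 h2
    have h5 : 0 < p.1 / p.2 := div_pos h1 h3
    simp only [toModulus, ofModulus]
    rw [Real.sq_sqrt (by nlinarith), sub_sub_cancel, Real.sqrt_sq h5.le, div_mul_cancel₀ _ h3.ne']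
  · refine ContDiffOn.prodMk (ContDiffOn.mul (ContDiffOn.sqrt (by fun_prop) fun p hp => ?_)
      contDiffOn_snd) contDiffOn_snd
    obtain ⟨h1, h2, h3⟩ := hU p hp
    nlinarith
  · refine ContDiffOn.prodMk (ContDiffOn.sqrt (contDiffOn_const.sub
      ((contDiffOn_fst.div contDiffOn_snd fun p hp => ?_).pow 2)) fun p hp => ?_) contDiffOn_snd
    · obtain ⟨h1, h2⟩ := hW p hp
      exact (h1.trans h2).ne'
    · obtain ⟨h1, h2⟩ := hW p hp
      have h3 := h1.trans h2
      have h4 : p.1 / p.2 < 1 := (div_lt_one h3).2 h2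
      have h5 : 0 < p.1 / p.2 := div_pos h1 h3
      nlinarith

theorem ofModulus_fst_mem {x b : ℝ} (h1 : 0 < x) (h2 : x < b) :
    0 < √(1 - (x / b) ^ 2) ∧ √(1 - (x / b) ^ 2) < 1 := by
  have h3 := h1.trans h2
  have h4 : x / b < 1 := (div_lt_one h3).2 h2
  have h5 : 0 < x / b := div_pos h1 h3
  refine ⟨Real.sqrt_pos.2 (by nlinarith), ?_⟩
  rw [Real.sqrt_lt' one_pos]
  nlinarith

theorem isSmoothPair_modulus_C2i :
    IsSmoothPair C2i.toModulus C2i.ofModulus C2i.domain C2i.modulusDomain := by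
  refine isSmoothPair_modulus_aux (fun p hp => ⟨hp.1, hp.2.1, hp.2.2.1⟩)
    (fun p hp => ⟨hp.1, hp.2.1⟩) (fun p hp => ?_) (fun p hp => ?_)
  · obtain ⟨h1, h2, h3, h4⟩ := hp
    have h5 := Real.sqrt_pos.2 (by nlinarith : 0 < 1 - p.1 ^ 2)
    have h6 : √(1 - p.1 ^ 2) < 1 := by
      rw [Real.sqrt_lt' one_pos]
      nlinarith
    refine ⟨mul_pos h5 h3, ?_, h4⟩
    simp only [toModulus]
    nlinarith
  · obtain ⟨h1, h2, h3⟩ := hp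
    obtain ⟨h4, h5⟩ := ofModulus_fst_mem h1 h2
    exact ⟨h4, h5, h1.trans h2, h3⟩

theorem isSmoothPair_modulus_C2ii :
    IsSmoothPair C2ii.toModulus C2ii.ofModulus C2ii.domain C2ii.modulusDomain := by
  refine isSmoothPair_modulus_aux (fun p hp => ⟨hp.1, hp.2.1, one_pos.trans hp.2.2.1⟩)
    (fun p hp => ⟨hp.1, hp.2.1.trans hp.2.2⟩) (fun p hp => ?_) (fun p hp => ?_)
  · obtain ⟨h1, h2, h3, h4⟩ := hp
    have h0 : 0 < 1 - p.1 ^ 2 := by nlinarith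
    refine ⟨mul_pos (Real.sqrt_pos.2 h0) (one_pos.trans h3), ?_, h3⟩
    refine lt_of_pow_lt_pow_left₀ 2 zero_le_one ?_
    simp only [toModulus]
    rwa [mul_pow, Real.sq_sqrt h0.le, one_pow]
  · obtain ⟨h1, h2, h3⟩ := hp
    have h6 := h2.trans h3
    obtain ⟨h4, h5⟩ := ofModulus_fst_mem h1 h6
    refine ⟨h4, h5, h3, ?_⟩
    have h7 : p.1 / p.2 < 1 := (div_lt_one (h1.trans h6)).2 h6
    have h8 : 0 < p.1 / p.2 := div_pos h1 (h1.trans h6)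
    simp only [ofModulus]
    rw [Real.sq_sqrt (by nlinarith), sub_sub_cancel, div_pow,
      div_mul_cancel₀ _ (pow_pos (h1.trans h6) 2).ne']
    nlinarith

theorem isSmoothPair_modulus_C3 :
    IsSmoothPair C3.toModulus C3.ofModulus C3.domain C3.modulusDomain := by
  have hN : ∀ p ∈ C3.modulusDomain, 0 < p.2 ^ 2 * p.1 ^ 2 - 1 := fun p hp => by
    obtain ⟨h1, h2, h3, h4⟩ := hp
    nlinarith
  refine ⟨fun p hp => ?_, fun p hp => ?_, fun p hp => ?_, fun p hp => ?_, ?_, ?_⟩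
  · obtain ⟨h1, h2, h3⟩ := hp
    have h4 : 0 < 4 * p.1 - 1 := by linarith
    have h5 : 1 < (4 * p.1 + 1) / (4 * p.1 - 1) := by
      rw [lt_div_iff₀ h4]
      linarith
    have h6 : 1 < √((4 * p.1 + 1) / (4 * p.1 - 1)) := Real.lt_sqrt_of_sq_lt (by linarith)
    have h7 : 0 < p.2 := one_pos.trans h2
    refine ⟨div_pos (one_pos.trans h6) h7, ?_, h2, ?_⟩
    · simp only [toModulus]
      rw [div_lt_one h7, Real.sqrt_lt' h7, div_lt_iff₀ h4]
      linarith
    · simp only [toModulus]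
      rwa [mul_div_cancel₀ _ h7.ne']
  · have h5 := hN p hp
    obtain ⟨h1, h2, h3, h4⟩ := hp
    refine ⟨?_, h3, ?_⟩ <;> simp only [ofModulus]
    · rw [lt_div_iff₀ (by positivity)]
      linarith
    · have : 4 * ((p.2 ^ 2 * p.1 ^ 2 + 1) / (4 * (p.2 ^ 2 * p.1 ^ 2 - 1))) * (p.2 ^ 2 - 1) -
          (p.2 ^ 2 + 1) = 2 * p.2 ^ 2 * (1 - p.1 ^ 2) / (p.2 ^ 2 * p.1 ^ 2 - 1) := by
        field_simp
        ring
      rw [this]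
      have h6 : 0 < 1 - p.1 ^ 2 := by nlinarith
      positivity
  · obtain ⟨h1, h2, h3⟩ := hp
    have h4 : 0 < 4 * p.1 - 1 := by linarith
    have h5 : 0 ≤ (4 * p.1 + 1) / (4 * p.1 - 1) := div_nonneg (by linarith) h4.le
    have h7 : 0 < p.2 := one_pos.trans h2
    simp only [toModulus, ofModulus]
    rw [div_pow, mul_div_cancel₀ _ (pow_pos h7 2).ne', Real.sq_sqrt h5]
    have e1 : (4 * p.1 + 1) / (4 * p.1 - 1) + 1 = 8 * p.1 / (4 * p.1 - 1) := by
      field_simp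
      ring
    have e2 : 4 * ((4 * p.1 + 1) / (4 * p.1 - 1) - 1) = 8 / (4 * p.1 - 1) := by
      field_simp
      ring
    rw [e1, e2, div_div_div_cancel_right₀ h4.ne', mul_div_cancel_left₀ _ (by norm_num)]
  · have h5 := hN p hp
    obtain ⟨h1, h2, h3, h4⟩ := hp
    have h7 : 0 < p.2 := one_pos.trans h3
    simp only [toModulus, ofModulus]
    have e : (4 * ((p.2 ^ 2 * p.1 ^ 2 + 1) / (4 * (p.2 ^ 2 * p.1 ^ 2 - 1))) + 1) /
        (4 * ((p.2 ^ 2 * p.1 ^ 2 + 1) / (4 * (p.2 ^ 2 * p.1 ^ 2 - 1))) - 1) = (p.2 * p.1) ^ 2 := by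
      have e1 : 4 * ((p.2 ^ 2 * p.1 ^ 2 + 1) / (4 * (p.2 ^ 2 * p.1 ^ 2 - 1))) + 1 =
          (p.2 * p.1) ^ 2 * (2 / (p.2 ^ 2 * p.1 ^ 2 - 1)) := by
        field_simp
        ring
      have e2 : 4 * ((p.2 ^ 2 * p.1 ^ 2 + 1) / (4 * (p.2 ^ 2 * p.1 ^ 2 - 1))) - 1 =
          2 / (p.2 ^ 2 * p.1 ^ 2 - 1) := by
        field_simp
        ring
      rw [e1, e2, mul_div_cancel_right₀ _ (by positivity)]
    rw [e, Real.sqrt_sq (by positivity), mul_div_cancel_left₀ _ h7.ne']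
  · refine ContDiffOn.prodMk (ContDiffOn.div (ContDiffOn.sqrt (ContDiffOn.div (by fun_prop)
      (by fun_prop) fun p hp => ?_) fun p hp => ?_) contDiffOn_snd fun p hp => ?_) contDiffOn_snd
    · have := hp.1
      linarith
    · have := hp.1
      have h4 : 0 < 4 * p.1 - 1 := by linarith
      exact (div_pos (by linarith) h4).ne'
    · exact (one_pos.trans hp.2.1).ne'
  · refine ContDiffOn.prodMk (ContDiffOn.div (by fun_prop) (by fun_prop) fun p hp => ?_)
      contDiffOn_snd
    exact mul_ne_zero (by norm_num) (hN p hp).ne'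

theorem isSmoothPair_modulus_C4 :
    IsSmoothPair C4.toModulus C4.ofModulus C4.domain C4.modulusDomain := by
  refine ⟨fun p hp => ?_, fun p hp => ?_, fun p hp => ?_, fun p hp => ?_, ?_, ?_⟩
  · obtain ⟨h1, h2, h3, h4⟩ := hp
    have h0 : 0 < 1 - p.1 ^ 2 := by nlinarith
    have h5 := Real.sqrt_pos.2 h0
    refine ⟨by simp only [toModulus]; positivity, ?_, h3⟩
    simp only [toModulus]
    rw [div_lt_one h1]
    refine lt_of_pow_lt_pow_left₀ 2 h1.le ?_
    rw [mul_pow, Real.sq_sqrt h0.le]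
    linarith
  · obtain ⟨h1, h2, h3⟩ := hp
    have h4 : 0 < p.2 ^ 2 + p.1 ^ 2 := by positivity
    have h5 := Real.sqrt_pos.2 h4
    have h6 : p.2 < √(p.2 ^ 2 + p.1 ^ 2) := Real.lt_sqrt_of_sq_lt (by nlinarith)
    refine ⟨div_pos h3 h5, (div_lt_one h5).2 h6, h3, ?_⟩
    simp only [ofModulus]
    rw [div_pow, Real.sq_sqrt h4.le]
    have : p.2 ^ 2 / (p.2 ^ 2 + p.1 ^ 2) + (p.2 ^ 2 / (p.2 ^ 2 + p.1 ^ 2) - 1) * p.2 ^ 2 =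
        p.2 ^ 2 * (1 - p.1 ^ 2) / (p.2 ^ 2 + p.1 ^ 2) := by
      field_simp
      ring
    rw [this]
    have h7 : 0 < 1 - p.1 ^ 2 := by nlinarith
    positivity
  · obtain ⟨h1, h2, h3, h4⟩ := hp
    have h0 : 0 < 1 - p.1 ^ 2 := by nlinarith
    simp only [toModulus, ofModulus]
    rw [div_pow, mul_pow, Real.sq_sqrt h0.le]
    have e : p.2 ^ 2 + (1 - p.1 ^ 2) * p.2 ^ 2 / p.1 ^ 2 = (p.2 / p.1) ^ 2 := by
      field_simp
      ring
    rw [e, Real.sqrt_sq (by positivity), div_div_cancel₀ h3.ne']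
  · obtain ⟨h1, h2, h3⟩ := hp
    have h4 : 0 < p.2 ^ 2 + p.1 ^ 2 := by positivity
    have h5 := Real.sqrt_pos.2 h4
    simp only [toModulus, ofModulus]
    rw [div_pow, Real.sq_sqrt h4.le]
    have e : 1 - p.2 ^ 2 / (p.2 ^ 2 + p.1 ^ 2) = p.1 ^ 2 / (p.2 ^ 2 + p.1 ^ 2) := by
      field_simp
      ring
    rw [e, Real.sqrt_div (sq_nonneg _), Real.sqrt_sq h1.le]
    ext
    · simp only
      field_simp
    · rfl
  · refine ContDiffOn.prodMk (ContDiffOn.div (ContDiffOn.mul (ContDiffOn.sqrt (by fun_prop)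
      fun p hp => ?_) contDiffOn_snd) contDiffOn_fst fun p hp => hp.1.ne') contDiffOn_snd
    obtain ⟨h1, h2, h3, h4⟩ := hp
    nlinarith
  · refine ContDiffOn.prodMk (ContDiffOn.div contDiffOn_snd (ContDiffOn.sqrt (by fun_prop)
      fun p hp => ?_) fun p hp => ?_) contDiffOn_snd
    · have := hp.1
      positivity
    · have := hp.1
      positivity

theorem isSmoothPair_modulus (c : RegularClass) :
    IsSmoothPair c.toModulus c.ofModulus c.domain c.modulusDomain := by
  cases c
  exacts [isSmoothPair_modulus_C1, isSmoothPair_modulus_C2i, isSmoothPair_modulus_C2ii,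
    isSmoothPair_modulus_C3, isSmoothPair_modulus_C4]

theorem isOpen_domain (c : RegularClass) : IsOpen c.domain := by
  have f {g h : ℝ × ℝ → ℝ} (hg : Continuous g) (hh : Continuous h) : IsOpen {p | g p < h p} :=
    isOpen_lt hg hh
  cases c
  · exact (f (by fun_prop) (by fun_prop)).inter ((f (by fun_prop) (by fun_prop)).inter
      ((f (by fun_prop) (by fun_prop)).inter (f (by fun_prop) (by fun_prop))))
  · exact (f (by fun_prop) (by fun_prop)).inter ((f (by fun_prop) (by fun_prop)).inter
      ((f (by fun_prop) (by fun_prop)).inter (f (by fun_prop) (by fun_prop))))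
  · exact (f (by fun_prop) (by fun_prop)).inter ((f (by fun_prop) (by fun_prop)).inter
      ((f (by fun_prop) (by fun_prop)).inter (f (by fun_prop) (by fun_prop))))
  · exact (f (by fun_prop) (by fun_prop)).inter ((f (by fun_prop) (by fun_prop)).inter
      (f (by fun_prop) (by fun_prop)))
  · exact (f (by fun_prop) (by fun_prop)).inter ((f (by fun_prop) (by fun_prop)).inter
      ((f (by fun_prop) (by fun_prop)).inter (f (by fun_prop) (by fun_prop))))

/-- The stratum is the preimage, in the half-plane `k > 0`, of the open range of `(K, w)`. -/
theorem isOpen_stratum (c : RegularClass) : IsOpen c.stratum := by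
  have f {g h : ℝ × ℝ → ℝ} (hg : Continuous g) (hh : Continuous h) : IsOpen {p | g p < h p} :=
    isOpen_lt hg hh
  have hopen : IsOpen c.invariantDomain := by
    cases c
    · exact (f (by fun_prop) (by fun_prop)).inter ((f (by fun_prop) (by fun_prop)).inter
        (f (by fun_prop) (by fun_prop)))
    · exact (f (by fun_prop) (by fun_prop)).inter (f (by fun_prop) (by fun_prop))
    · exact (f (by fun_prop) (by fun_prop)).inter ((f (by fun_prop) (by fun_prop)).inter
        (f (by fun_prop) (by fun_prop)))
    · exact (f (by fun_prop) (by fun_prop)).inter ((f (by fun_prop) (by fun_prop)).inter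
        ((f (by fun_prop) (by fun_prop)).inter (f (by fun_prop) (by fun_prop))))
    · exact (f (by fun_prop) (by fun_prop)).inter (f (by fun_prop) (by fun_prop))
  have e : c.stratum = {q : ℝ × ℝ | 0 < q.1} ∩ ofCurvature ⁻¹' c.invariantDomain := by
    ext q
    exact ⟨fun hq => ⟨stratum_fst_pos hq, (ofCurvature_mem_iff (stratum_fst_pos hq)).2 hq⟩,
      fun hq => (ofCurvature_mem_iff hq.1).1 hq.2⟩
  rw [e]
  refine (f (by fun_prop) (by fun_prop)).inter (hopen.preimage ?_)
  unfold ofCurvature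
  fun_prop

theorem isDiffeoOn_curvatures (c : RegularClass) : IsDiffeoOn c.curvatures c.domain c.stratum :=
  (((c.isSmoothPair_modulus.trans c.isSmoothPair_square).trans c.isSmoothPair_invariant).trans
    c.isSmoothPair_curvature).isDiffeoOn c.isOpen_domain c.isOpen_stratum

/-! ### The canonical frames of the model curves -/

/-- The relations between the curvatures `(k, h)` of a model curve, the coefficients of the
characteristic polynomial of its generator, and the scalar products of its derivatives. The
number `L` is the square of the ratio of the conformal parameter to `t`. -/
theorem exists_speed {c : RegularClass} {a b : ℝ} (hp : (a, b) ∈ c.domain) :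
    0 < (c.curvatures (a, b)).1 ∧ 0 < c.momentOne a b ∧ ∃ L : ℝ, 0 < L ∧
      2 * (c.curvatures (a, b)).2 * L * c.momentOne a b = -c.momentTwo a b ∧
      ((c.curvatures (a, b)).1 ^ 2 + 2 * (c.curvatures (a, b)).2) * L = c.coeffThree b ∧
      (1 + 2 * (c.curvatures (a, b)).2 * (c.curvatures (a, b)).1 ^ 2) * L ^ 2 = c.coeffOne b := by
  have hx := c.isSmoothPair_modulus.mapsTo hp
  have hK := invariantDomain_fst_pos
    (c.isSmoothPair_invariant.mapsTo (c.isSmoothPair_square.mapsTo hx))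
  have e1 : (c.curvatures (a, b)).1 =
      √(c.toInvariant (c.toSquare (c.toModulus (a, b)))).1 := rfl
  have e2 : 2 * (c.curvatures (a, b)).2 =
      (c.toInvariant (c.toSquare (c.toModulus (a, b)))).1 -
      (c.toInvariant (c.toSquare (c.toModulus (a, b)))).2 :=
    mul_div_cancel₀ _ two_ne_zero
  rw [e2, e1, Real.sq_sqrt hK.le]
  refine ⟨Real.sqrt_pos.2 hK, ?_⟩
  clear e1 e2 hK
  cases c
  · have hm : a + b = (C1.toModulus (a, b)).1 * (1 - a * b) := by
      obtain ⟨h1, h2, h3, h4⟩ := C1_domain_iff.1 hp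
      have h5 : 1 - a * b ≠ 0 := by
        simp only at h1 h2 h3 h4
        nlinarith [mul_pos h3 (sub_pos.2 h2)]
      exact (div_mul_cancel₀ _ h5).symm
    have hD : 1 - a * b ≠ 0 := by
      intro h
      obtain ⟨h1, h2, h3, h4⟩ := C1_domain_iff.1 hp
      simp only at h1 h2 h3 h4
      nlinarith [mul_pos h3 (sub_pos.2 h2)]
    have hb : (C1.toModulus (a, b)).2 = b := rfl
    simp only [momentOne, momentTwo, coeffThree, coeffOne, toInvariant, toSquare, hb]
    rw [hm]
    obtain ⟨h1, h2, h3, -⟩ := hx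
    rw [hb] at h3
    generalize (C1.toModulus (a, b)).1 = m at h1 h2 ⊢
    generalize 1 - a * b = D at hD ⊢
    have h4 : 0 < 1 - m ^ 2 := by nlinarith
    refine ⟨?_, 2 * b * (1 + m ^ 2) / (1 - m ^ 2), by positivity, ?_, ?_, ?_⟩
    · have : 2 * (D ^ 2 - (m * D) ^ 2) = 2 * D ^ 2 * (1 - m ^ 2) := by ring
      rw [this]
      positivity
    all_goals
      field_simp
      ring
  · have hxe : (1 - a ^ 2) * b ^ 2 = (C2i.toModulus (a, b)).1 ^ 2 := by
      simp only [toModulus]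
      rw [mul_pow, Real.sq_sqrt (one_sub_sq_pos hp (by simp)).le]
    have hb : (C2i.toModulus (a, b)).2 = b := rfl
    simp only [momentOne, momentTwo, coeffThree, coeffOne, toInvariant, toSquare, hb]
    rw [show (1 - a ^ 2) * b ^ 4 = (1 - a ^ 2) * b ^ 2 * b ^ 2 by ring, hxe]
    obtain ⟨h1, h2, h3⟩ := hx
    rw [hb] at h2 h3
    generalize (C2i.toModulus (a, b)).1 = x at h1 h2 ⊢
    have h4 : 0 < 1 - x ^ 2 := by nlinarith
    have h5 : 0 < 1 - b ^ 2 := by nlinarith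
    refine ⟨h4, x * (1 - b ^ 2) / (1 - x ^ 2), by positivity, ?_, ?_, ?_⟩
    all_goals
      field_simp
      ring
  · have hxe : (1 - a ^ 2) * b ^ 2 = (C2ii.toModulus (a, b)).1 ^ 2 := by
      simp only [toModulus]
      rw [mul_pow, Real.sq_sqrt (one_sub_sq_pos hp (by simp)).le]
    have hb : (C2ii.toModulus (a, b)).2 = b := rfl
    simp only [momentOne, momentTwo, coeffThree, coeffOne, toInvariant, toSquare, hb]
    rw [show (1 - a ^ 2) * b ^ 4 = (1 - a ^ 2) * b ^ 2 * b ^ 2 by ring, hxe]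
    obtain ⟨h1, h2, h3⟩ := hx
    rw [hb] at h3
    generalize (C2ii.toModulus (a, b)).1 = x at h1 h2 ⊢
    have h4 : 0 < 1 - x ^ 2 := by nlinarith
    have h5 : 0 < b ^ 2 - 1 := by nlinarith
    refine ⟨h4, x * (b ^ 2 - 1) / (1 - x ^ 2), by positivity, ?_, ?_, ?_⟩
    all_goals
      field_simp
      ring
  · have hxe : 4 * a + 1 = (4 * a - 1) * (b ^ 2 * (C3.toModulus (a, b)).1 ^ 2) := by
      obtain ⟨h1, h2, -⟩ := hp
      simp only at h1 h2
      have h3 : 0 < 4 * a - 1 := by linarith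
      have h4 : b ≠ 0 := (one_pos.trans h2).ne'
      simp only [toModulus]
      rw [div_pow, Real.sq_sqrt (div_nonneg (by linarith) h3.le)]
      field_simp
    have hu : 0 < 4 * a - 1 := by
      have := hp.1
      simp only at this
      linarith
    have hb : (C3.toModulus (a, b)).2 = b := rfl
    simp only [momentOne, momentTwo, coeffThree, coeffOne, toInvariant, toSquare, hb]
    rw [hxe]
    obtain ⟨h1, h2, h3, -⟩ := hx
    rw [hb] at h3
    generalize (C3.toModulus (a, b)).1 = x at h1 h2 ⊢
    generalize 4 * a - 1 = u at hu ⊢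
    have h4 : 0 < 1 - x ^ 2 := by nlinarith
    have h5 : 0 < b ^ 2 - 1 := by nlinarith
    refine ⟨?_, x * (b ^ 2 - 1) / (1 - x ^ 2), by positivity, ?_, ?_, ?_⟩
    · have : (u * b ^ 2 - u * (b ^ 2 * x ^ 2)) / 2 = u * b ^ 2 * (1 - x ^ 2) / 2 := by ring
      rw [this]
      positivity
    all_goals
      field_simp
      ring
  · have hxe : (1 - a ^ 2) * b ^ 2 = a ^ 2 * (C4.toModulus (a, b)).1 ^ 2 := by
      have h1 : a ≠ 0 := hp.1.ne'
      simp only [toModulus]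
      rw [div_pow, mul_pow, Real.sq_sqrt (one_sub_sq_pos hp (by simp)).le]
      field_simp
    have ha : a ≠ 0 := hp.1.ne'
    have hb : (C4.toModulus (a, b)).2 = b := rfl
    simp only [momentOne, momentTwo, coeffThree, coeffOne, toInvariant, toSquare, hb]
    rw [show (1 - a ^ 2) * b ^ 4 = (1 - a ^ 2) * b ^ 2 * b ^ 2 by ring, hxe]
    obtain ⟨h1, h2, h3⟩ := hx
    rw [hb] at h3
    generalize (C4.toModulus (a, b)).1 = x at h1 h2 ⊢
    have h4 : 0 < 1 - x ^ 2 := by nlinarith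
    refine ⟨?_, x * (b ^ 2 + 1) / (1 - x ^ 2), by positivity, ?_, ?_, ?_⟩
    · have : a ^ 2 - a ^ 2 * x ^ 2 = a ^ 2 * (1 - x ^ 2) := by ring
      rw [this]
      positivity
    all_goals
      field_simp
      ring

/-- A model curve in the standard basis has a Frenet frame with constant speed. -/
theorem exists_frame_std {c : RegularClass} {p : ℝ × ℝ} (hp : p ∈ c.domain) :
    ∃ (l r : ℝ) (M : ℝ → Fin 5 → V), 0 < l ∧ 0 < r ∧
      IsFrenetFrame M univ (fun _ => l) (c.curvatures p).1 (c.curvatures p).2 ∧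
      ∀ t, M t 0 = r • c.combine (c.coords p.1 p.2 t) := by
  obtain ⟨a, b⟩ := p
  obtain ⟨hk, hμ, L, hL, e1, e2, e3⟩ := exists_speed hp
  obtain ⟨m0, m1, m2⟩ := moments_zero hp
  have hl := Real.sqrt_pos.2 hL
  have hl2 := Real.sq_sqrt hL.le
  have hr := Real.sqrt_pos.2 (div_pos hL hμ)
  have hr2 := Real.sq_sqrt (div_pos hL hμ).le
  refine ⟨√L, √(L / c.momentOne a b), _, hl, hr, isFrenetFrame_krylovFrame
    (Y := fun n t => c.combine ((c.gen b)^[n] (c.coords a b t))) (c₁ := c.coeffThree b)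
    (c₀ := c.coeffOne b) (μ₁ := c.momentOne a b) (μ₂ := c.momentTwo a b) hr hl hk ?_ ?_ ?_
    m0 m1 m2 ?_ ?_ ?_ ?_ (vol_zero_neg hp) (timeArea_zero_pos hp), fun t => rfl⟩
  · intro n t
    have h1 : ∀ n, HasDerivAt (fun t => (c.gen b)^[n] (c.coords a b t))
        ((c.gen b)^[n + 1] (c.coords a b t)) t := by
      intro n
      induction n with
      | zero => exact c.hasDerivAt_coords a b t
      | succ n ih =>
        simp only [Function.iterate_succ_apply'] at ih ⊢
        exact (LinearMap.toContinuousLinearMap (c.gen b)).hasFDerivAt.comp_hasDerivAt t ih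
    exact (LinearMap.toContinuousLinearMap c.combine).hasFDerivAt.comp_hasDerivAt t (h1 n)
  · intro m n t
    simp only [Function.iterate_succ_apply']
    exact c.gen_skew b _ _
  · intro t
    simp only [gen_cayley, map_neg, map_add, map_smul, Function.iterate_one]
  · rw [hr2, hl2]
    field_simp
  · rw [hl2, e1]
  · rw [hl2, e2]
  · rw [show √L ^ 4 = (√L ^ 2) ^ 2 by ring, hl2, e3]

/-- A frame whose first vector is a positive multiple of `y` is a frame along the projection of
`y` to the Einstein universe. -/
theorem isFrenetFrameAlong_proj {M : ℝ → Fin 5 → V} {lam : ℝ → ℝ} {k h r : ℝ} {y : ℝ → V}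
    (hM : IsFrenetFrame M univ lam k h) (hr : 0 < r) (hy : ∀ t, M t 0 = r • y t) :
    IsFrenetFrameAlong (fun t => proj (y t)) M univ lam k h ∧ ∀ t, proj (y t) ∈ einstein := by
  have hy' : ∀ t, y t = r⁻¹ • M t 0 := fun t => by
    rw [hy, smul_smul, inv_mul_cancel₀ hr.ne', one_smul]
  have hnull : ∀ t, ip (y t) (y t) = 0 := fun t => by
    rw [hy', ip_smul_left, ip_smul_right, (hM.mobius t trivial).ip_zero_zero]
    ring
  have hne : ∀ t, y t ≠ 0 := fun t h0 => by
    have := (hM.mobius t trivial).ip_zero_four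
    rw [hy, h0] at this
    simp [ip] at this
  have hsm : ContDiffOn ℝ ∞ y univ := by
    rw [show y = fun t => r⁻¹ • M t 0 from funext hy']
    exact (hM.smooth_apply 0).const_smul r⁻¹
  have hpos := fun t => sq_add_sq_pos_of_null (hne t) (hnull t)
  refine ⟨⟨hM, fun t => (√(y t 0 ^ 2 + y t 1 ^ 2))⁻¹ * r⁻¹, ?_, fun t _ => ?_, fun t _ => ?_⟩,
    fun t => (proj_spec (hne t) (hnull t)).1⟩
  · rw [contDiffOn_pi] at hsm
    exact ((((hsm 0).pow 2).add ((hsm 1).pow 2)).sqrt fun t _ => (hpos t).ne').inv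
      (fun t _ => (Real.sqrt_pos.2 (hpos t)).ne') |>.mul contDiffOn_const
  · exact mul_pos (inv_pos.2 (Real.sqrt_pos.2 (hpos t))) (inv_pos.2 hr)
  · rw [mul_smul, ← hy', proj]

/-- The canonical frames of the model curves with given parameters: they are the images, under the
restricted conformal group, of a single field of frames. -/
theorem exists_frame {c : RegularClass} {p : ℝ × ℝ} (hp : p ∈ c.domain) :
    ∃ (l : ℝ) (M : ℝ → Fin 5 → V), 0 < l ∧ (∀ t, IsMobiusBasis (M t)) ∧
      ∀ F : V ≃ₗ[ℝ] V, IsAutomorphism F →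
        IsFrenetFrameAlong (c.model p fun i => F (c.stdBasis i)) (fun t i => F (M t i)) univ
          (fun _ => l) (c.curvatures p).1 (c.curvatures p).2 ∧
        ∀ t, c.model p (fun i => F (c.stdBasis i)) t ∈ einstein := by
  obtain ⟨l, r, M, hl, hr, hM, hM0⟩ := exists_frame_std hp
  refine ⟨l, M, hl, fun t => hM.mobius t trivial, fun F hF => ?_⟩
  refine isFrenetFrameAlong_proj (hM.map hF) hr fun t => ?_
  rw [hM0, map_smul, combine_apply, map_sum]
  simp only [map_smul]

theorem IsBasis.exists_eq {c : RegularClass} {B : Fin 5 → V} (hB : c.IsBasis B) :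
    ∃ F : V ≃ₗ[ℝ] V, IsAutomorphism F ∧ B = fun i => F (c.stdBasis i) := by
  obtain ⟨F, hF, h⟩ := c.isBasis_stdBasis.exists_automorphism hB
  exact ⟨F, hF, funext fun i => (h i).symm⟩

end RegularClass

/-! ### Homogeneous curves -/

theorem isOpenInterval_univ : IsOpenInterval univ :=
  ⟨isOpen_univ, ordConnected_univ, univ_nonempty⟩

theorem IsFrenetFrame.congr_speed {M : ℝ → Fin 5 → V} {I : Set ℝ} {lam lam' : ℝ → ℝ} {k h : ℝ}
    (hM : IsFrenetFrame M I lam k h) (e : ∀ t ∈ I, lam' t = lam t) :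
    IsFrenetFrame M I lam' k h :=
  ⟨hM.smooth, hM.speed_smooth.congr e, fun t ht => (e t ht).symm ▸ hM.speed_pos t ht, hM.mobius,
    fun t ht j => (e t ht).symm ▸ hM.frenet t ht j⟩

theorem IsFrenetFrameAlong.eq_proj {γ : ℝ → V} {M : ℝ → Fin 5 → V} {I : Set ℝ} {lam : ℝ → ℝ}
    {k h : ℝ} (hM : IsFrenetFrameAlong γ M I lam k h) {t : ℝ} (ht : t ∈ I)
    (hmem : γ t ∈ einstein) : γ t = proj (M t 0) := by
  obtain ⟨ρ, -, hpos, e⟩ := hM.exists_scale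
  rw [← proj_eq_self hmem, e t ht, proj_smul (hpos t ht)]

namespace RegularClass

variable {c : RegularClass} {γ : ℝ → V} {I : Set ℝ} {p : ℝ × ℝ}

/-- The strain density of a model curve is constant, so its total strain is infinite in both
directions. -/
theorem model_isGeneric_maximal (hp : p ∈ c.domain) {B : Fin 5 → V} (hB : c.IsBasis B) :
    HasConstantCurvatures (c.model p B) univ (c.curvatures p) ∧
      IsMaximalCurve (c.model p B) univ := by
  obtain ⟨l, M, hl, -, H⟩ := exists_frame hp
  obtain ⟨F, hF, rfl⟩ := hB.exists_eq
  obtain ⟨H1, H2⟩ := H F hF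
  have hc := H1.hasConstantCurvatures isOpenInterval_univ fun t _ => H2 t
  refine ⟨hc, isMaximalCurve_of_strain hc.1.1 hl contDiffOn_id (fun s _ => ?_)
    (fun x _ => ⟨x, trivial, rfl⟩) fun s _ => ?_⟩
  · simp
  · rw [H1.strainDensity_eq isOpen_univ trivial]
    simp

/-- If a timelike curve is parametrized as a model curve, then the change of parameter is
increasing. -/
theorem IsModelParam.deriv_pos (hγ : IsTimelikeCurve γ I) (hp : p ∈ c.domain)
    {B : Fin 5 → V} {f : ℝ → ℝ} (h : c.IsModelParam γ I p B f) : ∀ s ∈ I, 0 < deriv f s :=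
  fun _ hs => deriv_pos_of_comp hγ (model_isGeneric_maximal hp h.1).1.1.1 h.2.1.smooth
    (fun _ _ => trivial) h.2.2 hs

/-- A homogeneous curve of the class, parametrized in a basis as a model curve, has the
transported canonical frame. -/
theorem IsModelParam.frame (hγ : IsTimelikeCurve γ I) (hp : p ∈ c.domain) {l : ℝ}
    {M : ℝ → Fin 5 → V} {F : V ≃ₗ[ℝ] V} {f : ℝ → ℝ}
    (hM : IsFrenetFrameAlong (c.model p fun i => F (c.stdBasis i)) (fun t i => F (M t i)) univ
          (fun _ => l) (c.curvatures p).1 (c.curvatures p).2)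
    (h : c.IsModelParam γ I p (fun i => F (c.stdBasis i)) f) :
    IsFrenetFrameAlong γ (fun s i => F (M (f s) i)) I (fun s => l * deriv f s)
      (c.curvatures p).1 (c.curvatures p).2 :=
  hM.comp hγ.interval.isOpen h.2.1.smooth (fun _ _ => trivial)
    (IsModelParam.deriv_pos hγ hp h) h.2.2

/-- The parameters of a homogeneous curve are determined by its curvatures. -/
theorem IsModelParam.curvatures_eq {kh : ℝ × ℝ} (hγ : HasConstantCurvatures γ I kh)
    (hp : p ∈ c.domain) {B : Fin 5 → V} {f : ℝ → ℝ} (h : c.IsModelParam γ I p B f) :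
    c.curvatures p = kh := by
  obtain ⟨N, hN⟩ := hγ.exists_frame
  obtain ⟨l, M, hl, -, H⟩ := exists_frame hp
  obtain ⟨F, hF, rfl⟩ := h.1.exists_eq
  have hM := IsModelParam.frame hγ.1.1 hp (H F hF).1 h
  have hI := hγ.1.1.interval
  obtain ⟨s, hs⟩ := hI.nonempty
  obtain ⟨-, h1, h2⟩ := hN.unique hI.isOpen hM hs
  exact Prod.ext h1 h2

/-- A homogeneous curve with the curvatures of a model curve is a reparametrized model curve, in
exactly one basis once the parameter `0` is attached to a point `s₀`. The isometry taking the
canonical frame of the model at `0` to that of the curve at `s₀` provides the basis, and the ratio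
of the strain densities is the derivative of the change of parameter. -/
theorem exists_modelParam {kh : ℝ × ℝ} (hγ : HasConstantCurvatures γ I kh)
    (hp : p ∈ c.domain) (hk : c.curvatures p = kh) {s₀ : ℝ} (hs₀ : s₀ ∈ I) :
    ∃! B : Fin 5 → V, ∃ f : ℝ → ℝ, c.IsModelParam γ I p B f ∧ f s₀ = 0 := by
  obtain ⟨N, hN⟩ := hγ.exists_frame
  obtain ⟨l, M, hl, hMm, H⟩ := exists_frame hp
  have hI := hγ.1.1.interval
  obtain ⟨F, hF, hFM⟩ := (hMm 0).exists_automorphism (hN.mobius s₀ hs₀)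
  obtain ⟨H1, H2⟩ := H F hF
  obtain ⟨f, hf, hfd, hf0⟩ := exists_smooth_primitive hI
    (hN.speed_smooth.div (contDiffOn_const (c := l)) fun _ _ => hl.ne') hs₀
  have hfpos : ∀ s ∈ I, 0 < deriv f s := fun s hs => by
    rw [hfd s hs]
    exact div_pos (hN.speed_pos s hs) hl
  refine ⟨fun i => F (c.stdBasis i), ⟨f, ⟨c.isBasis_stdBasis.map hF,
    isParamChange_of_deriv_pos hI hf hfpos, fun s hs => ?_⟩, hf0⟩, ?_⟩
  · have h1 := H1.toIsFrenetFrame.comp hI.isOpen hf (fun _ _ => trivial) hfpos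
    have h2 : IsFrenetFrame (fun s i => F (M (f s) i)) I (strainDensity γ) kh.1 kh.2 := by
      rw [← hk]
      refine h1.congr_speed fun t ht => ?_
      rw [hfd t ht, Pi.div_apply]
      exact (mul_div_cancel₀ _ hl.ne').symm
    have h3 := h2.eq_of_eq hI hN.toIsFrenetFrame hs₀ (by funext i; simp only [hf0, hFM]) hs
    rw [hN.eq_proj hs (hγ.1.1.mem s hs), ← h3, H1.eq_proj trivial (H2 _)]
  · rintro B ⟨g, hg, hg0⟩
    obtain ⟨F', hF', rfl⟩ := hg.1.exists_eq
    have h1 := (hN.unique hI.isOpen (IsModelParam.frame hγ.1.1 hp (H F' hF').1 hg) hs₀).1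
    have h2 : ∀ i, F' (M 0 i) = F (M 0 i) := fun i => by
      rw [hFM]
      simpa only [hg0] using congrFun h1 i
    have h3 : (F' : V →ₗ[ℝ] V) = F := by
      refine (basisOfLinearIndependentOfCardEqFinrank
        (linearIndependent_of_vol_ne (hMm 0).orientation.ne') (by simp)).ext fun i => ?_
      simpa using h2 i
    funext i
    exact congrArg (fun G : V →ₗ[ℝ] V => G (c.stdBasis i)) h3

/-- Model curves in different bases differ by a conformal transformation. -/
theorem model_map (hp : p ∈ c.domain) {F : V ≃ₗ[ℝ] V} (t : ℝ) :
    c.model p (fun i => F (c.stdBasis i)) t = proj (F (c.model p c.stdBasis t)) := by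
  obtain ⟨l, r, M, hl, hr, hM, hM0⟩ := exists_frame_std hp
  have hm := hM.mobius t trivial
  have e : c.combine (c.coords p.1 p.2 t) = r⁻¹ • M t 0 := by
    rw [hM0, smul_smul, inv_mul_cancel₀ hr.ne', one_smul]
  have h0 : ip (c.combine (c.coords p.1 p.2 t)) (c.combine (c.coords p.1 p.2 t)) = 0 := by
    rw [e, ip_smul_left, ip_smul_right, hm.ip_zero_zero]
    ring
  have hne : c.combine (c.coords p.1 p.2 t) ≠ 0 := fun h => by
    have := hm.ip_zero_four
    rw [hM0, h] at this
    simp [ip] at this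
  have := proj_map_proj F hne h0
  rw [combine_apply, map_sum] at this
  simp only [map_smul] at this
  exact this.symm

theorem conformallyEquivalent_iff (hp : p ∈ c.domain) :
    ConformallyEquivalent γ I (c.model p c.stdBasis) univ ↔
      ∃ B f, c.IsModelParam γ I p B f ∧ f '' I = univ := by
  constructor
  · rintro ⟨F, f, hF, hf, h⟩
    refine ⟨fun i => F (c.stdBasis i), f, ⟨c.isBasis_stdBasis.map hF, ?_, fun s hs => ?_⟩,
      hf.bijOn.image_eq⟩
    · rwa [hf.bijOn.image_eq]
    · rw [h s hs, model_map hp]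
  · rintro ⟨B, f, ⟨hB, hf, h⟩, e⟩
    obtain ⟨F, hF, rfl⟩ := hB.exists_eq
    rw [e] at hf
    exact ⟨F, f, hF, hf, fun s hs => by rw [h s hs, model_map hp]⟩

end RegularClass

end EinsteinUniverse

open EinsteinUniverse
theorem theorem8 (c : RegularClass) :
    -- parametrization in adapted bases, for every homogeneous curve of the class
    (∀ (γ : ℝ → V) (I : Set ℝ) (kh : ℝ × ℝ), kh ∈ c.stratum → HasConstantCurvatures γ I kh →
      ∃ p ∈ c.domain,
        (∀ s₀ ∈ I, ∃! B : Fin 5 → V, ∃ f : ℝ → ℝ, c.IsModelParam γ I p B f ∧ f s₀ = 0) ∧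
        (∀ q ∈ c.domain, ∀ B f, c.IsModelParam γ I q B f → q = p) ∧
        (IsMaximalCurve γ I → ∀ B f, c.IsModelParam γ I p B f → f '' I = Set.univ)) ∧
    -- the model curves are homogeneous, and their curvatures give a diffeomorphism
    (∃ Φ : ℝ × ℝ → ℝ × ℝ,
      (∀ p ∈ c.domain, ∀ B : Fin 5 → V, c.IsBasis B →
        HasConstantCurvatures (c.model p B) Set.univ (Φ p) ∧
          IsMaximalCurve (c.model p B) Set.univ) ∧
      IsDiffeoOn Φ c.domain c.stratum) ∧
    -- classification up to conformal equivalence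
    (∀ (γ : ℝ → V) (I : Set ℝ), IsGenericCurve γ I →
      (((∃ kh ∈ c.stratum, HasConstantCurvatures γ I kh) ∧ IsMaximalCurve γ I) ↔
        ∃! p : ℝ × ℝ, p ∈ c.domain ∧
          ConformallyEquivalent γ I (c.model p c.stdBasis) Set.univ)) := by
  have hΦ := c.isDiffeoOn_curvatures
  have part1 : ∀ (γ : ℝ → V) (I : Set ℝ) (kh : ℝ × ℝ), kh ∈ c.stratum →
      HasConstantCurvatures γ I kh → ∃ p ∈ c.domain,
        (∀ s₀ ∈ I, ∃! B : Fin 5 → V, ∃ f : ℝ → ℝ, c.IsModelParam γ I p B f ∧ f s₀ = 0) ∧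
        (∀ q ∈ c.domain, ∀ B f, c.IsModelParam γ I q B f → q = p) ∧
        (IsMaximalCurve γ I → ∀ B f, c.IsModelParam γ I p B f → f '' I = Set.univ) := by
    intro γ I kh hkh hγ
    obtain ⟨p, hp, hpk⟩ := hΦ.bijOn.surjOn hkh
    refine ⟨p, hp, fun s₀ hs₀ => RegularClass.exists_modelParam hγ hp hpk hs₀,
      fun q hq B f h => hΦ.bijOn.injOn hq hp ?_, fun hmax B f h => ?_⟩
    · rw [RegularClass.IsModelParam.curvatures_eq hγ hq h, hpk]
    · exact hmax _ univ (f '' I) f (RegularClass.model_isGeneric_maximal hp h.1).1.1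
        (subset_univ _) h.2.1 h.2.2
  refine ⟨part1, ⟨c.curvatures, fun p hp B hB => RegularClass.model_isGeneric_maximal hp hB, hΦ⟩,
    fun γ I hγ => ⟨?_, ?_⟩⟩
  · rintro ⟨⟨kh, hkh, hc⟩, hmax⟩
    obtain ⟨p, hp, h1, h2, h3⟩ := part1 γ I kh hkh hc
    obtain ⟨s₀, hs₀⟩ := hγ.1.interval.nonempty
    obtain ⟨B, ⟨f, hf, -⟩, -⟩ := h1 s₀ hs₀
    refine ⟨p, ⟨hp, (RegularClass.conformallyEquivalent_iff hp).2 ⟨B, f, hf, h3 hmax B f hf⟩⟩, ?_⟩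
    rintro q ⟨hq, hqe⟩
    obtain ⟨B', f', h', -⟩ := (RegularClass.conformallyEquivalent_iff hq).1 hqe
    exact h2 q hq B' f' h'
  · rintro ⟨p, ⟨hp, he⟩, -⟩
    obtain ⟨B, f, hf, hsurj⟩ := (RegularClass.conformallyEquivalent_iff hp).1 he
    obtain ⟨l, M, hl, -, H⟩ := RegularClass.exists_frame hp
    obtain ⟨F, hF, rfl⟩ := hf.1.exists_eq
    have hM := RegularClass.IsModelParam.frame hγ.1 hp (H F hF).1 hf
    refine ⟨⟨c.curvatures p, hΦ.bijOn.mapsTo hp,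
      hM.hasConstantCurvatures hγ.1.interval hγ.1.mem⟩, ?_⟩
    exact isMaximalCurve_of_strain hγ.1 hl hf.2.1.smooth
      (RegularClass.IsModelParam.deriv_pos hγ.1 hp hf)
      (fun x _ => hsurj ▸ mem_univ x)
      fun s hs => hM.strainDensity_eq hγ.1.interval.isOpen hs
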